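/- Fix an arbitrary map $m:\,]0,1]\to\mathbb R_{\ge 0}\cup\{\infty\}$. **Graphs.** A graph has a finite vertex set, countably many directed edges and weights in $]0,1]$. The execution $F::G$ has vertex set $V^F\mathbin{\Delta}V^G$; its edges are the nonempty paths alternating between edges of $F$ and edges of $G$ with source and target in $V^F\mathbin{\Delta}V^G$, weighted by the product of the weights. Put $[F,G]=\sum_\pi m(\omega(\pi))$, where $\pi$ runs over the alternating cycles of $F,G$ up to cyclic permutation that are not proper powers. **Projects.** A project $\mathfrak a=(a,A)$ of carrier $V$ is a wager $a\in\mathbb R\cup\{\infty\}$ and a finite nonempty weighted family $A=\sum_i\alpha_iA_i$ ($\alpha_i\in\mathbb R$) of graphs on $V$; $1_A=\sum_i\alpha_i$, and execution and $[\cdot,\cdot]$ are extended bilinearly, any sum or product containing $\infty$ being $\infty$. Put $\ll\mathfrak a,\mathfrak b\gg=a1_B+1_Ab+[A,B]$ and $\mathfrak a::\mathfrak b=(\ll\mathfrak a,\mathfrak b\gg,A::B)$, also written $\mathfrak a\otimes\mathfrak b$ when the carriers are disjoint. $\mathfrak 0_V$ is the project of wager $0$ whose only slice is the graph without edges on $V$,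 with coefficient $1$. Projects of the same carrier are orthogonal when $\ll\mathfrak a,\mathfrak b\gg\ne 0,\infty$. **Conducts.** A conduct is a set $\mathbf A$ of projects of a fixed finite carrier $V^A$ with $\mathbf A=\mathbf A^{\perp\perp}$; $\mathbf 0_V=\emptyset$, $\mathbf T_V$ is the set of all projects of carrier $V$, $\mathbf 1_V=\{\mathfrak 0_V\}^{\perp\perp}$. For disjoint carriers put $\mathbf A\otimes\mathbf B=\{\mathfrak a\otimes\mathfrak b\}^{\perp\perp}$, $\mathbf A⅋\mathbf B=(\mathbf A^\perp\otimes\mathbf B^\perp)^\perp$, $\mathbf A\multimap\mathbf B=\{\mathfrak f \text{ of carrier } V^A\cup V^B : \forall\mathfrak a\in\mathbf A,\ \mathfrak f::\mathfrak a\in\mathbf B\}$, and, with $\mathbf A_{\uparrow V}=\{\mathfrak a\otimes\mathfrak 0_V : \mathfrak a\in\mathbf A\}$, $\mathbf A\oplus\mathbf B=((\mathbf A_{\uparrow V^B})^{\perp\perp}\cup(\mathbf B_{\uparrow V^A})^{\perp\perp})^{\perp\perp}$ and $\mathbf A\mathbin{\&}\mathbf B=((\mathbf A^\perp)_{\uparrow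 V^B})^\perp\cap((\mathbf B^\perp)_{\uparrow V^A})^\perp$. A conduct is a behaviour when $\mathbf A$ and $\mathbf A^\perp$ are closed under $\mathfrak a\mapsto\mathfrak a+\lambda\mathfrak 0_{V^A}$ for all $\lambda\in\mathbb R$. It is proper when it is non-empty, closed under these maps, and all its projects have wager $0$. **Categories.** Let $\psi_i(x)=(x,i)$ and $\phi(x,i)=2x+i$, for $x\in\mathbb N$, $i\in\{0,1\}$. Let $\mathbf{Cond}$ have as objects the conducts of carrier included in $\mathbb N$, and as morphisms $\mathbf A\to\mathbf B$ the classes of projects $\mathfrak f\in\psi_0(\mathbf A)\multimap\psi_1(\mathbf B)$ modulo observational equivalence: $\mathfrak f\cong\mathfrak f'$ iff $\ll\mathfrak f,\mathfrak c\gg=\ll\mathfrak f',\mathfrak c\gg$ for all $\mathfrak c\in(\psi_0(\mathbf A)\multimap\psi_1(\mathbf B))^\perp$. Composition is induced by the relocated execution $\mathfrak f::\mathfrak g$, and identities are the classes of the graphs with edges $(x,0)\leftrightarrows(x,1)$ of weight $1$, $x\in V^A$. For each connective put $\mathbf A\,\bar\square\,\mathbf B=\phi(\psi_0(\mathbf A)\mathbin\square\psi_1(\mathbf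 B))$. **Proposition.** 1. $\mathbf{Cond}$ is a category. It is $\ast$-autonomous for $\bar\otimes$ (on morphisms, the relocated tensor product of projects), with unit $\mathbf 1_\emptyset$, internal hom $\bar\multimap$, dualizing object $\bot_\emptyset=\mathbf 1_\emptyset^\perp$ and dual $\mathbf A^\perp$ up to isomorphism. 2. Its full subcategory $\mathbf{Beh}$ of behaviours is closed under $\bar\otimes$, $\bar\multimap$ and $(\cdot)^\perp$. 3. In $\mathbf{Beh}$, $\mathbf A\,\bar{\&}\,\mathbf B$ is a product and $\mathbf A\,\bar\oplus\,\mathbf B$ is a coproduct. The projections and the injections are the classes of the (relocated) identity of one component tensored with $\mathfrak 0$ on the carrier of the other. Moreover $\mathbf T_\emptyset$ is terminal, $\mathbf 0_\emptyset$ is initial, and these two are not isomorphic. 4. Mix does not hold: if $\mathbf A,\mathbf B$ are proper behaviours, $\mathfrak a\in\mathbf A$ and $\mathfrak b\in\mathbf B$, then the relocated tensor product of $\mathfrak a$ and $\mathfrak b$ is not in $\mathbf A\,\bar⅋\,\mathbf B$. Also, $\mathbf{Cond}$ has no morphism $\bot_\emptyset\to\mathbf 1_\emptyset$. 5. Weakening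 does not hold: if $\mathbf A,\mathbf B$ are conducts, $\mathbf A\ne\emptyset$, $\mathbf B^\perp\neq\emptyset$, $\mathbf C$ is a non-empty behaviour and $\mathfrak f\in\psi_0(\mathbf A)\multimap\psi_1(\mathbf B)$, then the relocated project $\mathfrak f\otimes\mathfrak 0_{V^C}$ does not represent a morphism $\mathbf A\bar\otimes\mathbf C\to\mathbf B$. Also, $\mathbf{Cond}$ has no morphism $\mathbf C\to\mathbf 1_\emptyset$. 6. The model is non-degenerate: $\mathbf A\bar\otimes\mathbf B\neq\mathbf A\,\bar⅋\,\mathbf B$ for some behaviours $\mathbf A,\mathbf B$, and for all proper $\mathbf A,\mathbf B$ both $\mathbf A\bar\otimes\mathbf B\ne\mathbf A\,\bar⅋\,\mathbf B$ and $\mathbf A\bar\otimes\mathbf B\neq\mathbf A\,\bar{\&}\,\mathbf B$. 7. Every proper conduct (as defined above) is a behaviour, and proper behaviours of carrier included in $\mathbb N$ exist if and only if $m$ takes a value in $]0,\infty[$. -/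

import Mathlib

open CategoryTheory CategoryTheory.Limits
open scoped ENNReal MonoidalCategory

noncomputable section

namespace IG

/-! ### Graphs, alternating paths and circuits, execution -/

/-- The set `]0,1]` of weights. -/
abbrev Weight : Type := Set.Ioc (0 : ℝ) 1

/-- Directed weighted graphs with a finite set of vertices in `L` and a finite or countably
infinite set of edges. -/
structure Graph (L : Type) where
  verts : Finset L
  E : Type
  countable : Countable E
  src : E → L
  tgt : E → L
  src_mem : ∀ e, src e ∈ verts
  tgt_mem : ∀ e, tgt e ∈ verts
  weight : E → Weight

namespace Graph

variable {L L' : Type}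

/-- Edges of the plugging of `F` and `G`: the colour of an edge is its side in the sum. -/
abbrev PlugE (F G : Graph L) : Type := F.E ⊕ G.E

def plugSrc (F G : Graph L) : PlugE F G → L := Sum.elim F.src G.src
def plugTgt (F G : Graph L) : PlugE F G → L := Sum.elim F.tgt G.tgt
def plugWeight (F G : Graph L) : PlugE F G → Weight := Sum.elim F.weight G.weight

/-- `e'` may follow `e` in an alternating path: `s(e') = t(e)`, and the colours differ. -/
def Follows (F G : Graph L) (e e' : PlugE F G) : Prop :=
  plugSrc F G e' = plugTgt F G e ∧ e.isLeft ≠ e'.isLeft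

/-- Alternating paths (nonempty sequences of edges) with source and target in `W`. -/
def IsAltPath (F G : Graph L) (W : Finset L) (l : List (PlugE F G)) : Prop :=
  l.IsChain (Follows F G) ∧
    ∃ h : l ≠ [], plugSrc F G (l.head h) ∈ W ∧ plugTgt F G (l.getLast h) ∈ W

/-- The edges of the execution. -/
def ExecE [DecidableEq L] (F G : Graph L) : Type :=
  {l : List (PlugE F G) // IsAltPath F G (symmDiff F.verts G.verts) l}

/-- The execution `F :: G`. -/
def exec [DecidableEq L] (F G : Graph L) : Graph L where
  verts := symmDiff F.verts G.verts
  E := ExecE F G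
  countable := by
    have := F.countable
    have := G.countable
    unfold ExecE
    infer_instance
  src l := plugSrc F G (l.1.head l.2.2.1)
  tgt l := plugTgt F G (l.1.getLast l.2.2.1)
  src_mem l := l.2.2.2.1
  tgt_mem l := l.2.2.2.2
  weight l := (l.1.map (plugWeight F G)).prod

/-- Alternating `1`-circuits: nonempty alternating cycles, up to cyclic permutation
(`Cycle` is the type of lists up to rotation, and `Cycle.Chain` also relates the last element
to the first one), that are not a proper power `ρ ^ k`. -/
def IsOneCircuit (F G : Graph L) (c : Cycle (PlugE F G)) : Prop :=
  c ≠ Cycle.nil ∧ c.Chain (Follows F G) ∧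
    ∀ (ρ : List (PlugE F G)) (k : ℕ), ((List.replicate k ρ).flatten : Cycle (PlugE F G)) = c → k = 1

/-- The weight of a circuit. -/
def circuitWeight (F G : Graph L) (c : Cycle (PlugE F G)) : Weight :=
  (c.toMultiset.map (plugWeight F G)).prod

/-- The measurement `[F, G]_m`. -/
def meas (m : Weight → ℝ≥0∞) (F G : Graph L) : ℝ≥0∞ :=
  ∑' c : {c : Cycle (PlugE F G) // IsOneCircuit F G c}, m (circuitWeight F G c.1)

/-- Delocation along a map that is injective on the set of vertices. -/
def map [DecidableEq L'] (θ : L → L') (F : Graph L) : Graph L' where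
  verts := F.verts.image θ
  E := F.E
  countable := F.countable
  src e := θ (F.src e)
  tgt e := θ (F.tgt e)
  src_mem e := Finset.mem_image_of_mem θ (F.src_mem e)
  tgt_mem e := Finset.mem_image_of_mem θ (F.tgt_mem e)
  weight := F.weight

/-- The graph without edges on `V`. -/
def empty (V : Finset L) : Graph L where
  verts := V
  E := Empty
  countable := inferInstance
  src := Empty.elim
  tgt := Empty.elim
  src_mem e := e.elim
  tgt_mem e := e.elim
  weight := Empty.elim

/-- The graph with, for each `x ∈ S`, one edge `p x → q x` and one edge `q x → p x`, all of
weight `1`. -/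
def fax {K : Type} [DecidableEq L] (S : Finset K) (p q : K → L) : Graph L where
  verts := S.image p ∪ S.image q
  E := S ⊕ S
  countable := inferInstance
  src := Sum.elim (fun x => p x.1) (fun x => q x.1)
  tgt := Sum.elim (fun x => q x.1) (fun x => p x.1)
  src_mem := by
    rintro (x | x)
    · exact Finset.mem_union_left _ (Finset.mem_image_of_mem p x.2)
    · exact Finset.mem_union_right _ (Finset.mem_image_of_mem q x.2)
  tgt_mem := by
    rintro (x | x)
    · exact Finset.mem_union_right _ (Finset.mem_image_of_mem q x.2)
    · exact Finset.mem_union_left _ (Finset.mem_image_of_mem p x.2)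
  weight _ := 1

end Graph

/-! ### Projects -/

/-- Multiplication of an element of `ℝ ∪ {∞}` by a real number, with `r · ∞ = ∞` for every `r`
(also for `r = 0`). The addition of `WithTop ℝ` already satisfies `x + ∞ = ∞`. -/
def mulTop (r : ℝ) (x : WithTop ℝ) : WithTop ℝ := x.map (fun y => r * y)

/-- The inclusion of `ℝ≥0 ∪ {∞}` in `ℝ ∪ {∞}`. -/
def ennToTop (x : ℝ≥0∞) : WithTop ℝ := if x = ∞ then ⊤ else ((x.toReal : ℝ) : WithTop ℝ)

/-- Projects: a wager in `ℝ ∪ {∞}` together with a sliced graph, i.e. a finite (nonempty)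
family of graphs on the same set of vertices, with real coefficients. -/
structure Project (L : Type) where
  wager : WithTop ℝ
  carrier : Finset L
  I : Type
  [fintype : Fintype I]
  [nonempty : Nonempty I]
  coeff : I → ℝ
  slice : I → Graph L
  slice_verts : ∀ i, (slice i).verts = carrier

attribute [instance] Project.fintype Project.nonempty

namespace Project

variable {L L' : Type}

/-- The sum of the coefficients of the slices. -/
def unit (a : Project L) : ℝ := ∑ i, a.coeff i

/-- The measurement of the sliced graphs of two projects. -/
def meas (m : Weight → ℝ≥0∞) (a b : Project L) : WithTop ℝ :=
  ∑ p : a.I × b.I,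
    mulTop (a.coeff p.1 * b.coeff p.2) (ennToTop (Graph.meas m (a.slice p.1) (b.slice p.2)))

/-- The measurement `⟪a, b⟫ = a 1_B + 1_A b + [A, B]`. -/
def sca (m : Weight → ℝ≥0∞) (a b : Project L) : WithTop ℝ :=
  mulTop b.unit a.wager + mulTop a.unit b.wager + meas m a b

/-- The cut `f :: g`. -/
def cut [DecidableEq L] (m : Weight → ℝ≥0∞) (f g : Project L) : Project L where
  wager := sca m f g
  carrier := symmDiff f.carrier g.carrier
  I := f.I × g.I
  coeff p := f.coeff p.1 * g.coeff p.2
  slice p := (f.slice p.1).exec (g.slice p.2)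
  slice_verts p := by simp [Graph.exec, f.slice_verts, g.slice_verts]

/-- The tensor product of two projects of disjoint carriers: there, the execution is the
union of graphs. -/
abbrev tensor [DecidableEq L] (m : Weight → ℝ≥0∞) (a b : Project L) : Project L := cut m a b

/-- Delocation of a project. -/
def map [DecidableEq L'] (θ : L → L') (a : Project L) : Project L' where
  wager := a.wager
  carrier := a.carrier.image θ
  I := a.I
  coeff := a.coeff
  slice i := (a.slice i).map θ
  slice_verts i := by simp [Graph.map, a.slice_verts]

/-- The project with wager `w` and a single slice `G`, of coefficient `1`. -/
def single (w : WithTop ℝ) (G : Graph L) : Project L where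
  wager := w
  carrier := G.verts
  I := Unit
  coeff _ := 1
  slice _ := G
  slice_verts _ := rfl

/-- The project `0_V`. -/
def zero (V : Finset L) : Project L := single 0 (Graph.empty V)

/-- The project `Fax`. -/
def fax {K : Type} [DecidableEq L] (S : Finset K) (p q : K → L) : Project L :=
  single 0 (Graph.fax S p q)

/-- The project `a + r b`, for projects of the same carrier. -/
def addSmul (a : Project L) (r : ℝ) (b : Project L) (h : b.carrier = a.carrier) : Project L where
  wager := a.wager + mulTop r b.wager
  carrier := a.carrier
  I := a.I ⊕ b.I
  coeff := Sum.elim a.coeff (fun j => r * b.coeff j)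
  slice := Sum.elim a.slice b.slice
  slice_verts := by
    rintro (i | j)
    · exact a.slice_verts i
    · exact (b.slice_verts j).trans h

/-- Orthogonality of projects: `⟪a, b⟫ ≠ 0, ∞`. -/
def Perp (m : Weight → ℝ≥0∞) (a b : Project L) : Prop := sca m a b ≠ 0 ∧ sca m a b ≠ ⊤

end Project

/-- The orthogonal, among the projects of carrier `V`, of a set of projects. -/
def orthSet {L : Type} (m : Weight → ℝ≥0∞) (V : Finset L) (S : Set (Project L)) :
    Set (Project L) :=
  {b | b.carrier = V ∧ ∀ a ∈ S, a.Perp m b}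

/-! ### Basic facts that the definitions below need: orthogonality is symmetric and it is
invariant under delocation -/

section Facts

variable {L L' : Type}

theorem Graph.plug_swap (F G : Graph L) (e : Graph.PlugE F G) :
    Graph.plugSrc G F e.swap = Graph.plugSrc F G e ∧
      Graph.plugTgt G F e.swap = Graph.plugTgt F G e ∧
      Graph.plugWeight G F e.swap = Graph.plugWeight F G e := by
  rcases e with e | e <;> exact ⟨rfl, rfl, rfl⟩

theorem Graph.follows_swap (F G : Graph L) (e e' : Graph.PlugE F G) :
    Graph.Follows G F e.swap e'.swap ↔ Graph.Follows F G e e' := by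
  rcases e with e | e <;> rcases e' with e' | e' <;>
    simp [Graph.Follows, Graph.plugSrc, Graph.plugTgt]

theorem Graph.map_swap_swap {α β : Type} (c : Cycle (α ⊕ β)) :
    Cycle.map Sum.swap (Cycle.map Sum.swap c) = c := by
  induction c using Quotient.inductionOn' with
  | _ l =>
    change ((List.map Sum.swap (List.map Sum.swap l) : List _) : Cycle (α ⊕ β)) = (l : Cycle _)
    simp

theorem Graph.isOneCircuit_swap {F G : Graph L} {c : Cycle (Graph.PlugE F G)}
    (h : Graph.IsOneCircuit F G c) : Graph.IsOneCircuit G F (c.map Sum.swap) := by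
  obtain ⟨h1, h2, h3⟩ := h
  refine ⟨?_, ?_, ?_⟩
  · intro h
    apply h1
    have := congrArg (Cycle.map Sum.swap) h
    rw [Graph.map_swap_swap] at this
    simpa using this
  · rw [Cycle.chain_map]
    simpa only [Graph.follows_swap] using h2
  · intro ρ k hk
    apply h3 (ρ.map Sum.swap) k
    have := congrArg (Cycle.map Sum.swap) hk
    rw [Graph.map_swap_swap, Cycle.map_coe, List.map_flatten, List.map_replicate] at this
    exact this

theorem Graph.meas_comm (m : Weight → ℝ≥0∞) (F G : Graph L) :
    Graph.meas m F G = Graph.meas m G F := by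
  unfold Graph.meas
  let e : {c : Cycle (Graph.PlugE F G) // Graph.IsOneCircuit F G c} ≃
      {c : Cycle (Graph.PlugE G F) // Graph.IsOneCircuit G F c} :=
    { toFun := fun c => ⟨c.1.map Sum.swap, Graph.isOneCircuit_swap c.2⟩
      invFun := fun c => ⟨c.1.map Sum.swap, Graph.isOneCircuit_swap c.2⟩
      left_inv := fun c => Subtype.ext (Graph.map_swap_swap c.1)
      right_inv := fun c => Subtype.ext (Graph.map_swap_swap c.1) }
  rw [← e.tsum_eq]
  refine tsum_congr fun c => ?_
  congr 1
  obtain ⟨c, hc⟩ := c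
  change Graph.circuitWeight F G c = Graph.circuitWeight G F (c.map Sum.swap)
  clear hc
  induction c using Quotient.inductionOn' with
  | _ l =>
    change ((l : Multiset _).map (Graph.plugWeight F G)).prod =
      (((l.map Sum.swap : List _) : Multiset _).map (Graph.plugWeight G F)).prod
    simp only [Multiset.map_coe, Multiset.prod_coe, List.map_map]
    congr 1
    refine List.map_congr_left fun x _ => ?_
    exact ((Graph.plug_swap F G x).2.2).symm

theorem Project.sca_comm (m : Weight → ℝ≥0∞) (a b : Project L) :
    a.sca m b = b.sca m a := by
  unfold Project.sca Project.meas
  rw [add_comm (mulTop b.unit a.wager)]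
  congr 1
  refine Fintype.sum_equiv (Equiv.prodComm _ _) _ _ fun p => ?_
  simp only [Equiv.prodComm_apply, Prod.fst_swap, Prod.snd_swap]
  rw [mul_comm, Graph.meas_comm]

theorem Project.perp_comm (m : Weight → ℝ≥0∞) (a b : Project L) :
    a.Perp m b ↔ b.Perp m a := by
  unfold Project.Perp
  rw [Project.sca_comm]

theorem orthSet_anti (m : Weight → ℝ≥0∞) (V : Finset L) {S T : Set (Project L)} (h : S ⊆ T) :
    orthSet m V T ⊆ orthSet m V S := fun _ hb => ⟨hb.1, fun a ha => hb.2 a (h ha)⟩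

theorem subset_orthSet_orthSet (m : Weight → ℝ≥0∞) (V : Finset L) {S : Set (Project L)}
    (h : ∀ a ∈ S, a.carrier = V) : S ⊆ orthSet m V (orthSet m V S) :=
  fun a ha => ⟨h a ha, fun b hb => (Project.perp_comm m a b).1 (hb.2 a ha)⟩

/-- The orthogonal of a set of projects of carrier `V` is equal to its bi-orthogonal. -/
theorem orthSet_closed (m : Weight → ℝ≥0∞) (V : Finset L) {S : Set (Project L)}
    (h : ∀ a ∈ S, a.carrier = V) :
    orthSet m V (orthSet m V (orthSet m V S)) = orthSet m V S :=
  Set.Subset.antisymm (orthSet_anti m V (subset_orthSet_orthSet m V h))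
    (subset_orthSet_orthSet m V fun _ ha => ha.1)

theorem Graph.meas_map [DecidableEq L'] (m : Weight → ℝ≥0∞) {θ : L → L'}
    (hθ : Function.Injective θ) (F G : Graph L) :
    Graph.meas m (F.map θ) (G.map θ) = Graph.meas m F G := by
  have hs : ∀ e, Graph.plugSrc (F.map θ) (G.map θ) e = θ (Graph.plugSrc F G e) := by
    rintro (e | e) <;> rfl
  have ht : ∀ e, Graph.plugTgt (F.map θ) (G.map θ) e = θ (Graph.plugTgt F G e) := by
    rintro (e | e) <;> rfl
  have hf : Graph.Follows (F.map θ) (G.map θ) = Graph.Follows F G := by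
    funext e e'
    simp only [Graph.Follows, hs, ht, hθ.eq_iff]
    rfl
  have hc : Graph.IsOneCircuit (F.map θ) (G.map θ) = Graph.IsOneCircuit F G := by
    funext c
    unfold Graph.IsOneCircuit
    rw [hf]
    rfl
  unfold Graph.meas
  exact (Equiv.subtypeEquivRight (fun c => by rw [hc]) :
    {c // Graph.IsOneCircuit (F.map θ) (G.map θ) c} ≃ {c // Graph.IsOneCircuit F G c}).tsum_eq
      (fun c => m (Graph.circuitWeight F G c.1))

theorem Project.sca_map [DecidableEq L'] (m : Weight → ℝ≥0∞) {θ : L → L'}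
    (hθ : Function.Injective θ) (a b : Project L) :
    (a.map θ).sca m (b.map θ) = a.sca m b := by
  have : Project.meas m (a.map θ) (b.map θ) = Project.meas m a b := by
    unfold Project.meas
    refine Finset.sum_congr rfl fun p _ => ?_
    rw [← Graph.meas_map m hθ (a.slice p.1)]
    rfl
  unfold Project.sca
  rw [this]
  rfl

theorem Project.exists_map_eq [DecidableEq L] [DecidableEq L'] [Nonempty L] {θ : L → L'} (hθ : Function.Injective θ)
    {V : Finset L} {b : Project L'} (hb : b.carrier = V.image θ) :
    ∃ a : Project L, a.carrier = V ∧ a.map θ = b := by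
  have hinv : ∀ x ∈ V.image θ, θ (Function.invFun θ x) = x := by
    intro x hx
    obtain ⟨y, -, rfl⟩ := Finset.mem_image.1 hx
    rw [Function.leftInverse_invFun hθ]
  have hG : ∀ G : Graph L', G.verts = V.image θ → (G.map (Function.invFun θ)).map θ = G := by
    intro G hG
    obtain ⟨verts, E, cE, src, tgt, hs, ht, w⟩ := G
    obtain rfl : verts = V.image θ := hG
    unfold Graph.map
    have h1 : ((V.image θ).image (Function.invFun θ)).image θ = V.image θ := by
      rw [Finset.image_image, Finset.image_image]
      refine Finset.image_congr fun x _ => ?_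
      simp [Function.leftInverse_invFun hθ x]
    have h2 : (fun e => θ (Function.invFun θ (src e))) = src := funext fun e => hinv _ (hs e)
    have h3 : (fun e => θ (Function.invFun θ (tgt e))) = tgt := funext fun e => hinv _ (ht e)
    simp only [h1, h2, h3]
  have hV : (V.image θ).image (Function.invFun θ) = V := by
    rw [Finset.image_image, (Function.leftInverse_invFun hθ).comp_eq_id, Finset.image_id]
  refine ⟨b.map (Function.invFun θ), ?_, ?_⟩
  · change b.carrier.image _ = V
    rw [hb, hV]
  · obtain ⟨w, carrier, I, coeff, slice, hs⟩ := b
    obtain rfl : carrier = V.image θ := hb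
    unfold Project.map
    have h1 : ((V.image θ).image (Function.invFun θ)).image θ = V.image θ := by rw [hV]
    have h2 : (fun i => ((slice i).map (Function.invFun θ)).map θ) = slice :=
      funext fun i => hG _ (hs i)
    simp only [h1, h2]

theorem orthSet_map [DecidableEq L] [DecidableEq L'] [Nonempty L] (m : Weight → ℝ≥0∞) {θ : L → L'}
    (hθ : Function.Injective θ) (V : Finset L) (S : Set (Project L)) :
    orthSet m (V.image θ) (Project.map θ '' S) = Project.map θ '' orthSet m V S := by
  ext b
  constructor
  · rintro ⟨hb, h⟩
    obtain ⟨a, ha, rfl⟩ := Project.exists_map_eq hθ hb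
    refine ⟨a, ⟨ha, fun c hc => ?_⟩, rfl⟩
    have := h _ ⟨c, hc, rfl⟩
    unfold Project.Perp at this ⊢
    rwa [Project.sca_map m hθ] at this
  · rintro ⟨a, ⟨ha, h⟩, rfl⟩
    refine ⟨congrArg (Finset.image θ) ha, ?_⟩
    rintro _ ⟨c, hc, rfl⟩
    have := h c hc
    unfold Project.Perp at this ⊢
    rwa [Project.sca_map m hθ]

theorem Project.cut_carrier [DecidableEq L] (m : Weight → ℝ≥0∞) {V W : Finset L}
    (h : Disjoint V W) {a b : Project L} (ha : a.carrier = V) (hb : b.carrier = W) :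
    (a.cut m b).carrier = V ∪ W := by
  change symmDiff a.carrier b.carrier = _
  rw [ha, hb, h.symmDiff_eq_sup]
  rfl

end Facts

/-! ### Conducts and connectives -/

/-- A conduct: a finite carrier and a set of projects of that carrier that is equal to its
bi-orthogonal. -/
@[ext] structure Conduct (m : Weight → ℝ≥0∞) (L : Type) where
  carrier : Finset L
  projects : Set (Project L)
  closed : orthSet m carrier (orthSet m carrier projects) = projects

namespace Conduct

variable {m : Weight → ℝ≥0∞} {L L' : Type}

theorem carrier_eq (A : Conduct m L) {a : Project L} (ha : a ∈ A.projects) :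
    a.carrier = A.carrier := by
  rw [← A.closed] at ha
  exact ha.1

/-- The orthogonal `A^⊥`. -/
def orth (A : Conduct m L) : Conduct m L where
  carrier := A.carrier
  projects := orthSet m A.carrier A.projects
  closed := orthSet_closed m _ fun _ ha => A.carrier_eq ha

/-- The conduct `S^⊥⊥` of carrier `V` generated by a set `S` of projects of carrier `V`. -/
def gen (m : Weight → ℝ≥0∞) (V : Finset L) (S : Set (Project L)) : Conduct m L where
  carrier := V
  projects := orthSet m V (orthSet m V S)
  closed := orthSet_closed m _ fun _ ha => ha.1

/-- The delocation `θ(A)`. -/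
def deloc [DecidableEq L] [DecidableEq L'] [Nonempty L] (θ : L → L') (hθ : Function.Injective θ) (A : Conduct m L) :
    Conduct m L' where
  carrier := A.carrier.image θ
  projects := Project.map θ '' A.projects
  closed := by rw [orthSet_map m hθ, orthSet_map m hθ, A.closed]

/-- The empty conduct `0_V`. -/
def zero (m : Weight → ℝ≥0∞) (V : Finset L) : Conduct m L where
  carrier := V
  projects := ∅
  closed := by
    refine Set.eq_empty_of_forall_notMem fun b hb => ?_
    refine (hb.2 (Project.single ⊤ (Graph.empty V)) ⟨rfl, fun _ h => h.elim⟩).2 ?_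
    simp [Project.sca, Project.single, mulTop]

/-- The conduct `T_V` of all projects of carrier `V`. -/
def full (m : Weight → ℝ≥0∞) (V : Finset L) : Conduct m L where
  carrier := V
  projects := {a | a.carrier = V}
  closed := Set.Subset.antisymm (fun _ ha => ha.1)
    (subset_orthSet_orthSet m V fun _ ha => ha)

/-- The conduct `1_V`. -/
def one (m : Weight → ℝ≥0∞) (V : Finset L) : Conduct m L := gen m V {Project.zero V}

variable [DecidableEq L]

/-- `A ⊗ B`, for disjoint carriers. -/
def tensor (A B : Conduct m L) (_ : Disjoint A.carrier B.carrier) : Conduct m L :=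
  gen m (A.carrier ∪ B.carrier) {c | ∃ a ∈ A.projects, ∃ b ∈ B.projects, c = a.tensor m b}

/-- The set of projects `A ⊸ B`, for disjoint carriers. -/
def limp (A B : Conduct m L) : Set (Project L) :=
  {f | f.carrier = A.carrier ∪ B.carrier ∧ ∀ a ∈ A.projects, f.cut m a ∈ B.projects}

/-- The set `A↑W` of the projects `a ⊗ 0_W`, `a ∈ A`. -/
def up (A : Conduct m L) (W : Finset L) : Set (Project L) :=
  {c | ∃ a ∈ A.projects, c = a.tensor m (Project.zero W)}

/-- `A ⊕ B`, for disjoint carriers. -/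
def plus (A B : Conduct m L) (_ : Disjoint A.carrier B.carrier) : Conduct m L :=
  gen m (A.carrier ∪ B.carrier)
    ((gen m (A.carrier ∪ B.carrier) (A.up B.carrier)).projects ∪
      (gen m (A.carrier ∪ B.carrier) (B.up A.carrier)).projects)

/-- `A & B`, for disjoint carriers. -/
def amp (A B : Conduct m L) (h : Disjoint A.carrier B.carrier) : Conduct m L where
  carrier := A.carrier ∪ B.carrier
  projects := orthSet m (A.carrier ∪ B.carrier) (A.orth.up B.carrier) ∩
    orthSet m (A.carrier ∪ B.carrier) (B.orth.up A.carrier)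
  closed := by
    have h1 : ∀ (V : Finset L) (S T : Set (Project L)),
        orthSet m V S ∩ orthSet m V T = orthSet m V (S ∪ T) := by
      intro V S T
      ext b
      constructor
      · rintro ⟨h1, h2⟩
        exact ⟨h1.1, fun a ha => ha.elim (h1.2 a) (h2.2 a)⟩
      · intro hb
        exact ⟨⟨hb.1, fun a ha => hb.2 a (Or.inl ha)⟩, ⟨hb.1, fun a ha => hb.2 a (Or.inr ha)⟩⟩
    rw [h1]
    refine orthSet_closed m _ ?_
    rintro _ (⟨a, ha, rfl⟩ | ⟨b, hb, rfl⟩)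
    · exact Project.cut_carrier m h (A.orth.carrier_eq ha) rfl
    · rw [Finset.union_comm]
      exact Project.cut_carrier m h.symm (B.orth.carrier_eq hb) rfl

/-- Behaviours. -/
def IsBehaviour (A : Conduct m L) : Prop :=
  ∀ r : ℝ,
    (∀ a ∈ A.projects, a.addSmul r (Project.zero a.carrier) rfl ∈ A.projects) ∧
    (∀ a ∈ A.orth.projects, a.addSmul r (Project.zero a.carrier) rfl ∈ A.orth.projects)

/-- Proper behaviours. -/
def IsProper (A : Conduct m L) : Prop :=
  (∀ a ∈ A.projects, ∀ r : ℝ, a.addSmul r (Project.zero a.carrier) rfl ∈ A.projects) ∧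
  (∀ a ∈ A.projects, a.wager = 0) ∧ A.projects.Nonempty

end Conduct

/-! ### Objects and morphisms of the category of conducts -/

/-- The set of two copies of `ℕ`. -/
abbrev Two : Type := ℕ × Fin 2

/-- The bijections `ψ i : x ↦ (x, i)` on the copies of `ℕ`. -/
def ψ (i : Fin 2) (x : ℕ) : Two := (x, i)

/-- `φ (x, i) = 2 x + i`. -/
def φ (p : Two) : ℕ := 2 * p.1 + p.2.1

/-- `μ (x, i) = (x, i + 1)`. -/
def μ (p : Two) : ℕ × Fin 3 := (p.1, p.2.succ)

/-- The inclusion of `ℕ × {0, 1}` in `ℕ × {0, 1, 2}`. -/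
def incl (p : Two) : ℕ × Fin 3 := (p.1, p.2.castSucc)

/-- `ν (x, i) = (x, i / 2)`; it is only used on `ℕ × {0, 2}`. -/
def ν (p : ℕ × Fin 3) : Two := (p.1, if p.2 = 0 then 0 else 1)

/-- The involution exchanging `(2 x + 1, 0)` and `(2 x, 1)`. -/
def τ (p : Two) : Two :=
  if p.2 = 0 ∧ p.1 % 2 = 1 then (p.1 - 1, 1)
  else if p.2 = 1 ∧ p.1 % 2 = 0 then (p.1 + 1, 0)
  else p

theorem ψ_injective (i : Fin 2) : Function.Injective (ψ i) := fun _ _ h => congrArg Prod.fst h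

theorem φ_injective : Function.Injective φ := by
  rintro ⟨x, i⟩ ⟨y, j⟩ h
  simp only [φ] at h
  have h1 : x = y := by omega
  have h2 : i = j := Fin.ext (by omega)
  rw [h1, h2]

theorem disjoint_ψ (V W : Finset ℕ) : Disjoint (V.image (ψ 0)) (W.image (ψ 1)) := by
  rw [Finset.disjoint_left]
  rintro x hx hy
  obtain ⟨a, -, rfl⟩ := Finset.mem_image.1 hx
  obtain ⟨b, -, h⟩ := Finset.mem_image.1 hy
  exact absurd (congrArg Prod.snd h) (by simp [ψ])

/-- The objects: conducts whose carrier is a (finite) subset of `ℕ`. -/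
abbrev Cond (m : Weight → ℝ≥0∞) : Type 1 := Conduct m ℕ

namespace Cond

variable {m : Weight → ℝ≥0∞}

/-- The copy `ψ i (A)` of an object. -/
def copy (i : Fin 2) (A : Cond m) : Conduct m Two := A.deloc (ψ i) (ψ_injective i)

/-- The set of projects `ψ 0 (A) ⊸ ψ 1 (B)`. -/
def HomSet (A B : Cond m) : Set (Project Two) := (copy 0 A).limp (copy 1 B)

/-- Observational equivalence `f ≅ g` relative to the conduct `ψ 0 (A) ⊸ ψ 1 (B)`. -/
def homSetoid (A B : Cond m) : Setoid (HomSet A B) where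
  r f g := ∀ c ∈ orthSet m ((copy 0 A).carrier ∪ (copy 1 B).carrier) (HomSet A B),
    f.1.sca m c = g.1.sca m c
  iseqv := ⟨fun _ _ _ => rfl, fun h c hc => (h c hc).symm,
    fun h h' c hc => (h c hc).trans (h' c hc)⟩

/-- Morphisms: observational equivalence classes of projects. -/
def Hom (A B : Cond m) : Type 1 := Quotient (homSetoid A B)

/-- The class of a project. -/
def Hom.mk {A B : Cond m} (f : Project Two) (hf : f ∈ HomSet A B) : Hom A B :=
  Quotient.mk (homSetoid A B) ⟨f, hf⟩

/-- `A ⊗̄ B = φ(ψ 0 (A) ⊗ ψ 1 (B))`. -/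
def tensorObj (A B : Cond m) : Cond m :=
  ((copy 0 A).tensor (copy 1 B) (disjoint_ψ _ _)).deloc φ φ_injective

/-- `A ⅋̄ B = (A^⊥ ⊗̄ B^⊥)^⊥`. -/
def parObj (A B : Cond m) : Cond m := (tensorObj A.orth B.orth).orth

/-- `A &̄ B = φ(ψ 0 (A) & ψ 1 (B))`. -/
def ampObj (A B : Cond m) : Cond m :=
  ((copy 0 A).amp (copy 1 B) (disjoint_ψ _ _)).deloc φ φ_injective

/-- `A ⊕̄ B = φ(ψ 0 (A) ⊕ ψ 1 (B))`. -/
def plusObj (A B : Cond m) : Cond m :=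
  ((copy 0 A).plus (copy 1 B) (disjoint_ψ _ _)).deloc φ φ_injective

/-- `A ⊸̄ B = φ(ψ 0 (A) ⊸ ψ 1 (B))`. To have a conduct by definition, the bi-orthogonal of
`ψ 0 (A) ⊸ ψ 1 (B)` is taken; that it adds nothing is `StarAutonomous.lolli_eq` below. -/
def lolliObj (A B : Cond m) : Cond m :=
  (Conduct.gen m ((copy 0 A).carrier ∪ (copy 1 B).carrier) (HomSet A B)).deloc φ φ_injective

/-- The multiplicative units `1_∅` and `⊥_∅ = 1_∅^⊥`. -/
def unitObj (m : Weight → ℝ≥0∞) : Cond m := Conduct.one m ∅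
def counitObj (m : Weight → ℝ≥0∞) : Cond m := (unitObj m).orth

/-- The project representing the identity of `A`: a `Fax`. -/
def idProject (A : Cond m) : Project Two := Project.fax A.carrier (ψ 0) (ψ 1)

/-- The composition `g ∘ f = ν(f :: μ(g))`. -/
def compProject (m : Weight → ℝ≥0∞) (f g : Project Two) : Project Two :=
  ((f.map incl).cut m (g.map μ)).map ν

/-- The tensor product `f ⊗̄ g = τ(ψ 0 (φ(f)) ⊗ ψ 1 (φ(g)))` of morphisms. -/
def tensorProject (m : Weight → ℝ≥0∞) (f g : Project Two) : Project Two :=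
  (((f.map φ).map (ψ 0)).tensor m ((g.map φ).map (ψ 1))).map τ

/-- The projections `A &̄ B → A`, `A &̄ B → B`: the identity tensored with `0`. -/
def fstProject (m : Weight → ℝ≥0∞) (A B : Cond m) : Project Two :=
  (Project.fax A.carrier (fun x => ψ 0 (φ (ψ 0 x))) (ψ 1)).tensor m
    (Project.zero (B.carrier.image fun x => ψ 0 (φ (ψ 1 x))))
def sndProject (m : Weight → ℝ≥0∞) (A B : Cond m) : Project Two :=
  (Project.fax B.carrier (fun x => ψ 0 (φ (ψ 1 x))) (ψ 1)).tensor m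
    (Project.zero (A.carrier.image fun x => ψ 0 (φ (ψ 0 x))))

/-- The injections `A → A ⊕̄ B`, `B → A ⊕̄ B`: the identity tensored with `0`. -/
def inlProject (m : Weight → ℝ≥0∞) (A B : Cond m) : Project Two :=
  (Project.fax A.carrier (ψ 0) (fun x => ψ 1 (φ (ψ 0 x)))).tensor m
    (Project.zero (B.carrier.image fun x => ψ 1 (φ (ψ 1 x))))
def inrProject (m : Weight → ℝ≥0∞) (A B : Cond m) : Project Two :=
  (Project.fax B.carrier (ψ 0) (fun x => ψ 1 (φ (ψ 1 x)))).tensor m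
    (Project.zero (A.carrier.image fun x => ψ 1 (φ (ψ 0 x))))

/-- The conclusion of the mix rule for `a` in `A` and `b` in `B`: the project
`φ(ψ 0 (a) ⊗ ψ 1 (b))`. -/
def mixProject (m : Weight → ℝ≥0∞) (a b : Project ℕ) : Project ℕ :=
  ((a.map (ψ 0)).tensor m (b.map (ψ 1))).map φ

/-- The conclusion of the weakening rule for `f` in `ψ 0 (A) ⊸ ψ 1 (B)` and an object `C`:
`f ⊗ 0_C`, where the source of `f` is relocated as in `A ⊗̄ C`. -/
def weakProject (f : Project Two) (C : Cond m) : Project Two :=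
  (f.map fun p => if p.2 = 0 then ψ 0 (φ (ψ 0 p.1)) else p).tensor m
    (Project.zero (C.carrier.image fun x => ψ 0 (φ (ψ 1 x))))

end Cond

/-! ### The category of conducts, its `∗`-autonomous structure, and behaviours -/

/-- `D` is a dualizing object of a symmetric monoidal closed category: the canonical morphisms
`A ⟶ (A ⊸ D) ⊸ D` are isomorphisms. -/
def IsDualizing {C : Type*} [Category C] [MonoidalCategory C] [SymmetricCategory C]
    [MonoidalClosed C] (D : C) : Prop :=
  ∀ A : C, IsIso (MonoidalClosed.curry
    ((β_ ((ihom A).obj D) A).hom ≫ (ihom.ev A).app D) : A ⟶ (ihom ((ihom A).obj D)).obj D)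

/-- The category of conducts up to observational equivalence: identities are the classes of
faxes and composition is induced by `g ∘ f = ν(f :: μ(g))` (in particular, that project is a
morphism and its class depends on the classes of `f` and `g` only). There is at most one such
structure, since `id` and `comp` are determined by the specifications. -/
structure CondCat (m : Weight → ℝ≥0∞) where
  id : ∀ A : Cond m, Cond.Hom A A
  comp : ∀ {A B C : Cond m}, Cond.Hom A B → Cond.Hom B C → Cond.Hom A C
  id_spec : ∀ A : Cond m, ∃ h, id A = Cond.Hom.mk (Cond.idProject A) h
  comp_spec : ∀ {A B C : Cond m} (f g : Project Two)
    (hf : f ∈ Cond.HomSet A B) (hg : g ∈ Cond.HomSet B C),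
    ∃ h, comp (Cond.Hom.mk f hf) (Cond.Hom.mk g hg) = Cond.Hom.mk (Cond.compProject m f g) h
  id_comp : ∀ {A B : Cond m} (f : Cond.Hom A B), comp (id A) f = f
  comp_id : ∀ {A B : Cond m} (f : Cond.Hom A B), comp f (id B) = f
  assoc : ∀ {A B C D : Cond m} (f : Cond.Hom A B) (g : Cond.Hom B C) (h : Cond.Hom C D),
    comp (comp f g) h = comp f (comp g h)

namespace CondCat

variable {m : Weight → ℝ≥0∞} (c : CondCat m)

/-- Type synonym for the objects, carrying the category structure of `c`. -/
def Obj (_ : CondCat m) : Type 1 := Cond m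

instance : Category.{1} c.Obj where
  Hom A B := Cond.Hom (m := m) A B
  id A := c.id A
  comp f g := c.comp f g
  id_comp f := c.id_comp f
  comp_id f := c.comp_id f
  assoc f g h := c.assoc f g h

/-- A conduct as an object, and a project as a morphism, of the category. -/
def obj (A : Cond m) : c.Obj := A
def hom {A B : Cond m} (f : Project Two) (hf : f ∈ Cond.HomSet A B) : c.obj A ⟶ c.obj B :=
  Cond.Hom.mk f hf

/-- The `∗`-autonomous structure of the category of conducts: it is symmetric monoidal closed
with tensor product `⊗̄` on objects and on morphisms, unit `1_∅`, internal hom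
`φ(ψ 0 (A) ⊸ ψ 1 (B))`, and `⊥_∅` is dualizing, the dual of `A` being `A^⊥`. -/
structure StarAutonomous where
  monoidal : MonoidalCategory c.Obj
  symmetric : SymmetricCategory c.Obj
  closed : MonoidalClosed c.Obj
  tensorObj_eq : ∀ A B : Cond m, c.obj A ⊗ c.obj B = c.obj (Cond.tensorObj A B)
  tensorHom_eq : ∀ {A B A' B' : Cond m} (f g : Project Two)
    (hf : f ∈ Cond.HomSet A A') (hg : g ∈ Cond.HomSet B B'),
    ∃ h : Cond.tensorProject m f g ∈
        Cond.HomSet (Cond.tensorObj A B) (Cond.tensorObj A' B'),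
      c.hom f hf ⊗ₘ c.hom g hg =
        eqToHom (tensorObj_eq A B) ≫ c.hom _ h ≫ eqToHom (tensorObj_eq A' B').symm
  unit_eq : 𝟙_ c.Obj = c.obj (Cond.unitObj m)
  ihom_eq : ∀ A B : Cond m, (ihom (c.obj A)).obj (c.obj B) = c.obj (Cond.lolliObj A B)
  lolli_eq : ∀ A B : Cond m, (Cond.lolliObj A B).projects = Project.map φ '' Cond.HomSet A B
  dualizing : IsDualizing (c.obj (Cond.counitObj m))
  dual_iso : ∀ A : Cond m,
    Nonempty ((ihom (c.obj A)).obj (c.obj (Cond.counitObj m)) ≅ c.obj A.orth)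

/-- The property of being a behaviour, and the full subcategory of behaviours. -/
def behaviour : ObjectProperty c.Obj := fun A => Conduct.IsBehaviour (m := m) A

abbrev Beh : Type 1 := c.behaviour.FullSubcategory

/-- A behaviour as an object, and a project as a morphism, of the category of behaviours. -/
def behObj (A : Cond m) (hA : A.IsBehaviour) : c.Beh := ⟨c.obj A, hA⟩
def behHom {A B : Cond m} (hA : A.IsBehaviour) (hB : B.IsBehaviour) (f : Project Two)
    (hf : f ∈ Cond.HomSet A B) : c.behObj A hA ⟶ c.behObj B hB :=
  ObjectProperty.homMk (c.hom f hf)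

end CondCat

end IG

end

open IG

/-!
Everything rests on one identity between measurements, from which the categorical structure follows
by relocating vertices.

**The trefoil property.** If no vertex is shared by three graphs `F`, `G`, `H`, then
`[F :: G, H] + [F, G]` counts each alternating `1`-circuit of the three graphs exactly once: the
circuits that stay in `F` and `G` are those of `[F, G]`, and in the others the maximal subpaths
between two edges of `H` are the edges of `F :: G`. This contraction of paths into blocks
(`circSum_contract`, `pathGraph_contract`) is carried out for an arbitrary relation; it also gives
the associativity of the execution (`Graph.exec_assoc`). The count is symmetric in the three graphs,
hence `Graph.trefoil`. On projects this becomes the adjunction `⟪a :: b, c⟫ = ⟪a, b :: c⟫`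
(`Proj.sca_mul`) and the associativity of the cut (`Proj.mul_assoc`). Projects are taken up to
isomorphism (`Proj`), where the cut is a partially associative commutative multiplication.

**Morphisms.** If two elements of `A^⊥` have the same measurements against a set that generates `A`,
then they have the same measurements against `A` (`Conduct.IsGen.agree`): otherwise a linear
combination of them would belong to `A^⊥` and have measurement `0` against an element of `A`. Since
`(A ⊸ B)^⊥` is generated by the tensor products of generators of `A` and of `B^⊥`, a morphism is
determined by its action on the classes of the generators of its source (`Cond.Hom.ext_gen`). A cut
against a fax is a relocation (`Proj.fax_mul`), so identities, associator, unitors and symmetry are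
given by relocations, and every coherence law is an identity between relocations of tensor products.
Currying is itself a relocation of projects (`Proj.curry_sca`, `Cond.isHom_curry`), and
`A ⊸ ⊥` is a relocation of `A^⊥`, which makes `⊥` dualizing.

**Behaviours.** A conduct is a behaviour exactly when it or its orthogonal is empty, or all the
projects of both have wager `0` (`Conduct.isBehaviour_iff`). This gives the closure properties. It
also gives the additives: the pairing of `f` and `g` is the sum `f ⊗ 0 + g ⊗ 0`, whose cross
terms are products of wagers with units of zero projects, hence vanish
(`Cond.exists_pair`, `Cond.exists_copair`).

**Failures.** A non-empty behaviour contains projects of wager `0` whose slices have coefficients of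
sum `0`. Against these, the measurement of a tensor product vanishes, which refutes mix, weakening
and morphisms to `1_∅`.

**Proper behaviours.** One loop of weight `v` and one of weight `w` on the same vertex have a single
`1`-circuit, so their measurement is `m (v w)` (`Graph.meas_loop`); if this is neither `0` nor `∞`,
the orthogonal of all `loop w + r 0` is proper. If `m` takes only the values `0` and `∞`, two
projects of wager `0` are never orthogonal, while a proper behaviour has an orthogonal pair.
-/

namespace IG

/-! ### Circuits of a relation -/

section Circuits

variable {X Y : Type}

/-- The `1`-circuits of a relation: nonempty cycles, chained by the relation, that are not proper
powers. For the relation `Graph.Follows F G` these are the alternating `1`-circuits. -/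
def IsCirc (R : X → X → Prop) (c : Cycle X) : Prop :=
  c ≠ Cycle.nil ∧ c.Chain R ∧
    ∀ (ρ : List X) (k : ℕ), ((List.replicate k ρ).flatten : Cycle X) = c → k = 1

/-- The sum of `m (ω c)` over the `1`-circuits `c` of a relation. -/
noncomputable def circSum (m : Weight → ℝ≥0∞) (R : X → X → Prop) (w : X → Weight) : ℝ≥0∞ :=
  ∑' c : {c : Cycle X // IsCirc R c}, m (c.1.toMultiset.map w).prod

theorem map_injective_cycle {f : X → Y} (hf : Function.Injective f) :
    Function.Injective (Cycle.map f) := by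
  rintro c c' h
  induction c using Quotient.inductionOn' with
  | _ l =>
  induction c' using Quotient.inductionOn' with
  | _ l' =>
  have h' : (l.map f) ~r (l'.map f) := Cycle.coe_eq_coe.1 h
  obtain ⟨n, hn⟩ := h'
  rw [← List.map_rotate] at hn
  exact Cycle.coe_eq_coe.2 ⟨n, hf.list_map hn⟩

theorem exists_eq_replicate_flatten_of_map [Nonempty X] {f : X → Y} (hf : Function.Injective f)
    {l : List X} {ρ : List Y} {k : ℕ} (h : l.map f = (List.replicate k ρ).flatten) :
    ∃ σ : List X, l = (List.replicate k σ).flatten := by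
  refine ⟨ρ.map (Function.invFun f), ?_⟩
  have := congrArg (List.map (Function.invFun f)) h
  rwa [List.map_map, (Function.leftInverse_invFun hf).comp_eq_id, List.map_id, List.map_flatten,
    List.map_replicate] at this

theorem replicate_flatten_rotate_one (a : X) (t : List X) (k : ℕ) :
    a :: (List.replicate k (t ++ [a])).flatten = (List.replicate k (a :: t)).flatten ++ [a] := by
  induction k with
  | zero => rfl
  | succ k ih =>
    simp only [List.replicate_succ, List.flatten_cons, List.append_assoc, List.cons_append,
      List.nil_append]
    rw [ih]

/-- A rotation of a power is a power. -/
theorem exists_eq_replicate_flatten_of_isRotated {l ρ : List X} {k : ℕ}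
    (h : (List.replicate k ρ).flatten ~r l) : ∃ σ : List X, l = (List.replicate k σ).flatten := by
  obtain ⟨n, rfl⟩ := h
  induction n generalizing ρ with
  | zero => exact ⟨ρ, by simp⟩
  | succ n ih =>
    rcases ρ with _ | ⟨a, t⟩
    · exact ⟨[], by simp⟩
    · rcases k with _ | k
      · exact ⟨[], by simp⟩
      · obtain ⟨σ, hσ⟩ := ih (ρ := t ++ [a])
        refine ⟨σ, ?_⟩
        rw [← hσ, Nat.add_comm n 1, ← List.rotate_rotate]
        congr 1
        rw [List.replicate_succ, List.flatten_cons, List.cons_append, List.rotate_cons_succ,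
          List.rotate_zero, List.replicate_succ, List.flatten_cons, List.append_assoc,
          List.append_assoc, List.singleton_append, replicate_flatten_rotate_one]

theorem isCirc_map_iff {R : X → X → Prop} {S : Y → Y → Prop} {f : X → Y}
    (hf : Function.Injective f) (hR : ∀ x y, S (f x) (f y) ↔ R x y) (c : Cycle X) :
    IsCirc S (c.map f) ↔ IsCirc R c := by
  have hch : (c.map f).Chain S ↔ c.Chain R := by
    rw [Cycle.chain_map]
    have : (fun a b => S (f a) (f b)) = R := by
      funext a b
      exact propext (hR a b)
    rw [this]
  unfold IsCirc
  rw [hch, Ne, Cycle.map_eq_nil]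
  refine and_congr_right fun h1 => and_congr_right fun _ => ⟨fun h ρ k hk => ?_, fun h ρ k hk => ?_⟩
  · apply h (ρ.map f) k
    rw [← hk, Cycle.map_coe, List.map_flatten, List.map_replicate]
  · induction c using Quotient.inductionOn' with
    | _ l =>
    have hl : l ≠ [] := fun h => h1 (by rw [h]; rfl)
    have : Nonempty X := ⟨l.head hl⟩
    have hk' : (List.replicate k ρ).flatten ~r l.map f := Cycle.coe_eq_coe.1 hk
    obtain ⟨σ, hσ⟩ := exists_eq_replicate_flatten_of_isRotated hk'
    obtain ⟨σ', hσ'⟩ := exists_eq_replicate_flatten_of_map hf hσ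
    exact h σ' k (congrArg _ hσ'.symm)

theorem toMultiset_map (f : X → Y) (c : Cycle X) :
    (c.map f).toMultiset = c.toMultiset.map f := by
  induction c using Quotient.inductionOn' with
  | _ l => rfl

theorem circSum_congr (m : Weight → ℝ≥0∞) {R : X → X → Prop} {S : Y → Y → Prop}
    {w : X → Weight} {v : Y → Weight} (e : X ≃ Y) (hR : ∀ x y, S (e x) (e y) ↔ R x y)
    (hw : ∀ x, v (e x) = w x) : circSum m S v = circSum m R w := by
  unfold circSum
  have hinv : ∀ c : Cycle Y, (c.map e.symm).map e = c := by
    intro c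
    induction c using Quotient.inductionOn' with
    | _ l =>
      change (((l.map e.symm).map e : List _) : Cycle Y) = (l : Cycle Y)
      simp
  let E : {c : Cycle X // IsCirc R c} → {c : Cycle Y // IsCirc S c} :=
    fun c => ⟨c.1.map e, (isCirc_map_iff e.injective hR c.1).2 c.2⟩
  have hE : Function.Bijective E := by
    constructor
    · intro c c' h
      exact Subtype.ext (map_injective_cycle e.injective (congrArg Subtype.val h))
    · rintro ⟨c, hc⟩
      refine ⟨⟨c.map e.symm, ?_⟩, Subtype.ext (hinv c)⟩
      rw [← isCirc_map_iff e.injective hR, hinv]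
      exact hc
  rw [← (Equiv.ofBijective E hE).tsum_eq]
  refine tsum_congr fun c => ?_
  change m ((c.1.map e).toMultiset.map v).prod = _
  rw [toMultiset_map, Multiset.map_map]
  congr 3
  funext x
  exact hw x

end Circuits

/-! ### Contraction of paths into blocks -/

section Blocks

variable {α β : Type}

/-- The concatenation of a list whose members are lists of elements of `α`, or elements of `β`. -/
def flat : List (List α ⊕ β) → List (α ⊕ β)
  | [] => []
  | Sum.inl p :: L => p.map Sum.inl ++ flat L
  | Sum.inr b :: L => Sum.inr b :: flat L

/-- Adds an element of `α` to the first block of a list of blocks. -/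
def pushBlock (a : α) : List (List α ⊕ β) → List (List α ⊕ β)
  | Sum.inl p :: L => Sum.inl (a :: p) :: L
  | L => Sum.inl [a] :: L

/-- The decomposition of a list into the elements of `β` and the maximal blocks of elements
of `α`. -/
def split : List (α ⊕ β) → List (List α ⊕ β)
  | [] => []
  | Sum.inl a :: l => pushBlock a (split l)
  | Sum.inr b :: l => Sum.inr b :: split l

theorem flat_pushBlock (a : α) (L : List (List α ⊕ β)) :
    flat (pushBlock a L) = Sum.inl a :: flat L := by
  rcases L with _ | ⟨p | b, L⟩ <;> simp [pushBlock, flat]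

theorem flat_split (l : List (α ⊕ β)) : flat (split l) = l := by
  induction l with
  | nil => rfl
  | cons x l ih =>
    rcases x with a | b
    · simp [split, flat_pushBlock, ih]
    · simp [split, flat, ih]

theorem flat_append (L L' : List (List α ⊕ β)) : flat (L ++ L') = flat L ++ flat L' := by
  induction L with
  | nil => rfl
  | cons x L ih => rcases x with p | b <;> simp [flat, ih]

theorem split_append (x : List (α ⊕ β)) (b : β) (y : List (α ⊕ β)) :
    split (x ++ Sum.inr b :: y) = split x ++ split (Sum.inr b :: y) := by
  induction x with
  | nil => rfl
  | cons a x ih =>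
    rcases a with a | b'
    · rw [List.cons_append, split, ih, split]
      rcases split x with _ | ⟨p | b'', L⟩ <;> simp [pushBlock, split]
    · simp only [List.cons_append, split, ih]

/-- A path that starts with an element of `β` is split in the same way at each repetition, so a
contracted power is a power. -/
theorem split_replicate (b : β) (t : List (α ⊕ β)) (k : ℕ) :
    split (List.replicate k (Sum.inr b :: t)).flatten =
      (List.replicate k (split (Sum.inr b :: t))).flatten := by
  induction k with
  | zero => rfl
  | succ k ih =>
    rcases k with _ | k
    · simp
    · rw [List.replicate_succ, List.flatten_cons, List.replicate_succ (n := k + 1),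
        List.flatten_cons, ← ih, List.replicate_succ (n := k), List.flatten_cons]
      exact split_append (Sum.inr b :: t) b _

variable (R : α ⊕ β → α ⊕ β → Prop) (Q₁ Q₂ : α → Prop)

/-- A block: a nonempty path of elements of `α`, whose end points satisfy given conditions. -/
def IsBlock (p : List α) : Prop :=
  p.IsChain (fun a a' => R (Sum.inl a) (Sum.inl a')) ∧
    ∃ h : p ≠ [], Q₁ (p.head h) ∧ Q₂ (p.getLast h)

/-- The elements of the contracted relation. -/
abbrev Block : Type := {p : List α // IsBlock R Q₁ Q₂ p} ⊕ β

variable {R Q₁ Q₂}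

/-- The relation between blocks and elements of `β` that is induced by `R`. -/
def blockRel : Block R Q₁ Q₂ → Block R Q₁ Q₂ → Prop
  | Sum.inl p, Sum.inr b => R (Sum.inl (p.1.getLast p.2.2.1)) (Sum.inr b)
  | Sum.inr b, Sum.inl p => R (Sum.inr b) (Sum.inl (p.1.head p.2.2.1))
  | _, _ => False

/-- The underlying piece of path. -/
def blockVal : Block R Q₁ Q₂ → List α ⊕ β := Sum.map Subtype.val id

theorem blockVal_injective : Function.Injective (blockVal (R := R) (Q₁ := Q₁) (Q₂ := Q₂)) :=
  Sum.map_injective.2 ⟨Subtype.val_injective, Function.injective_id⟩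

/-- The path underlying a list of blocks. -/
def flatB (L : List (Block R Q₁ Q₂)) : List (α ⊕ β) := flat (L.map blockVal)

@[simp] theorem flatB_nil : flatB ([] : List (Block R Q₁ Q₂)) = [] := rfl
@[simp] theorem flatB_inl (p : {p : List α // IsBlock R Q₁ Q₂ p}) (L : List (Block R Q₁ Q₂)) :
    flatB (Sum.inl p :: L) = p.1.map Sum.inl ++ flatB L := rfl
@[simp] theorem flatB_inr (b : β) (L : List (Block R Q₁ Q₂)) :
    flatB (Sum.inr b :: L) = Sum.inr b :: flatB L := rfl

theorem flatB_append (L L' : List (Block R Q₁ Q₂)) : flatB (L ++ L') = flatB L ++ flatB L' := by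
  rw [flatB, List.map_append, flat_append]
  rfl

theorem flatB_ne_nil {L : List (Block R Q₁ Q₂)} (h : L ≠ []) : flatB L ≠ [] := by
  rcases L with _ | ⟨p | b, L⟩
  · exact absurd rfl h
  · have := p.2.2.1
    simp [this]
  · simp

theorem flatB_replicate (σ : List (Block R Q₁ Q₂)) (k : ℕ) :
    flatB (List.replicate k σ).flatten = (List.replicate k (flatB σ)).flatten := by
  induction k with
  | zero => rfl
  | succ k ih => rw [List.replicate_succ, List.flatten_cons, flatB_append, ih]; rfl

theorem split_map_inl (p : List α) (hp : p ≠ []) (l : List (α ⊕ β))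
    (hl : ∀ x ∈ l.head?, x.isRight) :
    split (p.map Sum.inl ++ l) = Sum.inl p :: split l := by
  induction p with
  | nil => exact absurd rfl hp
  | cons a p ih =>
    rw [List.map_cons, List.cons_append, split]
    rcases p with _ | ⟨a', p⟩
    · rcases l with _ | ⟨x | b, l⟩
      · rfl
      · simp at hl
      · rfl
    · rw [ih (by simp)]
      rfl

theorem blockRel_head {p : {p : List α // IsBlock R Q₁ Q₂ p}} {L : List (Block R Q₁ Q₂)}
    (h : (Sum.inl p :: L).IsChain blockRel) : ∀ x ∈ (flatB L).head?, x.isRight := by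
  rcases L with _ | ⟨q | b, L⟩
  · simp
  · exact ((List.isChain_cons_cons.1 h).1).elim
  · simp

theorem split_flatB {L : List (Block R Q₁ Q₂)} (h : L.IsChain blockRel) :
    split (flatB L) = L.map blockVal := by
  induction L with
  | nil => rfl
  | cons x L ih =>
    rcases x with p | b
    · rw [flatB_inl, split_map_inl _ p.2.2.1 _ (blockRel_head h), ih h.tail]
      rfl
    · rw [flatB_inr, split, ih h.tail]
      rfl

theorem flatB_injective {L L' : List (Block R Q₁ Q₂)} (h : L.IsChain blockRel)
    (h' : L'.IsChain blockRel) (he : flatB L = flatB L') : L = L' := by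
  apply blockVal_injective.list_map
  rw [← split_flatB h, ← split_flatB h', he]

theorem isChain_flatB {L : List (Block R Q₁ Q₂)} (h : L.IsChain blockRel) :
    (flatB L).IsChain R := by
  induction L with
  | nil => exact List.IsChain.nil
  | cons x L ih =>
    have ih := ih h.tail
    rcases x with p | b
    · rw [flatB_inl, List.isChain_append]
      refine ⟨(List.isChain_map _).2 p.2.1, ih, ?_⟩
      intro x hx y hy
      rcases L with _ | ⟨q | b, L⟩
      · simp at hy
      · exact ((List.isChain_cons_cons.1 h).1).elim
      · simp only [flatB_inr, List.head?_cons, Option.mem_def, Option.some.injEq] at hy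
        rw [List.getLast?_map, List.getLast?_eq_some_getLast p.2.2.1] at hx
        simp only [Option.map_some, Option.mem_def, Option.some.injEq] at hx
        rw [← hx, ← hy]
        exact (List.isChain_cons_cons.1 h).1
    · rw [flatB_inr, List.isChain_cons]
      refine ⟨?_, ih⟩
      intro y hy
      rcases L with _ | ⟨q | b', L⟩
      · simp at hy
      · have hq := q.2.2.1
        rw [flatB_inl, List.head?_append, List.head?_map, List.head?_eq_some_head hq] at hy
        simp only [Option.map_some, Option.some_or, Option.mem_def, Option.some.injEq] at hy
        rw [← hy]
        exact (List.isChain_cons_cons.1 h).1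
      · exact ((List.isChain_cons_cons.1 h).1).elim

/-- The conditions under which the paths of `R` decompose into blocks: two elements of `β` never
follow each other, and a block may be entered or left only where the conditions on its end points
are satisfied. -/
structure Contractible (R : α ⊕ β → α ⊕ β → Prop) (Q₁ Q₂ : α → Prop) : Prop where
  not_inr : ∀ b b', ¬ R (Sum.inr b) (Sum.inr b')
  enter : ∀ b a, R (Sum.inr b) (Sum.inl a) → Q₁ a
  leave : ∀ a b, R (Sum.inl a) (Sum.inr b) → Q₂ a

/-- Every path decomposes, except possibly for a first block `p` whose entry has not been reached
yet: the induction on the path extends `p` at its head. -/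
theorem exists_flatB_aux (hR : Contractible R Q₁ Q₂) (l : List (α ⊕ β)) (h : l.IsChain R)
    (hl : ∀ x ∈ l.getLast?, ∀ a, x = Sum.inl a → Q₂ a) :
    (∃ L : List (Block R Q₁ Q₂), L.IsChain blockRel ∧ flatB L = l ∧ ∀ x ∈ L.head?, x.isRight) ∨
    ∃ (p : List α) (L : List (Block R Q₁ Q₂)) (hp : p ≠ []), L.IsChain blockRel ∧
      p.map Sum.inl ++ flatB L = l ∧ p.IsChain (fun a a' => R (Sum.inl a) (Sum.inl a')) ∧
      Q₂ (p.getLast hp) ∧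
      ∀ x ∈ L.head?, ∃ b, x = Sum.inr b ∧ R (Sum.inl (p.getLast hp)) (Sum.inr b) := by
  induction l with
  | nil => exact Or.inl ⟨[], List.IsChain.nil, rfl, by simp⟩
  | cons x l ih =>
    have ih := ih h.tail (by
      rcases l with _ | ⟨y, l⟩
      · simp
      · simpa using hl)
    rcases x with a | b
    · right
      rcases ih with ⟨L, hL, rfl, hh⟩ | ⟨p, L, hp, hL, rfl, hch, hQ, hh⟩
      · rcases L with _ | ⟨q | b, L⟩
        · refine ⟨[a], [], by simp, List.IsChain.nil, rfl, List.IsChain.singleton _, ?_, by simp⟩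
          exact hl (Sum.inl a) (by simp) a rfl
        · simp at hh
        · have hab := (List.isChain_cons_cons.1 h).1
          refine ⟨[a], _, by simp, hL, rfl, List.IsChain.singleton _, hR.leave _ _ hab, ?_⟩
          simpa using hab
      · refine ⟨a :: p, L, by simp, hL, rfl, ?_, ?_, ?_⟩
        · rcases p with _ | ⟨a', p⟩
          · exact absurd rfl hp
          · exact List.isChain_cons_cons.2 ⟨(List.isChain_cons_cons.1 h).1, hch⟩
        · rwa [List.getLast_cons hp]
        · simpa only [List.getLast_cons hp] using hh
    · left
      rcases ih with ⟨L, hL, rfl, hh⟩ | ⟨p, L, hp, hL, rfl, hch, hQ, hh⟩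
      · rcases L with _ | ⟨q | b', L⟩
        · exact ⟨[Sum.inr b], List.IsChain.singleton _, rfl, by simp⟩
        · simp at hh
        · exact (hR.not_inr _ _ (List.isChain_cons_cons.1 h).1).elim
      · have hb : R (Sum.inr b) (Sum.inl (p.head hp)) := by
          rcases p with _ | ⟨a', p⟩
          · exact absurd rfl hp
          · exact (List.isChain_cons_cons.1 h).1
        refine ⟨Sum.inr b :: Sum.inl ⟨p, hch, hp, hR.enter _ _ hb, hQ⟩ :: L, ?_, rfl, by simp⟩
        refine List.isChain_cons_cons.2 ⟨hb, List.isChain_cons.2 ⟨?_, hL⟩⟩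
        intro y hy
        obtain ⟨b', rfl, hb'⟩ := hh y hy
        exact hb'

theorem exists_flatB (hR : Contractible R Q₁ Q₂) {l : List (α ⊕ β)} (h : l.IsChain R)
    (hf : ∀ x ∈ l.head?, ∀ a, x = Sum.inl a → Q₁ a)
    (hl : ∀ x ∈ l.getLast?, ∀ a, x = Sum.inl a → Q₂ a) :
    ∃ L : List (Block R Q₁ Q₂), L.IsChain blockRel ∧ flatB L = l := by
  rcases exists_flatB_aux hR l h hl with ⟨L, hL, rfl, -⟩ | ⟨p, L, hp, hL, rfl, hch, hQ, hh⟩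
  · exact ⟨L, hL, rfl⟩
  · refine ⟨Sum.inl ⟨p, hch, hp, hf (Sum.inl (p.head hp)) ?_ _ rfl, hQ⟩ :: L, ?_, rfl⟩
    · rw [List.head?_append, List.head?_map, List.head?_eq_some_head hp]
      rfl
    · refine List.isChain_cons.2 ⟨?_, hL⟩
      intro y hy
      obtain ⟨b', rfl, hb'⟩ := hh y hy
      exact hb'

/-! ### Contraction of circuits -/

theorem exists_coe_inr_of_mem {X Y : Type} {c : Cycle (X ⊕ Y)} {b : Y} (h : Sum.inr b ∈ c) :
    ∃ l : List (X ⊕ Y), c = ((Sum.inr b :: l : List _) : Cycle _) := by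
  induction c using Quotient.inductionOn' with
  | _ l =>
  obtain ⟨s, t, rfl⟩ := List.append_of_mem (Cycle.mem_coe_iff.1 h)
  exact ⟨t ++ s, Cycle.coe_eq_coe.2 (List.isRotated_append (l := s) (l' := Sum.inr b :: t))⟩

theorem exists_coe_inr_of_chain {c : Cycle (Block R Q₁ Q₂)} (hn : c ≠ Cycle.nil)
    (hc : c.Chain blockRel) :
    ∃ (b : β) (L : List (Block R Q₁ Q₂)), c = ((Sum.inr b :: L : List _) : Cycle _) := by
  suffices h : ∃ b : β, (Sum.inr b : Block R Q₁ Q₂) ∈ c by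
    obtain ⟨b, hb⟩ := h
    exact ⟨b, exists_coe_inr_of_mem hb⟩
  induction c using Quotient.inductionOn' with
  | _ l =>
  rcases l with _ | ⟨x, l⟩
  · exact absurd rfl hn
  have hc := (Cycle.chain_coe_cons _ _ _).1 hc
  rcases x with p | b
  · rcases l with _ | ⟨q | b, l⟩
    · exact ((List.isChain_cons_cons.1 hc).1).elim
    · exact ((List.isChain_cons_cons.1 hc).1).elim
    · exact ⟨b, Cycle.mem_coe_iff.2 (by simp)⟩
  · exact ⟨b, Cycle.mem_coe_iff.2 (by simp)⟩

theorem flatB_isRotated {L L' : List (Block R Q₁ Q₂)} (h : L ~r L') : flatB L ~r flatB L' := by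
  obtain ⟨n, hn, rfl⟩ := List.isRotated_iff_mod.1 h
  rw [List.rotate_eq_drop_append_take hn]
  conv_lhs => rw [← List.take_append_drop n L]
  rw [flatB_append, flatB_append]
  exact List.isRotated_append

/-- The circuit underlying a circuit of blocks. -/
def flatC (c : Cycle (Block R Q₁ Q₂)) : Cycle (α ⊕ β) :=
  Quotient.map' (s₁ := List.IsRotated.setoid _) (s₂ := List.IsRotated.setoid _) flatB
    (fun _ _ h => flatB_isRotated h) c

theorem flatC_coe (L : List (Block R Q₁ Q₂)) :
    flatC (L : Cycle (Block R Q₁ Q₂)) = (flatB L : Cycle (α ⊕ β)) := rfl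

theorem isChain_of_chain_inr {b : β} {L : List (Block R Q₁ Q₂)}
    (hc : (((Sum.inr b :: L : List (Block R Q₁ Q₂))) : Cycle (Block R Q₁ Q₂)).Chain blockRel) :
    (Sum.inr b :: L).IsChain blockRel :=
  ((Cycle.chain_coe_cons _ _ _).1 hc).left_of_append (l₁ := Sum.inr b :: L)

theorem isCirc_flatC {c : Cycle (Block R Q₁ Q₂)} (hc : IsCirc blockRel c) :
    IsCirc R (flatC c) := by
  obtain ⟨hn, hch, hpr⟩ := hc
  obtain ⟨b, L, rfl⟩ := exists_coe_inr_of_chain hn hch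
  refine ⟨?_, ?_, ?_⟩
  · rw [flatC_coe, Ne, Cycle.coe_eq_nil]
    simp
  · rw [flatC_coe, flatB_inr, Cycle.chain_coe_cons]
    have := isChain_flatB ((Cycle.chain_coe_cons _ _ _).1 hch)
    rwa [flatB_inr, flatB_append] at this
  · intro ρ k hk
    rw [flatC_coe] at hk
    obtain ⟨σ, hσ⟩ := exists_eq_replicate_flatten_of_isRotated (Cycle.coe_eq_coe.1 hk)
    have hk0 : k ≠ 0 := by
      rintro rfl
      simp at hσ
    obtain ⟨t, rfl⟩ : ∃ t, σ = Sum.inr b :: t := by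
      obtain ⟨k, rfl⟩ := Nat.exists_eq_succ_of_ne_zero hk0
      rcases σ with _ | ⟨x, t⟩
      · simp at hσ
      · rw [List.replicate_succ, List.flatten_cons, flatB_inr, List.cons_append] at hσ
        exact ⟨t, by rw [(List.cons.inj hσ).1]⟩
    have hs := split_flatB (isChain_of_chain_inr hch)
    rw [hσ, split_replicate] at hs
    have : Nonempty (Block R Q₁ Q₂) := ⟨Sum.inr b⟩
    obtain ⟨σ', hσ'⟩ := exists_eq_replicate_flatten_of_map blockVal_injective hs.symm
    exact hpr σ' k (congrArg _ hσ'.symm)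

/-- A circuit of blocks is rotated to start with an element of `β`; since the underlying paths split
uniquely at the elements of `β`, a rotation between them comes from a rotation of the blocks. -/
theorem flatC_injective {c c' : Cycle (Block R Q₁ Q₂)} (hc : IsCirc blockRel c)
    (hc' : IsCirc blockRel c') (h : flatC c = flatC c') : c = c' := by
  obtain ⟨b, L, rfl⟩ := exists_coe_inr_of_chain hc.1 hc.2.1
  obtain ⟨b', L', rfl⟩ := exists_coe_inr_of_chain hc'.1 hc'.2.1
  have h1 := isChain_of_chain_inr hc.2.1
  have h2 := isChain_of_chain_inr hc'.2.1
  obtain ⟨n, hn, hr⟩ := List.isRotated_iff_mod.1 (Cycle.coe_eq_coe.1 h)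
  set l := flatB (Sum.inr b :: L) with hl
  have hl' : l = l.take n ++ l.drop n := (List.take_append_drop n l).symm
  rw [List.rotate_eq_drop_append_take hn] at hr
  rcases hd : l.drop n with _ | ⟨y, ys⟩
  · rw [hd, List.append_nil] at hl'
    rw [hd, List.nil_append, ← hl'] at hr
    rw [flatB_injective h1 h2 hr]
  · have hy : y = Sum.inr b' := by
      rw [hd, flatB_inr, List.cons_append] at hr
      exact (List.cons.inj hr).1
    subst hy
    rcases ht : l.take n with _ | ⟨x, xs⟩
    · rw [ht, List.nil_append] at hl'
      rw [ht, List.append_nil, ← hl'] at hr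
      rw [flatB_injective h1 h2 hr]
    · have hx : x = Sum.inr b := by
        rw [ht, hl, flatB_inr, List.cons_append] at hl'
        exact (List.cons.inj hl').1.symm
      subst hx
      rw [ht, hd] at hl' hr
      have e1 := split_flatB h1
      have e2 := split_flatB h2
      rw [← hl, hl', split_append] at e1
      rw [← hr, split_append] at e2
      obtain ⟨X, Z, hXZ, hX, hZ⟩ := List.map_eq_append_iff.1 e1.symm
      obtain ⟨Z', X', hXZ', hZ', hX'⟩ := List.map_eq_append_iff.1 e2.symm
      have hXX : X = X' := blockVal_injective.list_map (hX.trans hX'.symm)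
      have hZZ : Z = Z' := blockVal_injective.list_map (hZ.trans hZ'.symm)
      rw [hXZ, hXZ', hXX, hZZ]
      exact Cycle.coe_eq_coe.2 List.isRotated_append

/-- A circuit that contains an element of `β` decomposes: it is cut open there. -/
theorem exists_flatC (hR : Contractible R Q₁ Q₂) {c : Cycle (α ⊕ β)} (hc : IsCirc R c) {b : β}
    (hb : Sum.inr b ∈ c) : ∃ c' : Cycle (Block R Q₁ Q₂), IsCirc blockRel c' ∧ flatC c' = c := by
  obtain ⟨hn, hch, hpr⟩ := hc
  obtain ⟨l, rfl⟩ := exists_coe_inr_of_mem hb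
  have hch' := (Cycle.chain_coe_cons _ _ _).1 hch
  obtain ⟨M, hM, hMl⟩ := exists_flatB hR hch' (by simp) (by
    intro x hx a ha
    rw [← List.cons_append, List.getLast?_append] at hx
    simp only [List.getLast?_singleton, Option.some_or, Option.mem_def,
      Option.some.injEq] at hx
    rw [← hx] at ha
    exact absurd ha (by simp))
  have hs := split_flatB hM
  rw [hMl, ← List.cons_append, split_append] at hs
  obtain ⟨X, Z, rfl, hX, hZ⟩ := List.map_eq_append_iff.1 hs.symm
  have hZ' : Z = [Sum.inr b] := blockVal_injective.list_map hZ
  subst hZ'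
  have hXl : flatB X = Sum.inr b :: l := by
    rw [flatB, hX, flat_split]
  obtain ⟨L, rfl⟩ : ∃ L, X = Sum.inr b :: L := by
    rcases X with _ | ⟨x, X⟩
    · simp at hXl
    · rcases x with p | b'
      · have hp := p.2.2.1
        rw [flatB_inl] at hXl
        rcases hq : p.1 with _ | ⟨a, q⟩
        · exact absurd hq hp
        · rw [hq] at hXl
          exact absurd (List.cons.inj hXl).1 (by simp)
      · rw [flatB_inr] at hXl
        exact ⟨X, by rw [Sum.inr_injective (List.cons.inj hXl).1]⟩
  refine ⟨((Sum.inr b :: L : List _) : Cycle _), ⟨?_, ?_, ?_⟩, ?_⟩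
  · rw [Ne, Cycle.coe_eq_nil]
    simp
  · rw [Cycle.chain_coe_cons]
    exact hM
  · intro σ k hk
    apply hpr (flatB σ) k
    rw [← flatB_replicate, ← hXl]
    exact congrArg flatC hk
  · rw [flatC_coe, hXl]

theorem prod_flatB {wα : α → Weight} {wβ : β → Weight} {w' : Block R Q₁ Q₂ → Weight}
    (h1 : ∀ p, w' (Sum.inl p) = (p.1.map wα).prod) (h2 : ∀ b, w' (Sum.inr b) = wβ b)
    (L : List (Block R Q₁ Q₂)) :
    ((flatB L).map (Sum.elim wα wβ)).prod = (L.map w').prod := by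
  induction L with
  | nil => rfl
  | cons x L ih =>
    rcases x with p | b
    · rw [flatB_inl, List.map_append, List.prod_append, ih, List.map_cons, List.prod_cons, h1,
        List.map_map]
      rfl
    · rw [flatB_inr, List.map_cons, List.prod_cons, ih, List.map_cons, List.prod_cons, h2]
      rfl

/-- The sum over the circuits of `R` is the sum over those that stay in `α` plus the sum over
the circuits of blocks. -/
theorem circSum_contract (m : Weight → ℝ≥0∞) (hR : Contractible R Q₁ Q₂) {wα : α → Weight}
    {wβ : β → Weight} {w' : Block R Q₁ Q₂ → Weight}
    (h1 : ∀ p, w' (Sum.inl p) = (p.1.map wα).prod) (h2 : ∀ b, w' (Sum.inr b) = wβ b) :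
    circSum m (fun a a' => R (Sum.inl a) (Sum.inl a')) wα +
      circSum m (blockRel (R := R) (Q₁ := Q₁) (Q₂ := Q₂)) w' =
        circSum m R (Sum.elim wα wβ) := by
  unfold circSum
  have hinl : ∀ c : Cycle α, IsCirc (fun a a' => R (Sum.inl a) (Sum.inl a')) c →
      IsCirc R (c.map Sum.inl) := fun c hc =>
    (isCirc_map_iff Sum.inl_injective (fun _ _ => Iff.rfl) c).2 hc
  let E : {c : Cycle α // IsCirc (fun a a' => R (Sum.inl a) (Sum.inl a')) c} ⊕
      {c : Cycle (Block R Q₁ Q₂) // IsCirc blockRel c} → {c : Cycle (α ⊕ β) // IsCirc R c} :=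
    Sum.elim (fun c => ⟨c.1.map Sum.inl, hinl c.1 c.2⟩) (fun c => ⟨flatC c.1, isCirc_flatC c.2⟩)
  have hmem : ∀ c : {c : Cycle (Block R Q₁ Q₂) // IsCirc blockRel c},
      ∃ b : β, Sum.inr b ∈ flatC c.1 := by
    rintro ⟨c, hc⟩
    obtain ⟨b, L, rfl⟩ := exists_coe_inr_of_chain hc.1 hc.2.1
    exact ⟨b, Cycle.mem_coe_iff.2 (by simp)⟩
  have hnot : ∀ (c : Cycle α) (b : β), Sum.inr b ∉ (c.map Sum.inl : Cycle (α ⊕ β)) := by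
    intro c b h
    obtain ⟨x, -, hx⟩ := Cycle.mem_map.1 h
    exact absurd hx (by simp)
  have hE : Function.Bijective E := by
    constructor
    · rintro (c | c) (c' | c') h
      · have := map_injective_cycle Sum.inl_injective (congrArg Subtype.val h)
        rw [Subtype.ext this]
      · obtain ⟨b, hb⟩ := hmem c'
        have h' : c.1.map Sum.inl = flatC c'.1 := congrArg Subtype.val h
        rw [← h'] at hb
        exact (hnot _ _ hb).elim
      · obtain ⟨b, hb⟩ := hmem c
        have h' : flatC c.1 = c'.1.map Sum.inl := congrArg Subtype.val h
        rw [h'] at hb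
        exact (hnot _ _ hb).elim
      · have := flatC_injective c.2 c'.2 (congrArg Subtype.val h)
        rw [Subtype.ext this]
    · rintro ⟨c, hc⟩
      by_cases hb : ∃ b : β, Sum.inr b ∈ c
      · obtain ⟨b, hb⟩ := hb
        obtain ⟨c', hc', rfl⟩ := exists_flatC hR hc hb
        exact ⟨Sum.inr ⟨c', hc'⟩, rfl⟩
      · obtain ⟨c', rfl⟩ : ∃ c' : Cycle α, c'.map Sum.inl = c := by
          induction c using Quotient.inductionOn' with
          | _ l =>
          have : ∀ x ∈ l, ∃ a : α, Sum.inl a = x := by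
            rintro (a | b) hx
            · exact ⟨a, rfl⟩
            · exact absurd ⟨b, Cycle.mem_coe_iff.2 hx⟩ hb
          obtain ⟨l', rfl⟩ : l ∈ Set.range (List.map (Sum.inl : α → α ⊕ β)) := by
            rw [Set.range_list_map]
            exact this
          exact ⟨(l' : Cycle α), rfl⟩
        refine ⟨Sum.inl ⟨c', ?_⟩, rfl⟩
        exact (isCirc_map_iff Sum.inl_injective (fun _ _ => Iff.rfl) c').1 hc
  rw [← (Equiv.ofBijective E hE).tsum_eq,
    Summable.tsum_sum ENNReal.summable ENNReal.summable]
  congr 1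
  · refine tsum_congr fun c => ?_
    change _ = m ((c.1.map Sum.inl).toMultiset.map _).prod
    rw [toMultiset_map, Multiset.map_map]
    rfl
  · refine tsum_congr fun c => ?_
    change _ = m ((flatC c.1).toMultiset.map _).prod
    obtain ⟨c, hc⟩ := c
    change m (c.toMultiset.map w').prod = m ((flatC c).toMultiset.map _).prod
    clear hc
    induction c using Quotient.inductionOn' with
    | _ L =>
    change m ((L : Multiset _).map w').prod =
      m (((flatB L : List _) : Multiset _).map (Sum.elim wα wβ)).prod
    rw [Multiset.map_coe, Multiset.prod_coe, Multiset.map_coe, Multiset.prod_coe,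
      prod_flatB h1 h2]

end Blocks

end IG

namespace IG

/-! ### Isomorphisms of graphs -/

section PathGraph

variable {L X Y : Type}

/-- Isomorphisms of graphs that are the identity on vertices. -/
def Graph.IsIso (F G : Graph L) : Prop :=
  F.verts = G.verts ∧ ∃ e : F.E ≃ G.E, ∀ x, G.src (e x) = F.src x ∧ G.tgt (e x) = F.tgt x ∧
    G.weight (e x) = F.weight x

theorem Graph.IsIso.refl (F : Graph L) : F.IsIso F :=
  ⟨rfl, Equiv.refl _, fun _ => ⟨rfl, rfl, rfl⟩⟩

theorem Graph.IsIso.symm {F G : Graph L} (h : F.IsIso G) : G.IsIso F := by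
  obtain ⟨hv, e, he⟩ := h
  refine ⟨hv.symm, e.symm, fun x => ?_⟩
  obtain ⟨h1, h2, h3⟩ := he (e.symm x)
  rw [e.apply_symm_apply] at h1 h2 h3
  exact ⟨h1.symm, h2.symm, h3.symm⟩

theorem Graph.IsIso.trans {F G H : Graph L} (h : F.IsIso G) (h' : G.IsIso H) : F.IsIso H := by
  obtain ⟨hv, e, he⟩ := h
  obtain ⟨hv', e', he'⟩ := h'
  refine ⟨hv.trans hv', e.trans e', fun x => ?_⟩
  obtain ⟨h1, h2, h3⟩ := he x
  obtain ⟨h1', h2', h3'⟩ := he' (e x)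
  exact ⟨h1'.trans h1, h2'.trans h2, h3'.trans h3⟩

/-- The graph whose edges are the nonempty paths of a relation with end points in `W`. The
execution of two graphs is the special case of the relation `Graph.Follows`. -/
def pathGraph [Countable X] (s t : X → L) (R : X → X → Prop) (w : X → Weight) (W : Finset L) :
    Graph L where
  verts := W
  E := {l : List X // l.IsChain R ∧ ∃ h : l ≠ [], s (l.head h) ∈ W ∧ t (l.getLast h) ∈ W}
  countable := inferInstance
  src l := s (l.1.head l.2.2.1)
  tgt l := t (l.1.getLast l.2.2.1)
  src_mem l := l.2.2.2.1
  tgt_mem l := l.2.2.2.2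
  weight l := (l.1.map w).prod

theorem pathGraph_map {L' : Type} [DecidableEq L'] [Countable X] [Countable Y] {s t : X → L}
    {R : X → X → Prop} {w : X → Weight} {W : Finset L} {s' t' : Y → L'} {R' : Y → Y → Prop}
    {w' : Y → Weight} {W' : Finset L'} (θ : L → L') (e : X ≃ Y)
    (hR : ∀ x y, R' (e x) (e y) ↔ R x y)
    (hs : ∀ x, s' (e x) = θ (s x)) (ht : ∀ x, t' (e x) = θ (t x)) (hw : ∀ x, w' (e x) = w x)
    (hW : W' = W.image θ) (hs' : ∀ x, θ (s x) ∈ W' ↔ s x ∈ W) (ht' : ∀ x, θ (t x) ∈ W' ↔ t x ∈ W) :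
    (pathGraph s' t' R' w' W').IsIso ((pathGraph s t R w W).map θ) := by
  have key : ∀ l : List X, (l.map e).IsChain R' ∧
      (∃ h : l.map e ≠ [], s' ((l.map e).head h) ∈ W' ∧ t' ((l.map e).getLast h) ∈ W') ↔
      l.IsChain R ∧ ∃ h : l ≠ [], s (l.head h) ∈ W ∧ t (l.getLast h) ∈ W := by
    intro l
    rw [List.isChain_map]
    simp only [hR, List.map_eq_nil_iff, ne_eq, List.head_map, List.getLast_map, hs, ht, hs', ht']
  let E : (pathGraph s t R w W).E → (pathGraph s' t' R' w' W').E := fun l =>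
    ⟨l.1.map e, (key l.1).2 l.2⟩
  have hE : Function.Bijective E := by
    constructor
    · intro l l' h
      exact Subtype.ext (e.injective.list_map (congrArg Subtype.val h))
    · rintro ⟨l, hl⟩
      have hl' : (l.map e.symm).map e = l := by simp
      rw [← hl'] at hl
      exact ⟨⟨l.map e.symm, (key _).1 hl⟩, Subtype.ext hl'⟩
  refine Graph.IsIso.symm ⟨hW.symm, Equiv.ofBijective E hE, fun l => ?_⟩
  obtain ⟨l, hl, hn, hh, hg⟩ := l
  refine ⟨?_, ?_, ?_⟩
  · exact (congrArg s' (List.head_map (by simpa using hn))).trans (hs _)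
  · exact (congrArg t' (List.getLast_map (by simpa using hn))).trans (ht _)
  · change ((l.map e).map w').prod = (l.map w).prod
    rw [List.map_map]
    congr 2
    funext x
    exact hw x

theorem Graph.map_id_isIso [DecidableEq L] (F : Graph L) : (F.map id).IsIso F :=
  ⟨Finset.image_id, Equiv.refl _, fun _ => ⟨rfl, rfl, rfl⟩⟩

theorem pathGraph_congr [DecidableEq L] [Countable X] [Countable Y] {s t : X → L}
    {R : X → X → Prop}
    {w : X → Weight} {W : Finset L} {s' t' : Y → L} {R' : Y → Y → Prop} {w' : Y → Weight}
    {W' : Finset L} (e : X ≃ Y) (hR : ∀ x y, R' (e x) (e y) ↔ R x y)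
    (hs : ∀ x, s' (e x) = s x) (ht : ∀ x, t' (e x) = t x) (hw : ∀ x, w' (e x) = w x)
    (hW : W = W') : (pathGraph s t R w W).IsIso (pathGraph s' t' R' w' W') := by
  subst hW
  exact ((pathGraph_map id e hR hs ht hw Finset.image_id.symm (fun _ => Iff.rfl)
    fun _ => Iff.rfl).trans (Graph.map_id_isIso _)).symm

theorem pathGraph_contract {α β : Type} [Countable α] [Countable β] {R : α ⊕ β → α ⊕ β → Prop}
    {Q₁ Q₂ : α → Prop} [Countable (Block R Q₁ Q₂)] (hR : Contractible R Q₁ Q₂)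
    {s t : α ⊕ β → L} {wα : α → Weight}
    {wβ : β → Weight} {W : Finset L} {s' t' : Block R Q₁ Q₂ → L} {w' : Block R Q₁ Q₂ → Weight}
    (hs : ∀ p : {p : List α // IsBlock R Q₁ Q₂ p},
      s' (Sum.inl p) = s (Sum.inl (p.1.head p.2.2.1)))
    (ht : ∀ p : {p : List α // IsBlock R Q₁ Q₂ p},
      t' (Sum.inl p) = t (Sum.inl (p.1.getLast p.2.2.1)))
    (hs' : ∀ b, s' (Sum.inr b) = s (Sum.inr b)) (ht' : ∀ b, t' (Sum.inr b) = t (Sum.inr b))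
    (h1 : ∀ p, w' (Sum.inl p) = (p.1.map wα).prod) (h2 : ∀ b, w' (Sum.inr b) = wβ b)
    (hW₁ : ∀ a, s (Sum.inl a) ∈ W → Q₁ a) (hW₂ : ∀ a, t (Sum.inl a) ∈ W → Q₂ a) :
    (pathGraph s' t' blockRel w' W).IsIso (pathGraph s t R (Sum.elim wα wβ) W) := by
  have hhead : ∀ (l : List (Block R Q₁ Q₂)) (h : l ≠ []),
      s ((flatB l).head (flatB_ne_nil h)) = s' (l.head h) := by
    intro l h
    rcases l with _ | ⟨p | b, l⟩
    · exact absurd rfl h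
    · rw [List.head_cons, hs]
      congr 1
      rw [List.head_eq_iff_head?_eq_some, flatB_inl, List.head?_append, List.head?_map,
        List.head?_eq_some_head p.2.2.1]
      rfl
    · rw [List.head_cons, hs']
      rfl
  have hlast : ∀ (l : List (Block R Q₁ Q₂)) (h : l ≠ []),
      t ((flatB l).getLast (flatB_ne_nil h)) = t' (l.getLast h) := by
    intro l h
    obtain ⟨l, x, rfl⟩ : ∃ l' x, l = l' ++ [x] := ⟨_, _, (List.dropLast_append_getLast h).symm⟩
    rw [List.getLast_append_singleton]
    rcases x with p | b
    · rw [ht]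
      congr 1
      rw [List.getLast_eq_iff_getLast?_eq_some, flatB_append, List.getLast?_append, flatB_inl,
        flatB_nil, List.append_nil, List.getLast?_map, List.getLast?_eq_some_getLast p.2.2.1]
      rfl
    · rw [ht']
      congr 1
      rw [List.getLast_eq_iff_getLast?_eq_some, flatB_append, List.getLast?_append, flatB_inr,
        flatB_nil]
      rfl
  let E : (pathGraph s' t' (blockRel (R := R) (Q₁ := Q₁) (Q₂ := Q₂)) w' W).E →
      (pathGraph s t R (Sum.elim wα wβ) W).E := fun l =>
    ⟨flatB l.1, isChain_flatB l.2.1, flatB_ne_nil l.2.2.1,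
      by rw [hhead]; exact l.2.2.2.1, by rw [hlast]; exact l.2.2.2.2⟩
  have hE : Function.Bijective E := by
    constructor
    · rintro ⟨l, hl⟩ ⟨l', hl'⟩ h
      exact Subtype.ext (flatB_injective hl.1 hl'.1 (congrArg Subtype.val h))
    · rintro ⟨l, hl, hn, hh, hg⟩
      obtain ⟨M, hM, rfl⟩ := exists_flatB hR hl
        (by
          intro x hx a ha
          rw [List.head?_eq_some_head hn] at hx
          simp only [Option.mem_def, Option.some.injEq] at hx
          apply hW₁
          rwa [← ha, ← hx])
        (by
          intro x hx a ha
          rw [List.getLast?_eq_some_getLast hn] at hx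
          simp only [Option.mem_def, Option.some.injEq] at hx
          apply hW₂
          rwa [← ha, ← hx])
      have hM0 : M ≠ [] := by
        rintro rfl
        exact hn rfl
      rw [hhead M hM0] at hh
      rw [hlast M hM0] at hg
      exact ⟨⟨M, hM, hM0, hh, hg⟩, rfl⟩
  refine ⟨rfl, Equiv.ofBijective E hE, fun l => ⟨hhead _ _, hlast _ _, prod_flatB h1 h2 _⟩⟩

end PathGraph

namespace Graph

variable {L L' : Type}

/-! ### The execution of three graphs -/

section Assoc

variable (F G H : Graph L)

/-- Succession of the edges of three graphs in alternating paths. -/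
def Follows₃ : (F.E ⊕ G.E) ⊕ H.E → (F.E ⊕ G.E) ⊕ H.E → Prop
  | Sum.inl a, Sum.inl a' => Follows F G a a'
  | Sum.inl a, Sum.inr b => H.src b = plugTgt F G a
  | Sum.inr b, Sum.inl a => plugSrc F G a = H.tgt b
  | Sum.inr _, Sum.inr _ => False

/-- The source of an edge of three graphs. -/
def src₃ : (F.E ⊕ G.E) ⊕ H.E → L := Sum.elim (plugSrc F G) H.src

/-- The target of an edge of three graphs. -/
def tgt₃ : (F.E ⊕ G.E) ⊕ H.E → L := Sum.elim (plugTgt F G) H.tgt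

/-- The weight of an edge of three graphs. -/
def weight₃ : (F.E ⊕ G.E) ⊕ H.E → Weight := Sum.elim (plugWeight F G) H.weight

instance : Countable F.E := F.countable

/-- The execution of three graphs. -/
def exec₃ [DecidableEq L] : Graph L :=
  pathGraph (src₃ F G H) (tgt₃ F G H) (Follows₃ F G H) (weight₃ F G H)
    (symmDiff (symmDiff F.verts G.verts) H.verts)

variable {F G H}

theorem plugSrc_mem [DecidableEq L] (a : PlugE F G) : plugSrc F G a ∈ F.verts ∪ G.verts := by
  rcases a with a | a
  · exact Finset.mem_union_left _ (F.src_mem a)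
  · exact Finset.mem_union_right _ (G.src_mem a)

theorem plugTgt_mem [DecidableEq L] (a : PlugE F G) : plugTgt F G a ∈ F.verts ∪ G.verts := by
  rcases a with a | a
  · exact Finset.mem_union_left _ (F.tgt_mem a)
  · exact Finset.mem_union_right _ (G.tgt_mem a)

/-- Cyclic permutation of the edges of three graphs. -/
def rotE (A B C : Type) : (A ⊕ B) ⊕ C ≃ (B ⊕ C) ⊕ A where
  toFun := Sum.elim (Sum.elim Sum.inr (Sum.inl ∘ Sum.inl)) (Sum.inl ∘ Sum.inr)
  invFun := Sum.elim (Sum.elim (Sum.inl ∘ Sum.inr) Sum.inr) (Sum.inl ∘ Sum.inl)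
  left_inv := by rintro ((a | b) | c) <;> rfl
  right_inv := by rintro ((b | c) | a) <;> rfl

theorem follows₃_rot (x y : (F.E ⊕ G.E) ⊕ H.E) :
    Follows₃ G H F (rotE _ _ _ x) (rotE _ _ _ y) ↔ Follows₃ F G H x y := by
  rcases x with (x | x) | x <;> rcases y with (y | y) | y <;>
    simp [rotE, Follows₃, Follows, plugSrc, plugTgt]

variable [DecidableEq L]

theorem contractible_follows₃ (h : ∀ x ∈ F.verts, x ∈ G.verts → x ∉ H.verts) :
    Contractible (Follows₃ F G H) (fun a => plugSrc F G a ∈ symmDiff F.verts G.verts)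
      (fun a => plugTgt F G a ∈ symmDiff F.verts G.verts) where
  not_inr _ _ h := h
  enter b a hb := by
    have h1 := plugSrc_mem a
    have h2 := H.tgt_mem b
    have h3 := h (plugSrc F G a)
    rw [← show plugSrc F G a = H.tgt b from hb] at h2
    rw [Finset.mem_union] at h1
    rw [Finset.mem_symmDiff]
    tauto
  leave a b hb := by
    have h1 := plugTgt_mem a
    have h2 := H.src_mem b
    have h3 := h (plugTgt F G a)
    rw [show H.src b = plugTgt F G a from hb] at h2
    rw [Finset.mem_union] at h1
    rw [Finset.mem_symmDiff]
    tauto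

/-- The edges of the plugging of `F :: G` and `H` are the blocks of `Follows₃`. -/
theorem blockRel_iff (x y : PlugE (F.exec G) H) :
    blockRel (R := Follows₃ F G H) (Q₁ := fun a => plugSrc F G a ∈ symmDiff F.verts G.verts)
      (Q₂ := fun a => plugTgt F G a ∈ symmDiff F.verts G.verts) x y ↔
      Follows (F.exec G) H x y := by
  rcases x with x | x <;> rcases y with y | y
  · simp [blockRel, Follows]
  · simp only [Follows, Sum.isLeft_inl, Sum.isLeft_inr, ne_eq, Bool.true_eq_false,
      not_false_eq_true, and_true]
    exact Iff.rfl
  · simp only [Follows, Sum.isLeft_inl, Sum.isLeft_inr, ne_eq, Bool.false_eq_true,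
      not_false_eq_true, and_true]
    exact Iff.rfl
  · simp [blockRel, Follows]

/-- The edges of `(F :: G) :: H` are the alternating paths of the three graphs, contracted. -/
theorem exec_exec_isIso (h : ∀ x ∈ F.verts, x ∈ G.verts → x ∉ H.verts) :
    ((F.exec G).exec H).IsIso (exec₃ F G H) := by
  have : Countable (PlugE (F.exec G) H) := by
    have := (F.exec G).countable
    infer_instance
  refine (pathGraph_congr (X := PlugE (F.exec G) H) (Equiv.refl _) blockRel_iff
    (fun _ => rfl) (fun _ => rfl) (fun _ => rfl) rfl).trans
    (pathGraph_contract (contractible_follows₃ h) (fun _ => rfl) (fun _ => rfl)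
      (fun _ => rfl) (fun _ => rfl) (fun _ => rfl) (fun _ => rfl) ?_ ?_)
  · intro a ha
    have h1 := plugSrc_mem a
    have h3 := h (plugSrc F G a)
    change plugSrc F G a ∈ symmDiff (symmDiff F.verts G.verts) H.verts at ha
    rw [Finset.mem_union] at h1
    rw [Finset.mem_symmDiff] at ha
    rw [Finset.mem_symmDiff] at ha ⊢
    tauto
  · intro a ha
    have h1 := plugTgt_mem a
    have h3 := h (plugTgt F G a)
    change plugTgt F G a ∈ symmDiff (symmDiff F.verts G.verts) H.verts at ha
    rw [Finset.mem_union] at h1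
    rw [Finset.mem_symmDiff] at ha
    rw [Finset.mem_symmDiff] at ha ⊢
    tauto

/-- The circuits of three graphs are the circuits of `F` and `G` together with those of `F :: G` and
`H`. -/
theorem meas_add_meas (m : Weight → ℝ≥0∞) (h : ∀ x ∈ F.verts, x ∈ G.verts → x ∉ H.verts) :
    meas m F G + meas m (F.exec G) H = circSum m (Follows₃ F G H) (weight₃ F G H) := by
  have h1 : meas m (F.exec G) H = circSum m
      (blockRel (R := Follows₃ F G H) (Q₁ := fun a => plugSrc F G a ∈ symmDiff F.verts G.verts)
        (Q₂ := fun a => plugTgt F G a ∈ symmDiff F.verts G.verts))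
      (plugWeight (F.exec G) H) :=
    circSum_congr m (X := PlugE (F.exec G) H) (Equiv.refl _) (fun x y => (blockRel_iff x y).symm)
      (fun _ => rfl)
  rw [h1]
  exact circSum_contract m (contractible_follows₃ h) (fun _ => rfl) (fun _ => rfl)

theorem exec₃_rot : (exec₃ F G H).IsIso (exec₃ G H F) := by
  refine pathGraph_congr (rotE _ _ _) follows₃_rot ?_ ?_ ?_ ?_
  · rintro ((x | x) | x) <;> rfl
  · rintro ((x | x) | x) <;> rfl
  · rintro ((x | x) | x) <;> rfl
  · rw [symmDiff_assoc, symmDiff_comm]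

theorem exec_comm (F G : Graph L) : (F.exec G).IsIso (G.exec F) :=
  pathGraph_congr (X := PlugE F G) (Equiv.sumComm _ _) (fun x y => follows_swap F G x y)
    (fun x => (plug_swap F G x).1) (fun x => (plug_swap F G x).2.1)
    (fun x => (plug_swap F G x).2.2) (symmDiff_comm _ _)

/-- Associativity of the execution. -/
theorem exec_assoc (h : ∀ x ∈ F.verts, x ∈ G.verts → x ∉ H.verts) :
    ((F.exec G).exec H).IsIso (F.exec (G.exec H)) :=
  (exec_exec_isIso h).trans <| exec₃_rot.trans <|
    (exec_exec_isIso fun x hx hx' hx'' => h x hx'' hx hx').symm.trans (exec_comm _ _)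

/-- The trefoil property: both sides are the sum over the alternating circuits of the three
graphs. -/
theorem trefoil (m : Weight → ℝ≥0∞) (h : ∀ x ∈ F.verts, x ∈ G.verts → x ∉ H.verts) :
    meas m F G + meas m (F.exec G) H = meas m G H + meas m F (G.exec H) := by
  rw [meas_add_meas m h, meas_comm m F, meas_add_meas m fun x hx hx' hx'' => h x hx'' hx hx']
  refine (circSum_congr m (rotE _ _ _) follows₃_rot ?_).symm
  rintro ((x | x) | x) <;> rfl

end Assoc

/-! ### Invariance and special cases of the execution -/

theorem follows_congr {F F' G G' : Graph L} (e : F.E ≃ F'.E)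
    (he : ∀ x, F'.src (e x) = F.src x ∧ F'.tgt (e x) = F.tgt x ∧ F'.weight (e x) = F.weight x)
    (e' : G.E ≃ G'.E)
    (he' : ∀ x, G'.src (e' x) = G.src x ∧ G'.tgt (e' x) = G.tgt x ∧
      G'.weight (e' x) = G.weight x) (x y : PlugE F G) :
    Follows F' G' (Equiv.sumCongr e e' x) (Equiv.sumCongr e e' y) ↔ Follows F G x y := by
  rcases x with x | x <;> rcases y with y | y <;>
    simp [Follows, plugSrc, plugTgt, he, he']

theorem exec_congr [DecidableEq L] {F F' G G' : Graph L} (h : F.IsIso F') (h' : G.IsIso G') :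
    (F.exec G).IsIso (F'.exec G') := by
  obtain ⟨hv, e, he⟩ := h
  obtain ⟨hv', e', he'⟩ := h'
  refine pathGraph_congr (X := PlugE F G) (Equiv.sumCongr e e') (follows_congr e he e' he')
    ?_ ?_ ?_ (by rw [hv, hv'])
  · rintro (x | x)
    exacts [(he x).1, (he' x).1]
  · rintro (x | x)
    exacts [(he x).2.1, (he' x).2.1]
  · rintro (x | x)
    exacts [(he x).2.2, (he' x).2.2]

theorem meas_congr (m : Weight → ℝ≥0∞) {F F' G G' : Graph L} (h : F.IsIso F')
    (h' : G.IsIso G') : meas m F G = meas m F' G' := by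
  obtain ⟨hv, e, he⟩ := h
  obtain ⟨hv', e', he'⟩ := h'
  refine (circSum_congr m (Equiv.sumCongr e e') (follows_congr e he e' he') ?_).symm
  rintro (x | x)
  exacts [(he x).2.2, (he' x).2.2]

theorem map_congr [DecidableEq L'] (θ : L → L') {F F' : Graph L} (h : F.IsIso F') :
    (F.map θ).IsIso (F'.map θ) := by
  obtain ⟨hv, e, he⟩ := h
  exact ⟨congrArg (Finset.image θ) hv, e, fun x =>
    ⟨congrArg θ (he x).1, congrArg θ (he x).2.1, (he x).2.2⟩⟩

theorem map_isIso_of_eqOn [DecidableEq L'] {θ η : L → L'} {F : Graph L}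
    (h : ∀ x ∈ F.verts, θ x = η x) : (F.map θ).IsIso (F.map η) :=
  ⟨Finset.image_congr fun x hx => h x hx, Equiv.refl _, fun x =>
    ⟨(h _ (F.src_mem x)).symm, (h _ (F.tgt_mem x)).symm, rfl⟩⟩

theorem map_map_isIso {L'' : Type} [DecidableEq L'] [DecidableEq L''] (θ : L → L') (η : L' → L'')
    (F : Graph L) : ((F.map θ).map η).IsIso (F.map (η ∘ θ)) :=
  ⟨Finset.image_image, Equiv.refl _, fun _ => ⟨rfl, rfl, rfl⟩⟩

section Map

variable [DecidableEq L'] {θ : L → L'} {F G : Graph L}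

/-- Delocation does not change the edges. -/
def mapE (θ : L → L') (F G : Graph L) : PlugE F G ≃ PlugE (F.map θ) (G.map θ) :=
  Equiv.sumCongr (Equiv.refl F.E) (Equiv.refl G.E)

theorem plugSrc_mapE (e : PlugE F G) :
    plugSrc (F.map θ) (G.map θ) (mapE θ F G e) = θ (plugSrc F G e) := by rcases e with e | e <;> rfl

theorem plugTgt_mapE (e : PlugE F G) :
    plugTgt (F.map θ) (G.map θ) (mapE θ F G e) = θ (plugTgt F G e) := by rcases e with e | e <;> rfl

theorem plugWeight_mapE (e : PlugE F G) :
    plugWeight (F.map θ) (G.map θ) (mapE θ F G e) = plugWeight F G e := by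
  rcases e with e | e <;> rfl

theorem follows_map [DecidableEq L] (hθ : Set.InjOn θ (F.verts ∪ G.verts : Finset L))
    (x y : PlugE F G) :
    Follows (F.map θ) (G.map θ) (mapE θ F G x) (mapE θ F G y) ↔ Follows F G x y := by
  unfold Follows
  rw [plugSrc_mapE, plugTgt_mapE, hθ.eq_iff (plugSrc_mem _) (plugTgt_mem _)]
  rcases x with x | x <;> rcases y with y | y <;> exact Iff.rfl

theorem meas_map' [DecidableEq L] (m : Weight → ℝ≥0∞)
    (hθ : Set.InjOn θ (F.verts ∪ G.verts : Finset L)) :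
    meas m (F.map θ) (G.map θ) = meas m F G :=
  circSum_congr m (mapE θ F G) (follows_map hθ) plugWeight_mapE

theorem image_symmDiff' [DecidableEq L] {V W : Finset L} (hθ : Set.InjOn θ (V ∪ W : Finset L)) :
    (symmDiff V W).image θ = symmDiff (V.image θ) (W.image θ) := by
  ext y
  simp only [Finset.mem_image, Finset.mem_symmDiff]
  constructor
  · rintro ⟨x, ⟨hx, hx'⟩ | ⟨hx, hx'⟩, rfl⟩
    · refine Or.inl ⟨⟨x, hx, rfl⟩, ?_⟩
      rintro ⟨z, hz, hzx⟩
      rw [hθ (Finset.mem_union_right _ hz) (Finset.mem_union_left _ hx) hzx] at hz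
      exact hx' hz
    · refine Or.inr ⟨⟨x, hx, rfl⟩, ?_⟩
      rintro ⟨z, hz, hzx⟩
      rw [hθ (Finset.mem_union_left _ hz) (Finset.mem_union_right _ hx) hzx] at hz
      exact hx' hz
  · rintro (⟨⟨x, hx, rfl⟩, h⟩ | ⟨⟨x, hx, rfl⟩, h⟩)
    · exact ⟨x, Or.inl ⟨hx, fun h' => h ⟨x, h', rfl⟩⟩, rfl⟩
    · exact ⟨x, Or.inr ⟨hx, fun h' => h ⟨x, h', rfl⟩⟩, rfl⟩

theorem exec_map [DecidableEq L] (hθ : Set.InjOn θ (F.verts ∪ G.verts : Finset L)) :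
    ((F.map θ).exec (G.map θ)).IsIso ((F.exec G).map θ) := by
  have hV := image_symmDiff' (V := F.verts) (W := G.verts) hθ
  have hmem : ∀ x ∈ F.verts ∪ G.verts,
      θ x ∈ symmDiff (F.verts.image θ) (G.verts.image θ) ↔ x ∈ symmDiff F.verts G.verts := by
    intro x hx
    rw [← hV]
    constructor
    · intro h
      obtain ⟨y, hy, hxy⟩ := Finset.mem_image.1 h
      rwa [← hθ (Finset.symmDiff_subset_union hy) hx hxy]
    · exact Finset.mem_image_of_mem θ
  exact pathGraph_map θ (mapE θ F G) (follows_map hθ) plugSrc_mapE plugTgt_mapE plugWeight_mapE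
    hV.symm (fun _ => hmem _ (plugSrc_mem _)) (fun _ => hmem _ (plugTgt_mem _))

end Map

theorem _root_.IG.exists_rel_of_mem_chain {X : Type} {R : X → X → Prop} {c : Cycle X}
    (h : c.Chain R) {x : X} (hx : x ∈ c) : (∃ y ∈ c, R x y) ∧ ∃ y ∈ c, R y x := by
  obtain ⟨l, rfl⟩ : ∃ l : List X, c = ((x :: l : List X) : Cycle X) := by
    induction c using Quotient.inductionOn' with
    | _ l =>
    obtain ⟨s, t, rfl⟩ := List.append_of_mem (Cycle.mem_coe_iff.1 hx)
    exact ⟨t ++ s, Cycle.coe_eq_coe.2 (List.isRotated_append (l := s) (l' := x :: t))⟩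
  rw [Cycle.chain_coe_cons] at h
  constructor
  · rcases l with _ | ⟨y, l⟩
    · exact ⟨x, Cycle.mem_coe_iff.2 (by simp), (List.isChain_cons_cons.1 h).1⟩
    · exact ⟨y, Cycle.mem_coe_iff.2 (by simp), (List.isChain_cons_cons.1 h).1⟩
  · rw [← List.cons_append, List.isChain_append] at h
    refine ⟨(x :: l).getLast (by simp), Cycle.mem_coe_iff.2 (List.getLast_mem _), ?_⟩
    exact h.2.2 _ (List.getLast_mem_getLast? _) _ (by simp)

theorem _root_.IG.exists_mem_cycle {X : Type} {c : Cycle X} (h : c ≠ Cycle.nil) : ∃ x, x ∈ c := by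
  induction c using Quotient.inductionOn' with
  | _ l =>
  rcases l with _ | ⟨x, l⟩
  · exact absurd rfl h
  · exact ⟨x, Cycle.mem_coe_iff.2 (by simp)⟩

/-- There are no circuits when no edge of `F` can be both entered from `G` and left to `G`. -/
theorem meas_eq_zero (m : Weight → ℝ≥0∞) {F G : Graph L}
    (h : ∀ f : F.E, (∀ g : G.E, G.src g ≠ F.tgt f) ∨ ∀ g : G.E, F.src f ≠ G.tgt g) :
    meas m F G = 0 := by
  have : IsEmpty {c : Cycle (PlugE F G) // IsOneCircuit F G c} := by
    refine ⟨?_⟩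
    rintro ⟨c, hn, hc, -⟩
    have key : ∀ f : F.E, Sum.inl f ∉ c := by
      intro f hf
      obtain ⟨⟨y, -, hy⟩, ⟨z, -, hz⟩⟩ := exists_rel_of_mem_chain hc hf
      rcases h f with h | h
      · rcases y with y | y
        · exact hy.2 rfl
        · exact h y hy.1
      · rcases z with z | z
        · exact hz.2 rfl
        · exact h z hz.1
    obtain ⟨x, hx⟩ := exists_mem_cycle hn
    rcases x with x | x
    · exact key x hx
    · obtain ⟨⟨y, hy, hxy⟩, -⟩ := exists_rel_of_mem_chain hc hx
      rcases y with y | y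
      · exact key y hy
      · exact hxy.2 rfl
  exact tsum_empty

theorem meas_empty (m : Weight → ℝ≥0∞) (V : Finset L) (G : Graph L) :
    meas m (empty V) G = 0 :=
  meas_eq_zero m fun f => f.elim

theorem meas_disjoint (m : Weight → ℝ≥0∞) {F G : Graph L}
    (h : Disjoint F.verts G.verts) : meas m F G = 0 :=
  meas_eq_zero m fun f => Or.inl fun g hg =>
    Finset.disjoint_left.1 h (F.tgt_mem f) (hg ▸ G.src_mem g)

theorem exec_empty [DecidableEq L] (G : Graph L) : ((empty ∅).exec G).IsIso G := by
  let E : G.E → ((empty ∅).exec G).E := fun e =>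
    ⟨[Sum.inr e], List.IsChain.singleton _, by simp, by
      change G.src e ∈ symmDiff ∅ G.verts ∧ G.tgt e ∈ symmDiff ∅ G.verts
      simpa [symmDiff] using ⟨G.src_mem e, G.tgt_mem e⟩⟩
  have hE : Function.Bijective E := by
    constructor
    · intro e e' h
      simpa [E] using congrArg Subtype.val h
    · rintro ⟨l, hl, hn, -⟩
      rcases l with _ | ⟨x | x, _ | ⟨y | y, l⟩⟩
      · exact absurd rfl hn
      · exact x.elim
      · exact x.elim
      · exact x.elim
      · exact ⟨x, rfl⟩
      · exact y.elim
      · exact absurd rfl (List.isChain_cons_cons.1 hl).1.2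
  have hv : G.verts = symmDiff ∅ G.verts := by simp [symmDiff]
  refine Graph.IsIso.symm ⟨hv, Equiv.ofBijective E hE, fun e => ⟨rfl, rfl, ?_⟩⟩
  change (List.map _ [Sum.inr e]).prod = _
  simp [plugWeight]

theorem exec_empty_empty [DecidableEq L] (V W : Finset L) :
    ((empty V).exec (empty W)).IsIso (empty (symmDiff V W)) := by
  have h : IsEmpty ((empty V).exec (empty W)).E := by
    refine ⟨?_⟩
    rintro ⟨l, -, hn, -⟩
    rcases l.head hn with x | x <;> exact x.elim
  have h' : IsEmpty (empty (symmDiff V W)).E := inferInstanceAs (IsEmpty Empty)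
  exact ⟨rfl, Equiv.equivOfIsEmpty _ _, fun l => h.elim l⟩

section Fax

variable {K : Type} [DecidableEq L] {S : Finset K} {p q : K → L} {G : Graph K}

theorem meas_fax (m : Weight → ℝ≥0∞) (hG : G.verts = S) (hpq : ∀ x ∈ S, ∀ y ∈ S, p x ≠ q y) :
    meas m (fax S p q) (G.map p) = 0 := by
  refine meas_eq_zero m ?_
  rintro (x | x)
  · refine Or.inl fun g hg => ?_
    exact hpq _ (hG ▸ G.src_mem g) _ x.2 hg
  · refine Or.inr fun g hg => ?_
    exact hpq _ (hG ▸ G.tgt_mem g) _ x.2 hg.symm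

/-- Execution against a fax relocates a graph: the alternating paths with end points in the new
copy of the carrier are the edges of the graph, preceded and followed by one edge of the fax. -/
theorem exec_fax (hG : G.verts = S) (hp : Set.InjOn p S)
    (hpq : ∀ x ∈ S, ∀ y ∈ S, p x ≠ q y) :
    ((fax S p q).exec (G.map p)).IsIso (G.map q) := by
  have hV : symmDiff (S.image p ∪ S.image q) (G.verts.image p) = S.image q := by
    rw [hG]
    ext y
    simp only [Finset.mem_symmDiff, Finset.mem_union, Finset.mem_image]
    constructor
    · rintro (⟨h | h, h'⟩ | ⟨h, h'⟩)
      exacts [absurd h h', h, absurd (Or.inl h) h']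
    · rintro ⟨x, hx, rfl⟩
      refine Or.inl ⟨Or.inr ⟨x, hx, rfl⟩, ?_⟩
      rintro ⟨z, hz, hzx⟩
      exact hpq z hz x hx hzx
  have hsrc : ∀ e, G.src e ∈ S := fun e => hG ▸ G.src_mem e
  have htgt : ∀ e, G.tgt e ∈ S := fun e => hG ▸ G.tgt_mem e
  have hnot : ∀ x ∈ S, p x ∉ symmDiff (fax S p q).verts (G.map p).verts := by
    intro x hx h
    change _ ∈ symmDiff (S.image p ∪ S.image q) (G.verts.image p) at h
    rw [hV] at h
    obtain ⟨y, hy, hyx⟩ := Finset.mem_image.1 h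
    exact hpq x hx y hy hyx.symm
  have hyes : ∀ x ∈ S, q x ∈ symmDiff (fax S p q).verts (G.map p).verts := by
    intro x hx
    change _ ∈ symmDiff (S.image p ∪ S.image q) (G.verts.image p)
    rw [hV]
    exact Finset.mem_image_of_mem q hx
  -- an edge of `G` is traversed between the two fax edges at its end points
  let E : G.E → ((fax S p q).exec (G.map p)).E := fun e =>
    ⟨[Sum.inl (Sum.inr ⟨G.src e, hsrc e⟩), Sum.inr e, Sum.inl (Sum.inl ⟨G.tgt e, htgt e⟩)],
      List.isChain_cons_cons.2 ⟨⟨rfl, Bool.noConfusion⟩,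
        List.isChain_cons_cons.2 ⟨⟨rfl, Bool.noConfusion⟩, List.IsChain.singleton _⟩⟩,
      by simp, hyes _ (hsrc e), hyes _ (htgt e)⟩
  have hE : Function.Bijective E := by
    constructor
    · intro e e' h
      have := congrArg Subtype.val h
      simp only [E, List.cons.injEq] at this
      exact Sum.inr_injective this.2.1
    · rintro ⟨l, hl, hn, hh, ht⟩
      rcases l with _ | ⟨(x | x) | e, l⟩
      · exact absurd rfl hn
      · exact absurd hh (hnot _ x.2)
      · rcases l with _ | ⟨y | e, l⟩
        · exact absurd ht (hnot _ x.2)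
        · exact absurd rfl (List.isChain_cons_cons.1 hl).1.2
        obtain ⟨⟨h1, -⟩, hl⟩ := List.isChain_cons_cons.1 hl
        rcases l with _ | ⟨(y | y) | e', l⟩
        · exact absurd ht (hnot _ (htgt e))
        · obtain ⟨⟨h2, -⟩, hl⟩ := List.isChain_cons_cons.1 hl
          rcases l with _ | ⟨z | e', l⟩
          · refine ⟨e, Subtype.ext ?_⟩
            have e1 : (⟨G.src e, hsrc e⟩ : S) = x := Subtype.ext (hp (hsrc e) x.2 h1)
            have e2 : (⟨G.tgt e, htgt e⟩ : S) = y := Subtype.ext (hp (htgt e) y.2 h2.symm)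
            simp only [E]
            rw [e1, e2]
          · exact absurd rfl (List.isChain_cons_cons.1 hl).1.2
          · exact absurd (List.isChain_cons_cons.1 hl).1.1 (hpq _ (hsrc e') _ y.2)
        · obtain ⟨⟨h2, -⟩, hl⟩ := List.isChain_cons_cons.1 hl
          exact absurd h2.symm (hpq _ (htgt e) _ y.2)
        · exact absurd rfl (List.isChain_cons_cons.1 hl).1.2
      · exact absurd hh (hnot _ (hsrc e))
  refine Graph.IsIso.symm ⟨?_, Equiv.ofBijective E hE, fun e => ⟨rfl, rfl, ?_⟩⟩
  · change G.verts.image q = symmDiff (S.image p ∪ S.image q) (G.verts.image p)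
    rw [hV, hG]
  · change (1 : Weight) * (G.weight e * (1 * 1)) = G.weight e
    rw [one_mul, mul_one, mul_one]

end Fax

end Graph

end IG

namespace IG

/-! ### The values of the measurement -/

section Values

@[simp] theorem mulTop_coe (r x : ℝ) : mulTop r (x : WithTop ℝ) = ((r * x : ℝ) : WithTop ℝ) := rfl

@[simp] theorem mulTop_top (r : ℝ) : mulTop r ⊤ = ⊤ := rfl

@[simp] theorem mulTop_zero_right (r : ℝ) : mulTop r 0 = 0 := by
  change ((r * 0 : ℝ) : WithTop ℝ) = 0
  rw [mul_zero]
  rfl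

@[simp] theorem mulTop_one (x : WithTop ℝ) : mulTop 1 x = x := by
  induction x using WithTop.recTopCoe with
  | top => rfl
  | coe x => rw [mulTop_coe, one_mul]

theorem mulTop_eq_top {r : ℝ} {x : WithTop ℝ} : mulTop r x = ⊤ ↔ x = ⊤ := by
  induction x using WithTop.recTopCoe with
  | top => simp
  | coe x => exact iff_of_false WithTop.coe_ne_top WithTop.coe_ne_top

theorem mulTop_zero_left {x : WithTop ℝ} (h : x ≠ ⊤) : mulTop 0 x = 0 := by
  induction x using WithTop.recTopCoe with
  | top => exact absurd rfl h
  | coe x => rw [mulTop_coe, zero_mul]; rfl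

theorem mulTop_add (r : ℝ) (x y : WithTop ℝ) : mulTop r (x + y) = mulTop r x + mulTop r y := by
  induction x using WithTop.recTopCoe with
  | top => rfl
  | coe x =>
    induction y using WithTop.recTopCoe with
    | top => rfl
    | coe y =>
      rw [← WithTop.coe_add, mulTop_coe, mulTop_coe, mulTop_coe, ← WithTop.coe_add, mul_add]

theorem add_mulTop (r s : ℝ) (x : WithTop ℝ) : mulTop (r + s) x = mulTop r x + mulTop s x := by
  induction x using WithTop.recTopCoe with
  | top => rfl
  | coe x => rw [mulTop_coe, mulTop_coe, mulTop_coe, ← WithTop.coe_add, add_mul]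

theorem mulTop_mulTop (r s : ℝ) (x : WithTop ℝ) : mulTop r (mulTop s x) = mulTop (r * s) x := by
  induction x using WithTop.recTopCoe with
  | top => rfl
  | coe x => rw [mulTop_coe, mulTop_coe, mulTop_coe, mul_assoc]

theorem mulTop_sum {ι : Type} (s : Finset ι) (r : ℝ) (f : ι → WithTop ℝ) :
    mulTop r (∑ i ∈ s, f i) = ∑ i ∈ s, mulTop r (f i) := by
  classical
  induction s using Finset.induction_on with
  | empty => simp
  | insert i s hi ih => rw [Finset.sum_insert hi, Finset.sum_insert hi, mulTop_add, ih]

/-- The family must be nonempty, because `0 · ∞ = ∞` while the empty sum is `0`. -/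
theorem sum_mulTop {ι : Type} [Fintype ι] [Nonempty ι] (r : ι → ℝ) (x : WithTop ℝ) :
    mulTop (∑ i, r i) x = ∑ i, mulTop (r i) x := by
  induction x using WithTop.recTopCoe with
  | top =>
    rw [mulTop_top]
    symm
    rw [WithTop.sum_eq_top]
    exact ⟨Classical.arbitrary ι, Finset.mem_univ _, rfl⟩
  | coe x =>
    simp only [mulTop_coe]
    rw [Finset.sum_mul, WithTop.coe_sum]

@[simp] theorem ennToTop_zero : ennToTop 0 = 0 := by simp [ennToTop]

theorem ennToTop_add (x y : ℝ≥0∞) : ennToTop (x + y) = ennToTop x + ennToTop y := by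
  unfold ennToTop
  by_cases hx : x = ∞
  · simp [hx]
  · by_cases hy : y = ∞
    · simp [hy]
    · rw [if_neg hx, if_neg hy, if_neg (ENNReal.add_ne_top.2 ⟨hx, hy⟩), ENNReal.toReal_add hx hy]
      rfl

end Values

/-! ### Isomorphisms of projects, and associativity of the cut -/

namespace Project

variable {L L' : Type}

/-- Isomorphisms of projects: bijections of the slices that preserve the coefficients and the
graphs, up to isomorphism. -/
def IsIso (a b : Project L) : Prop :=
  a.wager = b.wager ∧ a.carrier = b.carrier ∧
    ∃ e : a.I ≃ b.I, ∀ i, b.coeff (e i) = a.coeff i ∧ (a.slice i).IsIso (b.slice (e i))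

theorem IsIso.refl (a : Project L) : a.IsIso a :=
  ⟨rfl, rfl, Equiv.refl _, fun _ => ⟨rfl, Graph.IsIso.refl _⟩⟩

theorem IsIso.symm {a b : Project L} (h : a.IsIso b) : b.IsIso a := by
  obtain ⟨hw, hc, e, he⟩ := h
  refine ⟨hw.symm, hc.symm, e.symm, fun i => ?_⟩
  obtain ⟨h1, h2⟩ := he (e.symm i)
  rw [e.apply_symm_apply] at h1 h2
  exact ⟨h1.symm, h2.symm⟩

theorem IsIso.trans {a b c : Project L} (h : a.IsIso b) (h' : b.IsIso c) : a.IsIso c := by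
  obtain ⟨hw, hc, e, he⟩ := h
  obtain ⟨hw', hc', e', he'⟩ := h'
  exact ⟨hw.trans hw', hc.trans hc', e.trans e', fun i =>
    ⟨((he' (e i)).1).trans (he i).1, (he i).2.trans (he' (e i)).2⟩⟩

theorem IsIso.unit_eq {a b : Project L} (h : a.IsIso b) : a.unit = b.unit := by
  obtain ⟨-, -, e, he⟩ := h
  exact Fintype.sum_equiv e _ _ fun i => (he i).1.symm

theorem sca_congr (m : Weight → ℝ≥0∞) {a a' b b' : Project L} (h : a.IsIso a')
    (h' : b.IsIso b') : a.sca m b = a'.sca m b' := by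
  have hu := h.unit_eq
  have hu' := h'.unit_eq
  obtain ⟨hw, -, e, he⟩ := h
  obtain ⟨hw', -, e', he'⟩ := h'
  unfold sca
  rw [hu, hu', hw, hw']
  congr 1
  refine Fintype.sum_equiv (Equiv.prodCongr e e') _ _ fun p => ?_
  rw [Graph.meas_congr m (he p.1).2 (he' p.2).2, ← (he p.1).1, ← (he' p.2).1]
  rfl

theorem cut_congr [DecidableEq L] (m : Weight → ℝ≥0∞) {a a' b b' : Project L} (h : a.IsIso a')
    (h' : b.IsIso b') : (a.cut m b).IsIso (a'.cut m b') := by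
  refine ⟨sca_congr m h h', ?_, ?_⟩
  · exact congrArg₂ symmDiff h.2.1 h'.2.1
  · obtain ⟨-, -, e, he⟩ := h
    obtain ⟨-, -, e', he'⟩ := h'
    refine ⟨Equiv.prodCongr e e', fun p => ⟨?_, Graph.exec_congr (he p.1).2 (he' p.2).2⟩⟩
    exact congrArg₂ (· * ·) (he p.1).1 (he' p.2).1

theorem cut_comm [DecidableEq L] (m : Weight → ℝ≥0∞) (a b : Project L) :
    (a.cut m b).IsIso (b.cut m a) :=
  ⟨sca_comm m a b, symmDiff_comm _ _, Equiv.prodComm _ _,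
    fun _ => ⟨mul_comm _ _, Graph.exec_comm _ _⟩⟩

theorem unit_cut [DecidableEq L] (m : Weight → ℝ≥0∞) (a b : Project L) :
    (a.cut m b).unit = a.unit * b.unit := by
  unfold unit
  rw [Finset.sum_mul_sum]
  exact Fintype.sum_prod_type _

section Assoc

variable [DecidableEq L] (m : Weight → ℝ≥0∞) (a b c : Project L)

/-- The part of the measurement of `a :: b` and `c` that does not involve the wagers. -/
theorem meas_cut_add :
    mulTop c.unit (meas m a b) + meas m (a.cut m b) c =
      ∑ i : a.I, ∑ j : b.I, ∑ k : c.I, mulTop (a.coeff i * b.coeff j * c.coeff k)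
        (ennToTop (Graph.meas m (a.slice i) (b.slice j) +
          Graph.meas m ((a.slice i).exec (b.slice j)) (c.slice k))) := by
  have h1 : mulTop c.unit (meas m a b) = ∑ i : a.I, ∑ j : b.I, ∑ k : c.I,
      mulTop (a.coeff i * b.coeff j * c.coeff k)
        (ennToTop (Graph.meas m (a.slice i) (b.slice j))) := by
    unfold meas unit
    rw [mulTop_sum, Fintype.sum_prod_type]
    refine Finset.sum_congr rfl fun i _ => Finset.sum_congr rfl fun j _ => ?_
    rw [sum_mulTop]
    refine Finset.sum_congr rfl fun k _ => ?_
    rw [mulTop_mulTop, mul_comm]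
  have h2 : meas m (a.cut m b) c = ∑ i : a.I, ∑ j : b.I, ∑ k : c.I,
      mulTop (a.coeff i * b.coeff j * c.coeff k)
        (ennToTop (Graph.meas m ((a.slice i).exec (b.slice j)) (c.slice k))) := by
    unfold meas
    rw [Fintype.sum_prod_type]
    exact Fintype.sum_prod_type _
  rw [h1, h2]
  simp only [← Finset.sum_add_distrib, ennToTop_add, mulTop_add]

variable {a b c}

/-- The adjunction: a consequence of the trefoil property. -/
theorem sca_cut_assoc (h : ∀ x ∈ a.carrier, x ∈ b.carrier → x ∉ c.carrier) :
    (a.cut m b).sca m c = a.sca m (b.cut m c) := by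
  have h1 : (a.cut m b).sca m c = mulTop c.unit (mulTop b.unit a.wager) +
      mulTop c.unit (mulTop a.unit b.wager) + mulTop (a.unit * b.unit) c.wager +
      (mulTop c.unit (meas m a b) + meas m (a.cut m b) c) := by
    rw [sca, unit_cut]
    change mulTop c.unit (sca m a b) + _ + _ = _
    rw [sca, mulTop_add, mulTop_add]
    abel
  have h2 : a.sca m (b.cut m c) = mulTop (b.unit * c.unit) a.wager +
      mulTop a.unit (mulTop c.unit b.wager) + mulTop a.unit (mulTop b.unit c.wager) +
      (mulTop a.unit (meas m b c) + meas m (b.cut m c) a) := by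
    rw [sca_comm, sca, unit_cut]
    change mulTop a.unit (sca m b c) + _ + _ = _
    rw [sca, mulTop_add, mulTop_add]
    abel
  rw [h1, h2, meas_cut_add, meas_cut_add]
  congr 1
  · rw [mulTop_mulTop, mulTop_mulTop, mulTop_mulTop, mulTop_mulTop, mul_comm c.unit b.unit,
      mul_comm c.unit a.unit]
  · have hG : ∀ i j k, ∀ x ∈ (a.slice i).verts, x ∈ (b.slice j).verts →
        x ∉ (c.slice k).verts := by
      intro i j k
      rw [a.slice_verts, b.slice_verts, c.slice_verts]
      exact h
    rw [Finset.sum_comm]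
    refine Finset.sum_congr rfl fun j _ => ?_
    rw [Finset.sum_comm]
    refine Finset.sum_congr rfl fun k _ => Finset.sum_congr rfl fun i _ => ?_
    rw [Graph.trefoil m (hG i j k), Graph.meas_comm m (a.slice i) (Graph.exec _ _)]
    congr 1
    ring

theorem cut_assoc (h : ∀ x ∈ a.carrier, x ∈ b.carrier → x ∉ c.carrier) :
    ((a.cut m b).cut m c).IsIso (a.cut m (b.cut m c)) := by
  refine ⟨sca_cut_assoc m h, symmDiff_assoc _ _ _, Equiv.prodAssoc _ _ _, fun p => ⟨?_, ?_⟩⟩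
  · exact (mul_assoc _ _ _).symm
  · refine Graph.exec_assoc ?_
    rw [a.slice_verts, b.slice_verts, c.slice_verts]
    exact h

end Assoc

theorem map_congr [DecidableEq L'] (θ : L → L') {a a' : Project L} (h : a.IsIso a') :
    (a.map θ).IsIso (a'.map θ) := by
  obtain ⟨hw, hc, e, he⟩ := h
  exact ⟨hw, congrArg (Finset.image θ) hc, e, fun i => ⟨(he i).1, Graph.map_congr θ (he i).2⟩⟩

theorem injOn_slices {θ : L → L'} [DecidableEq L] {a b : Project L}
    (h : Set.InjOn θ (a.carrier ∪ b.carrier : Finset L)) (i : a.I) (j : b.I) :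
    Set.InjOn θ ((a.slice i).verts ∪ (b.slice j).verts : Finset L) := by
  rwa [a.slice_verts, b.slice_verts]

theorem sca_map' [DecidableEq L] [DecidableEq L'] (m : Weight → ℝ≥0∞) {θ : L → L'}
    {a b : Project L} (h : Set.InjOn θ (a.carrier ∪ b.carrier : Finset L)) :
    (a.map θ).sca m (b.map θ) = a.sca m b := by
  have : meas m (a.map θ) (b.map θ) = meas m a b := by
    unfold meas
    refine Finset.sum_congr rfl fun p _ => ?_
    rw [← Graph.meas_map' m (injOn_slices h p.1 p.2)]
    rfl
  unfold sca
  rw [this]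
  rfl

theorem cut_map [DecidableEq L] [DecidableEq L'] (m : Weight → ℝ≥0∞) {θ : L → L'}
    {a b : Project L} (h : Set.InjOn θ (a.carrier ∪ b.carrier : Finset L)) :
    ((a.map θ).cut m (b.map θ)).IsIso ((a.cut m b).map θ) := by
  refine ⟨sca_map' m h, (Graph.image_symmDiff' h).symm, Equiv.refl _, fun p =>
    ⟨rfl, Graph.exec_map (injOn_slices h p.1 p.2)⟩⟩

theorem sca_addSmul (m : Weight → ℝ≥0∞) (a : Project L) (r : ℝ) (b : Project L)
    (h : b.carrier = a.carrier) (c : Project L) :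
    (a.addSmul r b h).sca m c = a.sca m c + mulTop r (b.sca m c) := by
  have h1 : (a.addSmul r b h).unit = a.unit + r * b.unit := by
    unfold unit
    rw [Finset.mul_sum]
    exact Fintype.sum_sum_type _
  have h2 : meas m (a.addSmul r b h) c = meas m a c + mulTop r (meas m b c) := by
    unfold meas
    rw [mulTop_sum, Fintype.sum_prod_type, Fintype.sum_prod_type, Fintype.sum_prod_type]
    refine (Fintype.sum_sum_type _).trans ?_
    congr 1
    refine Finset.sum_congr rfl fun j _ => Finset.sum_congr rfl fun k _ => ?_
    rw [mulTop_mulTop, ← mul_assoc]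
    rfl
  unfold sca
  rw [h1, h2]
  change mulTop c.unit (a.wager + mulTop r b.wager) + _ + _ = _
  simp only [mulTop_add, add_mulTop, mulTop_mulTop]
  rw [mul_comm c.unit r]
  abel

end Project

/-! ### Projects up to isomorphism -/

/-- The isomorphism relation on projects. -/
def projectSetoid (L : Type) : Setoid (Project L) where
  r := Project.IsIso
  iseqv := ⟨Project.IsIso.refl, Project.IsIso.symm, Project.IsIso.trans⟩

/-- Projects up to isomorphism. The parameter `m` of the measurement is recorded in the type, so
that the cut can be written as a multiplication. That multiplication is commutative, and it is
associative for carriers without a common element. -/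
def Proj (_ : Weight → ℝ≥0∞) (L : Type) : Type 1 := Quotient (projectSetoid L)

namespace Proj

variable {m : Weight → ℝ≥0∞} {L L' L'' : Type}

variable (m) in
/-- The isomorphism class of a project. -/
def mk (a : Project L) : Proj m L := Quotient.mk (projectSetoid L) a

theorem mk_eq {a b : Project L} (h : a.IsIso b) : mk m a = mk m b :=
  Quotient.sound (s := projectSetoid L) h

theorem exists_rep (x : Proj m L) : ∃ a, mk m a = x := Quotient.exists_rep x

/-- The carrier. -/
def carrier : Proj m L → Finset L :=
  Quotient.lift (s := projectSetoid L) Project.carrier fun _ _ h => h.2.1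

/-- The wager. -/
def wager : Proj m L → WithTop ℝ :=
  Quotient.lift (s := projectSetoid L) Project.wager fun _ _ h => h.1

/-- The sum of the coefficients of the slices. -/
def unit : Proj m L → ℝ :=
  Quotient.lift (s := projectSetoid L) Project.unit fun _ _ h => h.unit_eq

/-- The measurement. -/
noncomputable def sca : Proj m L → Proj m L → WithTop ℝ :=
  Quotient.lift₂ (s₁ := projectSetoid L) (s₂ := projectSetoid L) (Project.sca m)
    fun _ _ _ _ h h' => Project.sca_congr m h h'

theorem sca_mk (a b : Project L) : (mk m a).sca (mk m b) = a.sca m b := rfl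

section Mul

variable [DecidableEq L]

/-- The cut of projects. -/
noncomputable instance : Mul (Proj m L) where
  mul := Quotient.lift₂ (s₁ := projectSetoid L) (s₂ := projectSetoid L)
    (fun a b => mk m (a.cut m b)) fun _ _ _ _ h h' => mk_eq (Project.cut_congr m h h')

theorem mk_cut (a b : Project L) : mk m (a.cut m b) = mk m a * mk m b := rfl

protected theorem mul_comm (x y : Proj m L) : x * y = y * x := by
  obtain ⟨a, rfl⟩ := exists_rep x
  obtain ⟨b, rfl⟩ := exists_rep y
  exact mk_eq (Project.cut_comm m a b)

protected theorem mul_assoc {x y z : Proj m L}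
    (h : ∀ v ∈ x.carrier, v ∈ y.carrier → v ∉ z.carrier) : x * y * z = x * (y * z) := by
  obtain ⟨a, rfl⟩ := exists_rep x
  obtain ⟨b, rfl⟩ := exists_rep y
  obtain ⟨c, rfl⟩ := exists_rep z
  exact mk_eq (Project.cut_assoc m h)

theorem wager_mul (x y : Proj m L) : (x * y).wager = x.sca y := by
  obtain ⟨a, rfl⟩ := exists_rep x
  obtain ⟨b, rfl⟩ := exists_rep y
  rfl

theorem carrier_mul (x y : Proj m L) : (x * y).carrier = symmDiff x.carrier y.carrier := by
  obtain ⟨a, rfl⟩ := exists_rep x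
  obtain ⟨b, rfl⟩ := exists_rep y
  rfl

theorem unit_mul (x y : Proj m L) : (x * y).unit = x.unit * y.unit := by
  obtain ⟨a, rfl⟩ := exists_rep x
  obtain ⟨b, rfl⟩ := exists_rep y
  exact Project.unit_cut m a b

/-- The adjunction between the cut and the measurement. -/
theorem sca_mul {x y z : Proj m L} (h : ∀ v ∈ x.carrier, v ∈ y.carrier → v ∉ z.carrier) :
    (x * y).sca z = x.sca (y * z) := by
  rw [← wager_mul, ← wager_mul, Proj.mul_assoc h]

end Mul

theorem sca_comm (x y : Proj m L) : x.sca y = y.sca x := by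
  obtain ⟨a, rfl⟩ := exists_rep x
  obtain ⟨b, rfl⟩ := exists_rep y
  exact Project.sca_comm m a b

theorem sca_of_disjoint {x y : Proj m L} (h : Disjoint x.carrier y.carrier) :
    x.sca y = mulTop y.unit x.wager + mulTop x.unit y.wager := by
  obtain ⟨a, rfl⟩ := exists_rep x
  obtain ⟨b, rfl⟩ := exists_rep y
  rw [sca_mk, Project.sca]
  have : Project.meas m a b = 0 := by
    refine Finset.sum_eq_zero fun p _ => ?_
    rw [Graph.meas_disjoint, ennToTop_zero, mulTop_zero_right]
    rw [a.slice_verts, b.slice_verts]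
    exact h
  rw [this, add_zero]
  rfl

section Map

variable [DecidableEq L'] [DecidableEq L'']

/-- Delocation. -/
def map (θ : L → L') : Proj m L → Proj m L' :=
  Quotient.lift (s := projectSetoid L) (fun a => mk m (a.map θ))
    fun _ _ h => mk_eq (Project.map_congr θ h)

theorem mk_map (θ : L → L') (a : Project L) : mk m (a.map θ) = (mk m a).map θ := rfl

@[simp] theorem carrier_map (θ : L → L') (x : Proj m L) :
    (x.map θ).carrier = x.carrier.image θ := by
  obtain ⟨a, rfl⟩ := exists_rep x
  rfl

@[simp] theorem wager_map (θ : L → L') (x : Proj m L) : (x.map θ).wager = x.wager := by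
  obtain ⟨a, rfl⟩ := exists_rep x
  rfl

@[simp] theorem unit_map (θ : L → L') (x : Proj m L) : (x.map θ).unit = x.unit := by
  obtain ⟨a, rfl⟩ := exists_rep x
  rfl

theorem map_map (θ : L → L') (η : L' → L'') (x : Proj m L) :
    (x.map θ).map η = x.map (η ∘ θ) := by
  obtain ⟨a, rfl⟩ := exists_rep x
  exact mk_eq ⟨rfl, Finset.image_image, Equiv.refl _, fun _ =>
    ⟨rfl, Graph.map_map_isIso _ _ _⟩⟩

theorem map_congr {θ η : L → L'} {x : Proj m L} (h : ∀ v ∈ x.carrier, θ v = η v) :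
    x.map θ = x.map η := by
  obtain ⟨a, rfl⟩ := exists_rep x
  refine mk_eq ⟨rfl, Finset.image_congr fun v hv => h v hv, Equiv.refl _, fun i => ⟨rfl, ?_⟩⟩
  refine Graph.map_isIso_of_eqOn fun v hv => h v ?_
  exact (Finset.ext_iff.1 (a.slice_verts i) v).1 hv

theorem map_eq_self [DecidableEq L] {θ : L → L} {x : Proj m L} (h : ∀ v ∈ x.carrier, θ v = v) :
    x.map θ = x := by
  rw [map_congr (η := id) h]
  obtain ⟨a, rfl⟩ := exists_rep x
  exact mk_eq ⟨rfl, Finset.image_id, Equiv.refl _, fun _ => ⟨rfl, Graph.map_id_isIso _⟩⟩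

/-- Every project whose carrier is contained in the image of `θ` is relocated by `θ`. -/
theorem exists_map_eq [DecidableEq L] [Nonempty L] {θ : L → L'} (hθ : Function.Injective θ)
    {V : Finset L} {y : Proj m L'} (hy : y.carrier = V.image θ) :
    ∃ x : Proj m L, x.carrier = V ∧ x.map θ = y := by
  have hinv : ∀ v ∈ V.image θ, θ (Function.invFun θ v) = v := by
    intro v hv
    obtain ⟨u, -, rfl⟩ := Finset.mem_image.1 hv
    rw [Function.leftInverse_invFun hθ]
  refine ⟨y.map (Function.invFun θ), ?_, ?_⟩
  · rw [carrier_map, hy, Finset.image_image, (Function.leftInverse_invFun hθ).comp_eq_id,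
      Finset.image_id]
  · rw [map_map]
    refine map_eq_self fun v hv => hinv v ?_
    rwa [hy] at hv

theorem map_mul [DecidableEq L] {θ : L → L'} {x y : Proj m L}
    (h : Set.InjOn θ (x.carrier ∪ y.carrier : Finset L)) :
    (x * y).map θ = x.map θ * y.map θ := by
  obtain ⟨a, rfl⟩ := exists_rep x
  obtain ⟨b, rfl⟩ := exists_rep y
  exact (mk_eq (Project.cut_map m h)).symm

theorem map_mul_of_injective [DecidableEq L] {θ : L → L'} (hθ : Function.Injective θ)
    (x y : Proj m L) : (x * y).map θ = x.map θ * y.map θ :=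
  map_mul hθ.injOn

theorem sca_map [DecidableEq L] {θ : L → L'} {x y : Proj m L}
    (h : Set.InjOn θ (x.carrier ∪ y.carrier : Finset L)) :
    (x.map θ).sca (y.map θ) = x.sca y := by
  rw [← wager_mul, ← map_mul h, wager_map, wager_mul]

end Map

/-! ### The projects `0_V`, faxes, linear combinations -/

variable (m) in
/-- The project of carrier `V` and wager `w` whose only slice is the graph without edges, with
coefficient `u`. -/
def const (V : Finset L) (w : WithTop ℝ) (u : ℝ) : Proj m L :=
  mk m { wager := w, carrier := V, I := Unit, coeff := fun _ => u,
         slice := fun _ => Graph.empty V, slice_verts := fun _ => rfl }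

variable (m) in
/-- The project `0_V`. -/
def zero (V : Finset L) : Proj m L := const m V 0 1

section Const

variable {V : Finset L} {w : WithTop ℝ} {u : ℝ}

@[simp] theorem wager_const : (const m V w u).wager = w := rfl
@[simp] theorem unit_const : (const m V w u).unit = u := by
  change ∑ _ : Unit, u = u
  simp
@[simp] theorem carrier_zero : (zero m V).carrier = V := rfl
@[simp] theorem wager_zero : (zero m V).wager = 0 := rfl
@[simp] theorem unit_zero : (zero m V).unit = 1 := unit_const

theorem const_sca (x : Proj m L) :
    (const m V w u).sca x = mulTop x.unit w + mulTop u x.wager := by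
  obtain ⟨a, rfl⟩ := exists_rep x
  change Project.sca m _ a = _
  rw [Project.sca]
  have : ∀ b : Project L, (∀ i, b.slice i = Graph.empty V) → Project.meas m b a = 0 := by
    intro b hb
    refine Finset.sum_eq_zero fun p _ => ?_
    rw [hb, Graph.meas_empty, ennToTop_zero, mulTop_zero_right]
  rw [this _ fun _ => rfl, add_zero]
  congr 2
  exact unit_const (m := m) (V := V) (w := w) (u := u)

@[simp] theorem zero_sca (x : Proj m L) : (zero m V).sca x = x.wager := by
  rw [zero, const_sca, mulTop_zero_right, mulTop_one, zero_add]

@[simp] theorem sca_zero (x : Proj m L) : x.sca (zero m V) = x.wager := by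
  rw [sca_comm, zero_sca]

theorem map_zero [DecidableEq L'] (θ : L → L') : (zero m V).map θ = zero m (V.image θ) :=
  mk_eq ⟨rfl, rfl, Equiv.refl _, fun _ => ⟨rfl, rfl, Equiv.refl _, fun x => x.elim⟩⟩

variable [DecidableEq L]

@[simp] theorem zero_mul (x : Proj m L) : zero m ∅ * x = x := by
  obtain ⟨a, rfl⟩ := exists_rep x
  refine mk_eq ⟨?_, ?_, Equiv.punitProd a.I, fun p => ⟨?_, Graph.exec_empty _⟩⟩
  · exact zero_sca (m := m) (V := ∅) (mk m a)
  · exact bot_symmDiff a.carrier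
  · exact (one_mul _).symm

@[simp] theorem mul_zero (x : Proj m L) : x * zero m ∅ = x := by
  rw [Proj.mul_comm, zero_mul]

theorem zero_mul_zero (V W : Finset L) : zero m V * zero m W = zero m (symmDiff V W) := by
  refine mk_eq ⟨?_, rfl, Equiv.punitProd Unit, fun p => ⟨?_, Graph.exec_empty_empty _ _⟩⟩
  · exact zero_sca (m := m) (V := V) (zero m W)
  · exact (one_mul (1 : ℝ)).symm

end Const

variable (m) in
/-- The project `Fax`. -/
def fax {K : Type} [DecidableEq L] (S : Finset K) (p q : K → L) : Proj m L :=
  mk m (Project.fax S p q)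

theorem carrier_fax {K : Type} [DecidableEq L] (S : Finset K) (p q : K → L) :
    (fax m S p q).carrier = S.image p ∪ S.image q := rfl

/-- The cut against a fax is a relocation. -/
theorem fax_mul {K : Type} [DecidableEq L] {p q : K → L} {x : Proj m K}
    {S : Finset K} (hx : x.carrier = S)
    (hp : Set.InjOn p S) (hpq : ∀ v ∈ S, ∀ w ∈ S, p v ≠ q w) :
    fax m S p q * x.map p = x.map q := by
  obtain ⟨a, rfl⟩ := exists_rep x
  have hs : ∀ i, (a.slice i).verts = S := fun i => (a.slice_verts i).trans hx
  refine mk_eq ⟨?_, ?_, Equiv.punitProd a.I, fun i => ⟨?_, Graph.exec_fax (hs _) hp hpq⟩⟩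
  · change Project.sca m (Project.fax S p q) (a.map p) = a.wager
    rw [Project.sca]
    have : Project.meas m (Project.fax S p q) (a.map p) = 0 := by
      refine Finset.sum_eq_zero fun i _ => ?_
      have := Graph.meas_fax m (hs i.2) hpq
      change mulTop _ (ennToTop (Graph.meas m (Graph.fax S p q) ((a.slice i.2).map p))) = 0
      rw [this, ennToTop_zero, mulTop_zero_right]
    rw [this, add_zero]
    change mulTop _ 0 + mulTop (∑ _ : Unit, 1) a.wager = a.wager
    simp
  · have h1 := (Graph.exec_fax (G := Graph.empty S) rfl hp hpq).1
    change symmDiff (S.image p ∪ S.image q) (S.image p) = S.image q at h1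
    change symmDiff (S.image p ∪ S.image q) (a.carrier.image p) = a.carrier.image q
    rw [show a.carrier = S from hx]
    exact h1
  · exact (one_mul _).symm

/-- The project `x + r y`, characterized by its carrier and by its measurements. -/
theorem exists_add (x y : Proj m L) (h : y.carrier = x.carrier) (r : ℝ) :
    ∃ z : Proj m L, z.carrier = x.carrier ∧ ∀ w, z.sca w = x.sca w + mulTop r (y.sca w) := by
  obtain ⟨a, rfl⟩ := exists_rep x
  obtain ⟨b, rfl⟩ := exists_rep y
  refine ⟨mk m (a.addSmul r b h), rfl, fun w => ?_⟩
  obtain ⟨c, rfl⟩ := exists_rep w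
  exact Project.sca_addSmul m a r b h c

end Proj

end IG

namespace IG

/-! ### Conducts as sets of projects up to isomorphism -/

namespace Proj

variable {m : Weight → ℝ≥0∞} {L L' : Type}

/-- Orthogonality. -/
def Perp (x y : Proj m L) : Prop := x.sca y ≠ 0 ∧ x.sca y ≠ ⊤

theorem perp_comm {x y : Proj m L} : x.Perp y ↔ y.Perp x := by
  unfold Perp
  rw [sca_comm]

theorem perp_mk {a b : Project L} : (mk m a).Perp (mk m b) ↔ a.Perp m b := Iff.rfl

end Proj

namespace Conduct

variable {m : Weight → ℝ≥0∞} {L L' : Type}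

/-- The isomorphism classes of the projects of a conduct. -/
instance : Membership (Proj m L) (Conduct m L) where
  mem A x := ∃ a ∈ A.projects, Proj.mk m a = x

theorem mem_projects_iff (A : Conduct m L) {a : Project L} :
    a ∈ A.projects ↔ a.carrier = A.carrier ∧ ∀ b ∈ A.orth.projects, b.Perp m a := by
  conv_lhs => rw [← A.closed]
  exact Iff.rfl

theorem mem_orth_projects_iff (A : Conduct m L) {a : Project L} :
    a ∈ A.orth.projects ↔ a.carrier = A.carrier ∧ ∀ b ∈ A.projects, b.Perp m a := Iff.rfl

/-- Conducts are closed under isomorphism. -/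
theorem mk_mem {A : Conduct m L} {a : Project L} : Proj.mk m a ∈ A ↔ a ∈ A.projects := by
  constructor
  · rintro ⟨b, hb, hab⟩
    have h : b.IsIso a := Quotient.exact (s := projectSetoid L) hab
    rw [mem_projects_iff] at hb ⊢
    refine ⟨h.2.1.symm.trans hb.1, fun c hc => ?_⟩
    have := hb.2 c hc
    unfold Project.Perp at this ⊢
    rwa [← Project.sca_congr m (Project.IsIso.refl c) h]
  · exact fun h => ⟨a, h, rfl⟩

theorem carrier_eq_of_mem {A : Conduct m L} {x : Proj m L} (h : x ∈ A) :
    x.carrier = A.carrier := by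
  obtain ⟨a, ha, rfl⟩ := h
  exact A.carrier_eq ha

@[simp] theorem carrier_orth (A : Conduct m L) : A.orth.carrier = A.carrier := rfl

@[simp] theorem orth_orth (A : Conduct m L) : A.orth.orth = A := by
  ext1
  · rfl
  · exact A.closed

theorem mem_orth {A : Conduct m L} {y : Proj m L} :
    y ∈ A.orth ↔ y.carrier = A.carrier ∧ ∀ x ∈ A, x.Perp y := by
  obtain ⟨b, rfl⟩ := Proj.exists_rep y
  rw [mk_mem, mem_orth_projects_iff]
  refine and_congr Iff.rfl ⟨?_, fun h a ha => h _ (mk_mem.2 ha)⟩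
  rintro h _ ⟨c, hc, rfl⟩
  exact h c hc

theorem mem_iff {A : Conduct m L} {x : Proj m L} :
    x ∈ A ↔ x.carrier = A.carrier ∧ ∀ y ∈ A.orth, x.Perp y := by
  conv_lhs => rw [← A.orth_orth]
  rw [mem_orth]
  simp only [Proj.perp_comm (x := x)]
  rfl

theorem perp_of_mem {A : Conduct m L} {x y : Proj m L} (hx : x ∈ A) (hy : y ∈ A.orth) :
    x.Perp y := (mem_orth.1 hy).2 x hx

theorem ext_of_mem {A B : Conduct m L} (h : A.carrier = B.carrier)
    (h' : ∀ x : Proj m L, x ∈ A ↔ x ∈ B) : A = B := by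
  ext1
  · exact h
  · ext a
    rw [← mk_mem, ← mk_mem, h']

theorem nonempty_projects_iff {A : Conduct m L} :
    A.projects.Nonempty ↔ ∃ x : Proj m L, x ∈ A :=
  ⟨fun ⟨_, ha⟩ => ⟨_, mk_mem.2 ha⟩, fun ⟨_, a, ha, _⟩ => ⟨a, ha⟩⟩

/-! ### Generating sets -/

/-- `S` generates `A`, i.e. `A = S^⊥⊥`. -/
structure IsGen (A : Conduct m L) (S : Set (Proj m L)) : Prop where
  mem : ∀ s ∈ S, s ∈ A
  mem_orth : ∀ y : Proj m L, y.carrier = A.carrier → (∀ s ∈ S, s.Perp y) → y ∈ A.orth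

theorem isGen_self (A : Conduct m L) : A.IsGen {x | x ∈ A} :=
  ⟨fun _ h => h, fun _ hy h => Conduct.mem_orth.2 ⟨hy, h⟩⟩

theorem isGen_gen (V : Finset L) {S : Set (Project L)} (h : ∀ a ∈ S, a.carrier = V) :
    (gen m V S).IsGen {x | ∃ a ∈ S, Proj.mk m a = x} := by
  constructor
  · rintro _ ⟨a, ha, rfl⟩
    exact mk_mem.2 (subset_orthSet_orthSet m V h ha)
  · intro y hy hs
    obtain ⟨b, rfl⟩ := Proj.exists_rep y
    rw [mk_mem]
    change b ∈ orthSet m V (orthSet m V (orthSet m V S))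
    rw [orthSet_closed m V h]
    exact ⟨hy, fun a ha => hs _ ⟨a, ha, rfl⟩⟩

theorem IsGen.mem_iff {A : Conduct m L} {S : Set (Proj m L)} (hS : A.orth.IsGen S)
    {x : Proj m L} : x ∈ A ↔ x.carrier = A.carrier ∧ ∀ s ∈ S, s.Perp x := by
  constructor
  · exact fun h => ⟨carrier_eq_of_mem h, fun s hs => Proj.perp_comm.1 (perp_of_mem h (hS.mem s hs))⟩
  · rintro ⟨h1, h2⟩
    rw [← A.orth_orth]
    exact hS.mem_orth x h1 h2

/-- Two elements of `A^⊥` whose measurements against a generating set of `A` agree have the same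
measurements against all of `A`: otherwise, some combination `y + r (y - y')` would still be
orthogonal to the generating set, but its measurement against an element of `A` would vanish. -/
theorem IsGen.agree {A : Conduct m L} {S : Set (Proj m L)} (hS : A.IsGen S) {y y' : Proj m L}
    (hy : y ∈ A.orth) (hy' : y' ∈ A.orth) (h : ∀ s ∈ S, s.sca y = s.sca y') {x : Proj m L}
    (hx : x ∈ A) : x.sca y = x.sca y' := by
  have hc : y.carrier = A.carrier := carrier_eq_of_mem (A := A.orth) hy
  have hc' : y'.carrier = A.carrier := carrier_eq_of_mem (A := A.orth) hy'
  have key : ∀ r : ℝ, y.sca x + mulTop r (y.sca x) + mulTop (-r) (y'.sca x) ≠ 0 := by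
    intro r
    obtain ⟨z, hz, hz'⟩ := Proj.exists_add y y rfl r
    obtain ⟨w, hw, hw'⟩ := Proj.exists_add z y' (by rw [hz, hc, hc']) (-r)
    have hwA : w ∈ A.orth := by
      refine hS.mem_orth w (by rw [hw, hz, hc]) fun s hs => ?_
      have h1 := perp_of_mem (hS.mem s hs) hy
      have h2 := h s hs
      rw [Proj.perp_comm] at h1 ⊢
      unfold Proj.Perp at h1 ⊢
      rw [Proj.sca_comm s, Proj.sca_comm s] at h2
      rw [hw', hz', ← h2, add_assoc, ← add_mulTop, add_neg_cancel, mulTop_zero_left h1.2, add_zero]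
      exact h1
    have h3 := (Proj.perp_comm.1 (perp_of_mem hx hwA)).1
    rwa [hw', hz'] at h3
  have h1 := (perp_of_mem hx hy).2
  have h2 := (perp_of_mem hx hy').2
  rw [Proj.sca_comm] at h1 h2
  rw [Proj.sca_comm x, Proj.sca_comm x]
  generalize y.sca x = p at *
  generalize y'.sca x = q at *
  induction p using WithTop.recTopCoe with
  | top => exact absurd rfl h1
  | coe p =>
  induction q using WithTop.recTopCoe with
  | top => exact absurd rfl h2
  | coe q =>
  by_contra hpq
  have hd : p - q ≠ 0 := fun h => hpq (by rw [sub_eq_zero.1 h])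
  apply key (-p / (p - q))
  rw [mulTop_coe, mulTop_coe, ← WithTop.coe_add, ← WithTop.coe_add]
  have : p + -p / (p - q) * p + -(-p / (p - q)) * q = 0 := by
    field_simp
    ring
  rw [this]
  rfl

/-! ### Delocation of conducts -/

section Deloc

variable [DecidableEq L] [DecidableEq L'] [Nonempty L] {θ : L → L'} (hθ : Function.Injective θ)

theorem deloc_orth (A : Conduct m L) : (A.deloc θ hθ).orth = A.orth.deloc θ hθ := by
  ext1
  · rfl
  · exact orthSet_map m hθ _ _

theorem mem_deloc {A : Conduct m L} {x : Proj m L'} :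
    x ∈ A.deloc θ hθ ↔ ∃ a ∈ A, a.map θ = x := by
  constructor
  · rintro ⟨_, ⟨a, ha, rfl⟩, rfl⟩
    exact ⟨Proj.mk m a, mk_mem.2 ha, rfl⟩
  · rintro ⟨_, ⟨a, ha, rfl⟩, rfl⟩
    exact ⟨a.map θ, ⟨a, ha, rfl⟩, rfl⟩

theorem isGen_deloc {A : Conduct m L} {S : Set (Proj m L)} (hS : A.IsGen S) :
    (A.deloc θ hθ).IsGen (Proj.map θ '' S) := by
  constructor
  · rintro _ ⟨s, hs, rfl⟩
    exact (mem_deloc hθ).2 ⟨s, hS.mem s hs, rfl⟩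
  · intro y hy h
    obtain ⟨x, hx, rfl⟩ := Proj.exists_map_eq hθ hy
    rw [deloc_orth, mem_deloc]
    refine ⟨x, hS.mem_orth x hx fun s hs => ?_, rfl⟩
    have := h _ ⟨s, hs, rfl⟩
    unfold Proj.Perp at this ⊢
    rwa [Proj.sca_map hθ.injOn] at this

theorem map_mem_deloc {A : Conduct m L} {x : Proj m L} : x.map θ ∈ A.deloc θ hθ ↔ x ∈ A := by
  constructor
  · intro h
    have hc : x.carrier = A.carrier := by
      have := carrier_eq_of_mem h
      rw [Proj.carrier_map] at this
      exact Finset.image_injective hθ this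
    rw [mem_iff]
    refine ⟨hc, fun y hy => ?_⟩
    have h2 : y.map θ ∈ (A.deloc θ hθ).orth := by
      rw [deloc_orth]
      exact (mem_deloc hθ).2 ⟨y, hy, rfl⟩
    have := perp_of_mem h h2
    unfold Proj.Perp at this ⊢
    rwa [Proj.sca_map hθ.injOn] at this
  · exact fun h => (mem_deloc hθ).2 ⟨x, h, rfl⟩

end Deloc

end Conduct

/-! ### The action of a morphism -/

namespace Proj

variable {m : Weight → ℝ≥0∞}

/-- The carrier of a project that represents a morphism. -/
def bi (V W : Finset ℕ) : Finset Two := V.image (ψ 0) ∪ W.image (ψ 1)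

theorem mem_bi {V W : Finset ℕ} {p : Two} :
    p ∈ bi V W ↔ p.1 ∈ V ∧ p.2 = 0 ∨ p.1 ∈ W ∧ p.2 = 1 := by
  obtain ⟨x, i⟩ := p
  simp only [bi, Finset.mem_union, Finset.mem_image, ψ, Prod.mk.injEq]
  constructor
  · rintro (⟨a, ha, rfl, rfl⟩ | ⟨a, ha, rfl, rfl⟩)
    exacts [Or.inl ⟨ha, rfl⟩, Or.inr ⟨ha, rfl⟩]
  · rintro (⟨h, rfl⟩ | ⟨h, rfl⟩)
    exacts [Or.inl ⟨x, h, rfl, rfl⟩, Or.inr ⟨x, h, rfl, rfl⟩]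

theorem mem_image_ψ {V : Finset ℕ} {i : Fin 2} {p : Two} :
    p ∈ V.image (ψ i) ↔ p.1 ∈ V ∧ p.2 = i := by
  obtain ⟨x, j⟩ := p
  simp only [Finset.mem_image, ψ, Prod.mk.injEq]
  constructor
  · rintro ⟨a, ha, rfl, rfl⟩
    exact ⟨ha, rfl⟩
  · rintro ⟨h, rfl⟩
    exact ⟨x, h, rfl, rfl⟩

theorem symmDiff_bi_left (V W : Finset ℕ) : symmDiff (bi V W) (V.image (ψ 0)) = W.image (ψ 1) := by
  ext p
  rw [Finset.mem_symmDiff, mem_bi, mem_image_ψ, mem_image_ψ]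
  have : ¬ (p.2 = 0 ∧ p.2 = 1) := fun h => absurd (h.1.symm.trans h.2) (by decide)
  tauto

theorem symmDiff_bi_right (V W : Finset ℕ) :
    symmDiff (bi V W) (W.image (ψ 1)) = V.image (ψ 0) := by
  ext p
  rw [Finset.mem_symmDiff, mem_bi, mem_image_ψ, mem_image_ψ]
  have : ¬ (p.2 = 0 ∧ p.2 = 1) := fun h => absurd (h.1.symm.trans h.2) (by decide)
  tauto

/-- The image of a project under a morphism: the cut, relocated to `ℕ`. -/
noncomputable def act (F : Proj m Two) (a : Proj m ℕ) : Proj m ℕ := (F * a.map (ψ 0)).map Prod.fst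

/-- The image of a project of the orthogonal of the target under the transpose of a morphism. -/
noncomputable def coact (F : Proj m Two) (b : Proj m ℕ) : Proj m ℕ := (F * b.map (ψ 1)).map Prod.fst

variable {V W : Finset ℕ} {F : Proj m Two} {a b : Proj m ℕ}

theorem map_ψ_fst {i : Fin 2} {x : Proj m Two} (h : ∀ p ∈ x.carrier, p.2 = i) :
    (x.map Prod.fst).map (ψ i) = x := by
  rw [map_map]
  refine map_eq_self fun p hp => ?_
  obtain ⟨v, j⟩ := p
  have : j = i := h _ hp
  rw [← this]
  rfl

theorem carrier_mul_left (hF : F.carrier = bi V W) (ha : a.carrier = V) :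
    (F * a.map (ψ 0)).carrier = W.image (ψ 1) := by
  rw [carrier_mul, carrier_map, hF, ha, symmDiff_bi_left]

theorem carrier_mul_right (hF : F.carrier = bi V W) (hb : b.carrier = W) :
    (F * b.map (ψ 1)).carrier = V.image (ψ 0) := by
  rw [carrier_mul, carrier_map, hF, hb, symmDiff_bi_right]

theorem map_act (hF : F.carrier = bi V W) (ha : a.carrier = V) :
    (act F a).map (ψ 1) = F * a.map (ψ 0) :=
  map_ψ_fst fun p hp => by
    rw [carrier_mul_left hF ha] at hp
    exact (mem_image_ψ.1 hp).2

theorem map_coact (hF : F.carrier = bi V W) (hb : b.carrier = W) :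
    (coact F b).map (ψ 0) = F * b.map (ψ 1) :=
  map_ψ_fst fun p hp => by
    rw [carrier_mul_right hF hb] at hp
    exact (mem_image_ψ.1 hp).2

theorem image_fst_image_ψ (V : Finset ℕ) (i : Fin 2) : (V.image (ψ i)).image Prod.fst = V := by
  rw [Finset.image_image]
  exact Finset.image_id

theorem carrier_act (hF : F.carrier = bi V W) (ha : a.carrier = V) : (act F a).carrier = W := by
  rw [act, carrier_map, carrier_mul_left hF ha, image_fst_image_ψ]

theorem carrier_coact (hF : F.carrier = bi V W) (hb : b.carrier = W) : (coact F b).carrier = V := by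
  rw [coact, carrier_map, carrier_mul_right hF hb, image_fst_image_ψ]

theorem sca_act (hF : F.carrier = bi V W) (ha : a.carrier = V) :
    (act F a).sca b = F.sca (a.map (ψ 0) * b.map (ψ 1)) := by
  rw [← sca_map (ψ_injective 1).injOn, map_act hF ha]
  refine sca_mul fun p _ hp hp' => ?_
  rw [carrier_map, mem_image_ψ] at hp hp'
  exact absurd (hp.2.symm.trans hp'.2) (by decide)

/-- The action and the action of the transpose are adjoint. -/
theorem sca_act_eq_sca_coact (hF : F.carrier = bi V W) (ha : a.carrier = V) (hb : b.carrier = W) :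
    (act F a).sca b = a.sca (coact F b) := by
  rw [sca_act hF ha, ← sca_map (ψ_injective 0).injOn, map_coact hF hb, Proj.mul_comm (a.map _),
    ← sca_mul, sca_comm]
  intro p _ hp hp'
  rw [carrier_map, mem_image_ψ] at hp hp'
  exact absurd (hp.2.symm.trans hp'.2) (by decide)

/-! ### Composition, tensor product and relocation -/

/-- The composition of the projects of two morphisms. -/
noncomputable def comp (F G : Proj m Two) : Proj m Two := (F.map incl * G.map μ).map ν

theorem incl_injective : Function.Injective incl := by
  rintro ⟨x, i⟩ ⟨y, j⟩ h
  simp only [incl, Prod.mk.injEq, Fin.castSucc_inj] at h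
  rw [h.1, h.2]

theorem μ_injective : Function.Injective μ := by
  rintro ⟨x, i⟩ ⟨y, j⟩ h
  simp only [μ, Prod.mk.injEq, Fin.succ_inj] at h
  rw [h.1, h.2]

theorem mem_image_incl {p : ℕ × Fin 3} :
    p ∈ (bi V W).image incl ↔ p.1 ∈ V ∧ p.2 = 0 ∨ p.1 ∈ W ∧ p.2 = 1 := by
  obtain ⟨x, i⟩ := p
  simp only [Finset.mem_image, mem_bi, incl, Prod.mk.injEq, Prod.exists]
  constructor
  · rintro ⟨a, j, ⟨h, rfl⟩ | ⟨h, rfl⟩, rfl, rfl⟩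
    exacts [Or.inl ⟨h, rfl⟩, Or.inr ⟨h, rfl⟩]
  · rintro (⟨h, rfl⟩ | ⟨h, rfl⟩)
    exacts [⟨x, 0, Or.inl ⟨h, rfl⟩, rfl, rfl⟩, ⟨x, 1, Or.inr ⟨h, rfl⟩, rfl, rfl⟩]

theorem mem_image_μ {p : ℕ × Fin 3} :
    p ∈ (bi V W).image μ ↔ p.1 ∈ V ∧ p.2 = 1 ∨ p.1 ∈ W ∧ p.2 = 2 := by
  obtain ⟨x, i⟩ := p
  simp only [Finset.mem_image, mem_bi, μ, Prod.mk.injEq, Prod.exists]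
  constructor
  · rintro ⟨a, j, ⟨h, rfl⟩ | ⟨h, rfl⟩, rfl, rfl⟩
    exacts [Or.inl ⟨h, rfl⟩, Or.inr ⟨h, rfl⟩]
  · rintro (⟨h, rfl⟩ | ⟨h, rfl⟩)
    exacts [⟨x, 0, Or.inl ⟨h, rfl⟩, rfl, rfl⟩, ⟨x, 1, Or.inr ⟨h, rfl⟩, rfl, rfl⟩]

section Comp

variable {U : Finset ℕ} {G : Proj m Two}

theorem mem_carrier_comp (hF : F.carrier = bi U V) (hG : G.carrier = bi V W) {p : ℕ × Fin 3} :
    p ∈ (F.map incl * G.map μ).carrier ↔ p.1 ∈ U ∧ p.2 = 0 ∨ p.1 ∈ W ∧ p.2 = 2 := by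
  rw [carrier_mul, carrier_map, carrier_map, hF, hG, Finset.mem_symmDiff, mem_image_incl,
    mem_image_μ]
  obtain ⟨x, i⟩ := p
  fin_cases i <;> simp

theorem carrier_comp (hF : F.carrier = bi U V) (hG : G.carrier = bi V W) :
    (comp F G).carrier = bi U W := by
  ext ⟨x, i⟩
  rw [comp, carrier_map, Finset.mem_image, mem_bi]
  simp only [mem_carrier_comp hF hG]
  constructor
  · rintro ⟨⟨y, j⟩, ⟨h, rfl⟩ | ⟨h, rfl⟩, h'⟩
    · simp only [ν, if_true, Prod.mk.injEq] at h'
      rw [← h'.1, ← h'.2]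
      exact Or.inl ⟨h, rfl⟩
    · simp only [ν, Prod.mk.injEq] at h'
      rw [← h'.1, ← h'.2]
      exact Or.inr ⟨h, rfl⟩
  · rintro (⟨h, rfl⟩ | ⟨h, rfl⟩)
    exacts [⟨(x, 0), Or.inl ⟨h, rfl⟩, rfl⟩, ⟨(x, 2), Or.inr ⟨h, rfl⟩, rfl⟩]

/-- Composition of morphisms is composition of their actions. -/
theorem act_comp (hF : F.carrier = bi U V) (hG : G.carrier = bi V W) (ha : a.carrier = U) :
    act (comp F G) a = act G (act F a) := by
  let j : ℕ → ℕ × Fin 3 := fun x => (x, 0)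
  have h1 : a.map (ψ 0) = (a.map j).map ν := by
    rw [map_map]
    rfl
  have hj : ∀ p : ℕ × Fin 3, p ∈ (a.map j).carrier ↔ p.1 ∈ U ∧ p.2 = 0 := by
    rintro ⟨x, i⟩
    simp only [carrier_map, ha, Finset.mem_image, j, Prod.mk.injEq]
    constructor
    · rintro ⟨y, hy, rfl, rfl⟩
      exact ⟨hy, rfl⟩
    · rintro ⟨h, rfl⟩
      exact ⟨x, h, rfl, rfl⟩
  have hν : Set.InjOn ν ((F.map incl * G.map μ).carrier ∪ (a.map j).carrier : Finset _) := by
    rintro ⟨x, i⟩ hx ⟨y, k⟩ hy hxy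
    rw [Finset.mem_coe, Finset.mem_union, mem_carrier_comp hF hG, hj] at hx hy
    simp only [ν, Prod.mk.injEq] at hxy hx hy
    have h2 := hxy.2
    rw [hxy.1]
    congr 1
    rcases hx with (⟨-, rfl⟩ | ⟨-, rfl⟩) | ⟨-, rfl⟩ <;>
      rcases hy with (⟨-, rfl⟩ | ⟨-, rfl⟩) | ⟨-, rfl⟩ <;> first | rfl | simp at h2
  have h2 : F.map incl * G.map μ * a.map j = (G * (act F a).map (ψ 0)).map μ := by
    rw [Proj.mul_comm (F.map incl), Proj.mul_assoc, map_mul_of_injective μ_injective, map_map]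
    · congr 1
      have : F.map incl * a.map j = (F * a.map (ψ 0)).map incl := by
        rw [map_mul_of_injective incl_injective, map_map]
        rfl
      rw [this, ← map_act hF ha, map_map]
      rfl
    · intro p hp hp' hp''
      rw [carrier_map, hG, mem_image_μ] at hp
      rw [hj] at hp''
      rcases hp with hp | hp
      · exact absurd (hp.2.symm.trans hp''.2) (by decide)
      · exact absurd (hp.2.symm.trans hp''.2) (by decide)
  rw [act, comp, h1, ← map_mul hν, h2, map_map, map_map]
  rfl

end Comp

/-- The exchange law. -/
theorem mul_mul_mul_comm' {L : Type} [DecidableEq L] {x y z w : Proj m L}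
    (hxy : Disjoint x.carrier y.carrier)
    (hzw : Disjoint z.carrier w.carrier) (hxw : Disjoint x.carrier w.carrier) :
    x * y * (z * w) = x * z * (y * w) := by
  rw [Finset.disjoint_left] at hxy hzw hxw
  rw [Proj.mul_assoc fun v hv hv' => absurd hv' (hxy hv), Proj.mul_comm z w,
    ← Proj.mul_assoc (x := y) fun v _ hv hv' => hzw hv' hv, Proj.mul_comm (y * w) z,
    ← Proj.mul_assoc]
  intro v hv hv' hv''
  rw [carrier_mul, Finset.mem_symmDiff] at hv''
  rcases hv'' with h | h
  exacts [hxy hv h.1, hxw hv h.1]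

/-- The relocation of the first factor of a tensor product. -/
def ev (x : ℕ) : ℕ := 2 * x

/-- The relocation of the second factor of a tensor product. -/
def od (x : ℕ) : ℕ := 2 * x + 1

/-- The tensor product of two projects, relocated to `ℕ`. -/
noncomputable def tp (a b : Proj m ℕ) : Proj m ℕ := a.map ev * b.map od

theorem ev_injective : Function.Injective ev := fun x y h => by simpa [ev] using h
theorem od_injective : Function.Injective od := fun x y h => by simpa [od] using h

theorem ev_ne_od (x y : ℕ) : ev x ≠ od y := by
  unfold ev od
  omega

theorem disjoint_ev_od (V W : Finset ℕ) : Disjoint (V.image ev) (W.image od) := by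
  rw [Finset.disjoint_left]
  rintro _ hx hy
  obtain ⟨x, -, rfl⟩ := Finset.mem_image.1 hx
  obtain ⟨y, -, h⟩ := Finset.mem_image.1 hy
  exact ev_ne_od _ _ h.symm

theorem carrier_tp (a b : Proj m ℕ) :
    (tp a b).carrier = a.carrier.image ev ∪ b.carrier.image od := by
  rw [tp, carrier_mul, carrier_map, carrier_map, (disjoint_ev_od _ _).symmDiff_eq_sup]
  rfl

theorem mk_mixProject (a b : Project ℕ) :
    mk m (Cond.mixProject m a b) = tp (mk m a) (mk m b) := by
  change ((mk m a).map (ψ 0) * (mk m b).map (ψ 1)).map φ = _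
  rw [map_mul_of_injective φ_injective, map_map, map_map]
  rfl

/-- The tensor product of the projects of two morphisms. -/
noncomputable def tens (F G : Proj m Two) : Proj m Two :=
  F.map (fun p => (ev p.1, p.2)) * G.map (fun p => (od p.1, p.2))

theorem τ_τ (p : Two) : τ (τ p) = p := by
  obtain ⟨x, i⟩ := p
  fin_cases i
  · rcases Nat.even_or_odd' x with ⟨c, rfl | rfl⟩
    · simp [τ]
    · have : (2 * c + 1) % 2 = 1 := by omega
      simp [τ, this]
  · rcases Nat.even_or_odd' x with ⟨c, rfl | rfl⟩
    · have : (2 * c + 1) % 2 = 1 := by omega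
      simp [τ, this]
    · have : (2 * c + 1) % 2 = 1 := by omega
      simp [τ, this]

theorem τ_φ_zero (p : Two) : τ (ψ 0 (φ p)) = (ev p.1, p.2) := by
  obtain ⟨x, i⟩ := p
  fin_cases i
  · simp [τ, ψ, φ, ev]
  · have : (2 * x + 1) % 2 = 1 := by omega
    simp [τ, ψ, φ, ev, this]

theorem τ_φ_one (p : Two) : τ (ψ 1 (φ p)) = (od p.1, p.2) := by
  obtain ⟨x, i⟩ := p
  fin_cases i
  · simp [τ, ψ, φ, od]
  · have : (2 * x + 1) % 2 = 1 := by omega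
    simp [τ, ψ, φ, od, this]

theorem mk_tensorProject (f g : Project Two) :
    mk m (Cond.tensorProject m f g) = tens (mk m f) (mk m g) := by
  change ((((mk m f).map φ).map (ψ 0)) * (((mk m g).map φ).map (ψ 1))).map τ = _
  rw [map_mul_of_injective (Function.LeftInverse.injective τ_τ), map_map, map_map, map_map, map_map]
  unfold tens
  congr 2
  · exact funext τ_φ_zero
  · exact funext τ_φ_one

section Tens

variable {V' W' : Finset ℕ} {G : Proj m Two}

theorem evP_injective : Function.Injective (fun p : Two => (ev p.1, p.2)) := by
  rintro ⟨x, i⟩ ⟨y, j⟩ h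
  simp only [Prod.mk.injEq] at h
  rw [ev_injective h.1, h.2]

theorem odP_injective : Function.Injective (fun p : Two => (od p.1, p.2)) := by
  rintro ⟨x, i⟩ ⟨y, j⟩ h
  simp only [Prod.mk.injEq] at h
  rw [od_injective h.1, h.2]

theorem disjoint_evP_odP (X Y : Finset Two) :
    Disjoint (X.image fun p : Two => (ev p.1, p.2)) (Y.image fun p : Two => (od p.1, p.2)) := by
  rw [Finset.disjoint_left]
  rintro _ hx hy
  obtain ⟨x, -, rfl⟩ := Finset.mem_image.1 hx
  obtain ⟨y, -, h⟩ := Finset.mem_image.1 hy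
  exact ev_ne_od _ _ (congrArg Prod.fst h).symm

theorem carrier_tens (hF : F.carrier = bi V W) (hG : G.carrier = bi V' W') :
    (tens F G).carrier = bi (V.image ev ∪ V'.image od) (W.image ev ∪ W'.image od) := by
  rw [tens, carrier_mul, carrier_map, carrier_map, (disjoint_evP_odP _ _).symmDiff_eq_sup, hF, hG]
  unfold bi
  simp only [Finset.sup_eq_union, Finset.image_union, Finset.image_image]
  have h1 : ∀ i : Fin 2, (fun p : Two => (ev p.1, p.2)) ∘ ψ i = ψ i ∘ ev := fun _ => rfl
  have h2 : ∀ i : Fin 2, (fun p : Two => (od p.1, p.2)) ∘ ψ i = ψ i ∘ od := fun _ => rfl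
  rw [h1, h1, h2, h2]
  ext p
  simp only [Finset.mem_union]
  tauto

/-- The tensor product of two morphisms acts on tensor products of projects. -/
theorem act_tens (hF : F.carrier = bi V W) (hG : G.carrier = bi V' W') (ha : a.carrier = V)
    (hb : b.carrier = V') : act (tens F G) (tp a b) = tp (act F a) (act G b) := by
  have h1 : (tp a b).map (ψ 0) = (a.map (ψ 0)).map (fun p : Two => (ev p.1, p.2)) *
      (b.map (ψ 0)).map (fun p : Two => (od p.1, p.2)) := by
    rw [tp, map_mul_of_injective (ψ_injective 0), map_map, map_map, map_map, map_map]
    rfl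
  rw [act, tens, h1, mul_mul_mul_comm', ← map_mul_of_injective evP_injective,
    ← map_mul_of_injective odP_injective, ← map_act hF ha, ← map_act hG hb, map_map, map_map,
    map_mul, map_map, map_map]
  · rfl
  · rintro ⟨x, i⟩ hx ⟨y, j⟩ hy h
    have key : ∀ p : Two, p ∈ ((act F a).map ((fun p : Two => (ev p.1, p.2)) ∘ ψ 1)).carrier ∪
        ((act G b).map ((fun p : Two => (od p.1, p.2)) ∘ ψ 1)).carrier → p.2 = 1 := by
      intro p hp
      simp only [carrier_map, Finset.mem_union, Finset.mem_image, Function.comp] at hp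
      rcases hp with ⟨z, -, rfl⟩ | ⟨z, -, rfl⟩ <;> rfl
    have h1 := key _ hx
    have h2 := key _ hy
    simp only at h1 h2 h
    rw [h, h1, h2]
  · simp only [carrier_map]
    exact disjoint_evP_odP _ _
  · simp only [carrier_map]
    exact disjoint_evP_odP _ _
  · simp only [carrier_map]
    exact disjoint_evP_odP _ _

end Tens

variable (m) in
/-- The project of the relocation along `θ`. -/
noncomputable def reloc (θ : ℕ → ℕ) (V : Finset ℕ) : Proj m Two := fax m V (ψ 0) (ψ 1 ∘ θ)

theorem carrier_reloc (θ : ℕ → ℕ) (V : Finset ℕ) : (reloc m θ V).carrier = bi V (V.image θ) := by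
  rw [reloc, carrier_fax, ← Finset.image_image]
  rfl

theorem act_reloc (θ : ℕ → ℕ) (ha : a.carrier = V) : act (reloc m θ V) a = a.map θ := by
  rw [act, reloc, fax_mul ha (ψ_injective 0).injOn, map_map]
  · rfl
  · intro v _ w _ h
    exact absurd (congrArg Prod.snd h) (by simp [ψ])

end Proj

end IG

namespace IG

open Conduct Proj

namespace Cond

variable {m : Weight → ℝ≥0∞} {A B C D : Cond m}

/-! ### Morphisms -/

/-- The projects, up to isomorphism, that represent morphisms from `A` to `B`. -/
structure IsHom (A B : Cond m) (F : Proj m Two) : Prop where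
  carrier : F.carrier = bi A.carrier B.carrier
  act_mem : ∀ a ∈ A, act F a ∈ B

theorem mem_homSet {f : Project Two} : f ∈ HomSet A B ↔ IsHom A B (Proj.mk m f) := by
  constructor
  · rintro ⟨hf, h⟩
    refine ⟨hf, fun a ha => ?_⟩
    obtain ⟨a, ha, rfl⟩ := ha
    have h1 := mk_mem.2 (h _ ⟨a, ha, rfl⟩)
    rw [mk_cut, mk_map, ← map_act (F := Proj.mk m f) (a := Proj.mk m a) (V := A.carrier)
      (W := B.carrier) hf (A.carrier_eq ha)] at h1
    exact (map_mem_deloc _).1 h1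
  · rintro ⟨hf, h⟩
    refine ⟨hf, ?_⟩
    rintro _ ⟨a, ha, rfl⟩
    rw [← mk_mem, mk_cut, mk_map, ← map_act (F := Proj.mk m f) (a := Proj.mk m a)
      (V := A.carrier) (W := B.carrier) hf (A.carrier_eq ha)]
    exact (map_mem_deloc _).2 (h _ (mk_mem.2 ha))

theorem carrier_bi_of_mem {a b : Proj m ℕ} (ha : a ∈ A) (hb : b ∈ B) :
    (a.map (ψ 0) * b.map (ψ 1)).carrier = bi A.carrier B.carrier := by
  rw [carrier_mul, carrier_map, carrier_map, carrier_eq_of_mem ha, carrier_eq_of_mem hb,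
    (disjoint_ψ _ _).symmDiff_eq_sup]
  rfl

/-- A project represents a morphism as soon as the action sends generators of the source to
projects that are orthogonal to generators of the orthogonal of the target. -/
theorem isHom_of_gen {S T : Set (Proj m ℕ)} (hS : A.IsGen S) (hT : B.orth.IsGen T)
    {F : Proj m Two} (hF : F.carrier = bi A.carrier B.carrier)
    (h : ∀ s ∈ S, ∀ t ∈ T, (act F s).Perp t) : IsHom A B F := by
  have h1 : ∀ t ∈ T, coact F t ∈ A.orth := by
    intro t ht
    have htB : t.carrier = B.carrier := carrier_eq_of_mem (A := B.orth) (hT.mem t ht)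
    refine hS.mem_orth _ (carrier_coact hF htB) fun s hs => ?_
    have := h s hs t ht
    unfold Perp at this ⊢
    rwa [← sca_act_eq_sca_coact hF (carrier_eq_of_mem (hS.mem s hs)) htB]
  refine ⟨hF, fun a ha => ?_⟩
  have haA := carrier_eq_of_mem ha
  rw [hT.mem_iff]
  refine ⟨carrier_act hF haA, fun t ht => ?_⟩
  have htB : t.carrier = B.carrier := carrier_eq_of_mem (A := B.orth) (hT.mem t ht)
  have := perp_of_mem ha (h1 t ht)
  rw [Proj.perp_comm]
  unfold Perp at this ⊢
  rwa [sca_act_eq_sca_coact hF haA htB]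

theorem isHom_of_gen_left {S : Set (Proj m ℕ)} (hS : A.IsGen S)
    {F : Proj m Two} (hF : F.carrier = bi A.carrier B.carrier)
    (h : ∀ s ∈ S, act F s ∈ B) : IsHom A B F :=
  isHom_of_gen hS (isGen_self _) hF fun s hs _ ht => perp_of_mem (h s hs) ht

theorem IsHom.coact_mem {F : Proj m Two} (hF : IsHom A B F) {b : Proj m ℕ} (hb : b ∈ B.orth) :
    coact F b ∈ A.orth := by
  have hbB : b.carrier = B.carrier := carrier_eq_of_mem (A := B.orth) hb
  refine mem_orth.2 ⟨carrier_coact hF.carrier hbB, fun a ha => ?_⟩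
  have := perp_of_mem (hF.act_mem a ha) hb
  unfold Perp at this ⊢
  rwa [← sca_act_eq_sca_coact hF.carrier (carrier_eq_of_mem ha) hbB]

theorem perp_act_iff {F : Proj m Two} (hF : F.carrier = bi A.carrier B.carrier) {a b : Proj m ℕ}
    (ha : a ∈ A) : (act F a).Perp b ↔ F.Perp (a.map (ψ 0) * b.map (ψ 1)) := by
  unfold Perp
  rw [sca_act hF (carrier_eq_of_mem ha)]

/-- `ψ 0 (A) ⊸ ψ 1 (B)` as a conduct. -/
def homConduct (A B : Cond m) : Conduct m Two where
  carrier := (copy 0 A).carrier ∪ (copy 1 B).carrier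
  projects := HomSet A B
  closed := by
    refine Set.Subset.antisymm (fun f hf => ?_) (subset_orthSet_orthSet m _ fun f hf => hf.1)
    rw [mem_homSet]
    refine isHom_of_gen (isGen_self A) (isGen_self B.orth) hf.1 fun a ha b hb => ?_
    rw [perp_act_iff (F := Proj.mk m f) hf.1 ha, perp_comm]
    obtain ⟨c, hc⟩ := exists_rep (a.map (ψ 0) * b.map (ψ 1))
    rw [← hc, perp_mk]
    refine hf.2 c ⟨?_, fun g hg => ?_⟩
    · have := carrier_bi_of_mem ha (B := B.orth) hb
      rwa [← hc] at this
    · rw [mem_homSet] at hg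
      rw [← perp_mk, hc, ← perp_act_iff hg.carrier ha]
      exact perp_of_mem (hg.act_mem a ha) hb

theorem mem_homConduct {F : Proj m Two} : F ∈ homConduct A B ↔ IsHom A B F := by
  obtain ⟨f, rfl⟩ := exists_rep F
  rw [mk_mem]
  exact mem_homSet

/-- By adjunction, `f` sends `s` to a project orthogonal to `t` if and only if `f` is orthogonal to
`s ⊗ t`. -/
theorem isGen_homConduct_orth {S T : Set (Proj m ℕ)} (hS : A.IsGen S) (hT : B.orth.IsGen T) :
    (homConduct A B).orth.IsGen {c | ∃ s ∈ S, ∃ t ∈ T, c = s.map (ψ 0) * t.map (ψ 1)} := by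
  constructor
  · rintro _ ⟨s, hs, t, ht, rfl⟩
    refine mem_orth.2 ⟨carrier_bi_of_mem (B := B.orth) (hS.mem s hs) (hT.mem t ht), ?_⟩
    intro F hF
    rw [mem_homConduct] at hF
    rw [← perp_act_iff hF.carrier (hS.mem s hs)]
    exact perp_of_mem (hF.act_mem s (hS.mem s hs)) (hT.mem t ht)
  · intro F hF h
    rw [orth_orth, mem_homConduct]
    refine isHom_of_gen hS hT hF fun s hs t ht => ?_
    rw [perp_act_iff hF (hS.mem s hs), perp_comm]
    exact h _ ⟨s, hs, t, ht, rfl⟩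

/-- Observational equivalence may be tested on generators. -/
theorem homSetoid_iff {S T : Set (Proj m ℕ)} (hS : A.IsGen S) (hT : B.orth.IsGen T)
    {f g : HomSet A B} : homSetoid A B f g ↔ ∀ s ∈ S, ∀ t ∈ T,
      (act (Proj.mk m f.1) s).sca t = (act (Proj.mk m g.1) s).sca t := by
  have hf := mem_homSet.1 f.2
  have hg := mem_homSet.1 g.2
  have hG := isGen_homConduct_orth hS hT
  constructor
  · intro h s hs t ht
    have hsA := carrier_eq_of_mem (hS.mem s hs)
    rw [sca_act hf.carrier hsA, sca_act hg.carrier hsA]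
    obtain ⟨c, hc⟩ := exists_rep (s.map (ψ 0) * t.map (ψ 1))
    have hmem := hG.mem _ ⟨s, hs, t, ht, rfl⟩
    rw [← hc] at hmem ⊢
    exact h c (mk_mem.1 hmem)
  · intro h c hc
    have key := hG.agree (y := Proj.mk m f.1) (y' := Proj.mk m g.1)
      (by rw [orth_orth, mem_homConduct]; exact hf) (by rw [orth_orth, mem_homConduct]; exact hg)
      (by
        rintro _ ⟨s, hs, t, ht, rfl⟩
        have hsA := carrier_eq_of_mem (hS.mem s hs)
        rw [sca_comm, sca_comm _ (Proj.mk m g.1), ← sca_act hf.carrier hsA,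
          ← sca_act hg.carrier hsA]
        exact h s hs t ht)
      (x := Proj.mk m c) (mk_mem.2 hc)
    rw [sca_comm, sca_comm (Proj.mk m c)] at key
    exact key

/-- The morphism represented by a project. -/
noncomputable def homMk (F : Proj m Two) (hF : IsHom A B F) : Hom A B :=
  Hom.mk (exists_rep F).choose (mem_homSet.2 (by rwa [(exists_rep F).choose_spec]))

theorem mk_eq_mk_iff {S T : Set (Proj m ℕ)} (hS : A.IsGen S) (hT : B.orth.IsGen T)
    {f g : Project Two} {hf : f ∈ HomSet A B} {hg : g ∈ HomSet A B} :
    Hom.mk f hf = Hom.mk g hg ↔ ∀ s ∈ S, ∀ t ∈ T,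
      (act (Proj.mk m f) s).sca t = (act (Proj.mk m g) s).sca t := by
  exact (Quotient.eq (r := homSetoid A B)).trans (homSetoid_iff hS hT)

theorem homMk_eq_iff {S T : Set (Proj m ℕ)} (hS : A.IsGen S) (hT : B.orth.IsGen T)
    {F G : Proj m Two} {hF : IsHom A B F} {hG : IsHom A B G} :
    homMk F hF = homMk G hG ↔ ∀ s ∈ S, ∀ t ∈ T, (act F s).sca t = (act G s).sca t := by
  unfold homMk
  rw [mk_eq_mk_iff hS hT, (exists_rep F).choose_spec, (exists_rep G).choose_spec]

theorem mk_eq_homMk (f : Project Two) (hf : f ∈ HomSet A B) :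
    Hom.mk f hf = homMk (Proj.mk m f) (mem_homSet.1 hf) := by
  unfold homMk
  rw [mk_eq_mk_iff (isGen_self A) (isGen_self B.orth), (exists_rep (Proj.mk m f)).choose_spec]
  exact fun _ _ _ _ => rfl

/-- A representative of a morphism. -/
noncomputable def Hom.rep (h : Hom A B) : Proj m Two := Proj.mk m h.out.1

theorem Hom.isHom_rep (h : Hom A B) : IsHom A B h.rep := mem_homSet.1 h.out.2

theorem homMk_rep (h : Hom A B) : homMk h.rep h.isHom_rep = h := by
  have := mk_eq_homMk h.out.1 h.out.2
  unfold Hom.rep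
  rw [← this]
  exact Quotient.out_eq h

theorem Hom.exists_homMk (h : Hom A B) : ∃ F hF, h = homMk F hF :=
  ⟨h.rep, h.isHom_rep, (homMk_rep h).symm⟩

/-! ### Elements of a conduct up to observational equivalence -/

/-- Observational equivalence of the projects in a conduct. -/
def elSetoid (A : Cond m) : Setoid {x : Proj m ℕ // x ∈ A} where
  r x y := ∀ b ∈ A.orth, x.1.sca b = y.1.sca b
  iseqv := ⟨fun _ _ _ => rfl, fun h b hb => (h b hb).symm, fun h h' b hb =>
    (h b hb).trans (h' b hb)⟩

/-- The projects of a conduct up to observational equivalence. A morphism is determined by its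
action on these classes, so that equalities of morphisms reduce to equalities of projects. -/
def El (A : Cond m) : Type 1 := Quotient (elSetoid A)

/-- The class of a project of a conduct. -/
def El.mk (x : Proj m ℕ) (hx : x ∈ A) : El A := Quotient.mk (elSetoid A) ⟨x, hx⟩

theorem El.exists_mk (x : El A) : ∃ a ha, x = El.mk a ha := by
  induction x using Quotient.inductionOn' with
  | _ x => exact ⟨x.1, x.2, rfl⟩

theorem El.mk_eq_iff {T : Set (Proj m ℕ)} (hT : A.orth.IsGen T) {x y : Proj m ℕ} {hx : x ∈ A}
    {hy : y ∈ A} : El.mk x hx = El.mk y hy ↔ ∀ t ∈ T, x.sca t = y.sca t := by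
  refine (Quotient.eq (r := elSetoid A)).trans ?_
  constructor
  · exact fun h t ht => h t (hT.mem t ht)
  · intro h b hb
    rw [sca_comm, sca_comm y]
    refine hT.agree (by rwa [orth_orth]) (by rwa [orth_orth]) (fun t ht => ?_) hb
    rw [sca_comm, sca_comm t]
    exact h t ht

theorem El.mk_congr {x y : Proj m ℕ} (h : x = y) (hx : x ∈ A) (hy : y ∈ A) :
    El.mk x hx = El.mk y hy := by
  subst h
  rfl

theorem act_sca_congr {F : Proj m Two} (hF : IsHom A B F) {x y : Proj m ℕ} (hx : x ∈ A)
    (hy : y ∈ A) (h : El.mk x hx = El.mk y hy) {b : Proj m ℕ} (hb : b ∈ B.orth) :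
    (act F x).sca b = (act F y).sca b := by
  have hb' : b.carrier = B.carrier := carrier_eq_of_mem (A := B.orth) hb
  rw [sca_act_eq_sca_coact hF.carrier (carrier_eq_of_mem hx) hb',
    sca_act_eq_sca_coact hF.carrier (carrier_eq_of_mem hy) hb']
  exact (El.mk_eq_iff (isGen_self _)).1 h _ (hF.coact_mem hb)

/-- The action of a morphism on classes of projects. -/
noncomputable def Hom.app (h : Hom A B) : El A → El B :=
  Quotient.map' (s₁ := elSetoid A) (s₂ := elSetoid B)
    (fun x => ⟨act h.rep x.1, h.isHom_rep.act_mem x.1 x.2⟩)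
    fun x y hxy _ hb => act_sca_congr h.isHom_rep x.2 y.2 (Quotient.sound hxy) hb

@[simp] theorem app_homMk (F : Proj m Two) (hF : IsHom A B F) (x : Proj m ℕ) (hx : x ∈ A) :
    (homMk F hF).app (El.mk x hx) = El.mk (act F x) (hF.act_mem x hx) := by
  change El.mk (act (homMk F hF).rep x) _ = _
  rw [El.mk_eq_iff (isGen_self _)]
  intro t ht
  exact (homMk_eq_iff (isGen_self _) (isGen_self _)).1 (homMk_rep (homMk F hF)) x hx t ht

/-- A morphism is determined by its action on the generators of its source. -/
theorem Hom.ext_gen {S : Set (Proj m ℕ)} (hS : A.IsGen S) {h k : Hom A B}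
    (H : ∀ s (hs : s ∈ S), h.app (El.mk s (hS.mem s hs)) = k.app (El.mk s (hS.mem s hs))) :
    h = k := by
  obtain ⟨F, hF, rfl⟩ := h.exists_homMk
  obtain ⟨G, hG, rfl⟩ := k.exists_homMk
  rw [homMk_eq_iff hS (isGen_self _)]
  intro s hs t ht
  have := H s hs
  rw [app_homMk, app_homMk, El.mk_eq_iff (isGen_self _)] at this
  exact this t ht

theorem Hom.ext_app {h k : Hom A B} (H : ∀ x, h.app x = k.app x) : h = k :=
  Hom.ext_gen (isGen_self A) fun _ _ => H _

/-! ### The category of conducts -/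

theorem isHom_comp {F G : Proj m Two} (hF : IsHom A B F) (hG : IsHom B C G) :
    IsHom A C (comp F G) := by
  refine ⟨carrier_comp hF.carrier hG.carrier, fun a ha => ?_⟩
  rw [act_comp hF.carrier hG.carrier (carrier_eq_of_mem ha)]
  exact hG.act_mem _ (hF.act_mem a ha)

/-- Composition of morphisms. -/
noncomputable def Hom.comp (h : Hom A B) (k : Hom B C) : Hom A C :=
  homMk (Proj.comp h.rep k.rep) (isHom_comp h.isHom_rep k.isHom_rep)

theorem app_homMk_comp {F G : Proj m Two} (hF : IsHom A B F) (hG : IsHom B C G) (x : El A) :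
    (homMk (Proj.comp F G) (isHom_comp hF hG)).app x = (homMk G hG).app ((homMk F hF).app x) := by
  obtain ⟨x, hx, rfl⟩ := x.exists_mk
  rw [app_homMk, app_homMk, app_homMk]
  exact El.mk_congr (act_comp hF.carrier hG.carrier (carrier_eq_of_mem hx)) _ _

@[simp] theorem app_comp (h : Hom A B) (k : Hom B C) (x : El A) :
    (h.comp k).app x = k.app (h.app x) := by
  rw [Hom.comp, app_homMk_comp h.isHom_rep k.isHom_rep, homMk_rep, homMk_rep]

/-- A map `θ` that sends the projects of `A` to projects of `B` gives a morphism. -/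
theorem isHom_reloc_of_gen {S : Set (Proj m ℕ)} (hS : A.IsGen S) (θ : ℕ → ℕ)
    (hc : B.carrier = A.carrier.image θ)
    (h : ∀ s ∈ S, s.map θ ∈ B) : IsHom A B (reloc m θ A.carrier) :=
  isHom_of_gen_left hS (by rw [carrier_reloc, hc]) fun s hs => by
    rw [act_reloc θ (carrier_eq_of_mem (hS.mem s hs))]
    exact h s hs

theorem app_reloc (θ : ℕ → ℕ) (h : IsHom A B (reloc m θ A.carrier)) {x : Proj m ℕ} (hx : x ∈ A)
    (hx' : x.map θ ∈ B) : (homMk _ h).app (El.mk x hx) = El.mk (x.map θ) hx' := by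
  rw [app_homMk]
  exact El.mk_congr (act_reloc θ (carrier_eq_of_mem hx)) _ _

theorem map_id (x : Proj m ℕ) : x.map id = x := map_eq_self fun _ _ => rfl

theorem isHom_id (A : Cond m) : IsHom A A (reloc m id A.carrier) :=
  isHom_reloc_of_gen (isGen_self A) id Finset.image_id.symm fun s hs => by rwa [map_id]

/-- The identity of `A`. -/
noncomputable def Hom.id (A : Cond m) : Hom A A := homMk _ (isHom_id A)

@[simp] theorem app_id (x : El A) : (Hom.id A).app x = x := by
  obtain ⟨x, hx, rfl⟩ := x.exists_mk
  rw [Hom.id, app_reloc _ _ hx (by rwa [map_id])]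
  exact El.mk_congr (map_id x) _ _

variable (m) in
/-- The category of conducts. -/
noncomputable def condCat : CondCat m where
  id := Hom.id
  comp := Hom.comp
  id_spec A := by
    have h : idProject A ∈ HomSet A A := mem_homSet.2 (isHom_id A)
    exact ⟨h, (mk_eq_homMk _ h).symm⟩
  comp_spec {A B C} f g hf hg := by
    have h : compProject m f g ∈ HomSet A C :=
      mem_homSet.2 (isHom_comp (mem_homSet.1 hf) (mem_homSet.1 hg))
    refine ⟨h, ?_⟩
    refine Hom.ext_app fun x => ?_
    rw [app_comp, mk_eq_homMk, mk_eq_homMk, mk_eq_homMk]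
    exact (app_homMk_comp (mem_homSet.1 hf) (mem_homSet.1 hg) x).symm
  id_comp f := Hom.ext_app fun x => by rw [app_comp, app_id]
  comp_id f := Hom.ext_app fun x => by rw [app_comp, app_id]
  assoc f g h := Hom.ext_app fun x => by rw [app_comp, app_comp, app_comp, app_comp]

/-! ### The tensor product of conducts -/

@[simp] theorem carrier_tensorObj (A B : Cond m) :
    (tensorObj A B).carrier = A.carrier.image ev ∪ B.carrier.image od := by
  change ((A.carrier.image (ψ 0)) ∪ (B.carrier.image (ψ 1))).image φ = _
  rw [Finset.image_union, Finset.image_image, Finset.image_image]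
  rfl

theorem isGen_tensorObj_self (A B : Cond m) :
    (tensorObj A B).IsGen {x | ∃ a ∈ A, ∃ b ∈ B, x = tp a b} := by
  have h1 := isGen_deloc φ_injective (isGen_gen (m := m) ((copy 0 A).carrier ∪ (copy 1 B).carrier)
    (S := {c | ∃ a ∈ (copy 0 A).projects, ∃ b ∈ (copy 1 B).projects, c = a.tensor m b})
    (by
      rintro _ ⟨a, ha, b, hb, rfl⟩
      exact Project.cut_carrier m (disjoint_ψ _ _) (Conduct.carrier_eq _ ha)
        (Conduct.carrier_eq _ hb)))
  have h2 : {x | ∃ a ∈ A, ∃ b ∈ B, x = tp a b} = Proj.map φ '' {x | ∃ c ∈ {c : Project Two |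
      ∃ a ∈ (copy 0 A).projects, ∃ b ∈ (copy 1 B).projects, c = a.tensor m b},
      Proj.mk m c = x} := by
    ext x
    constructor
    · rintro ⟨_, ⟨a, ha, rfl⟩, _, ⟨b, hb, rfl⟩, rfl⟩
      refine ⟨_, ⟨_, ⟨_, ⟨a, ha, rfl⟩, _, ⟨b, hb, rfl⟩, rfl⟩, rfl⟩, ?_⟩
      exact mk_mixProject a b
    · rintro ⟨_, ⟨_, ⟨_, ⟨a, ha, rfl⟩, _, ⟨b, hb, rfl⟩, rfl⟩, rfl⟩, rfl⟩
      exact ⟨_, ⟨a, ha, rfl⟩, _, ⟨b, hb, rfl⟩, mk_mixProject a b⟩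
  rw [h2]
  exact h1

theorem tp_mem {a b : Proj m ℕ} (ha : a ∈ A) (hb : b ∈ B) : tp a b ∈ tensorObj A B :=
  (isGen_tensorObj_self A B).mem _ ⟨a, ha, b, hb, rfl⟩

/-- Partial evaluation of a project on a tensor product. -/
theorem exists_sca_tp_left {c b : Proj m ℕ} {V W : Finset ℕ}
    (hc : c.carrier = V.image ev ∪ W.image od) (hb : b.carrier = W) :
    ∃ d : Proj m ℕ, d.carrier = V ∧ ∀ a : Proj m ℕ, (tp a b).sca c = a.sca d := by
  obtain ⟨d, hd, hd'⟩ := exists_map_eq ev_injective (V := V) (y := b.map od * c) (by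
    rw [carrier_mul, carrier_map, hb, hc]
    have := disjoint_ev_od V W
    rw [Finset.disjoint_left] at this
    ext v
    rw [Finset.mem_symmDiff, Finset.mem_union]
    have := @this v
    tauto)
  refine ⟨d, hd, fun a => ?_⟩
  rw [tp, sca_mul, ← hd', sca_map ev_injective.injOn]
  intro v hv hv'
  rw [carrier_map] at hv hv'
  exact absurd hv' (Finset.disjoint_left.1 (disjoint_ev_od _ _) hv)

theorem exists_sca_tp_right {c a : Proj m ℕ} {V W : Finset ℕ}
    (hc : c.carrier = V.image ev ∪ W.image od) (ha : a.carrier = V) :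
    ∃ d : Proj m ℕ, d.carrier = W ∧ ∀ b : Proj m ℕ, (tp a b).sca c = b.sca d := by
  obtain ⟨d, hd, hd'⟩ := exists_map_eq od_injective (V := W) (y := a.map ev * c) (by
    rw [carrier_mul, carrier_map, ha, hc]
    have := disjoint_ev_od V W
    rw [Finset.disjoint_left] at this
    ext v
    rw [Finset.mem_symmDiff, Finset.mem_union]
    have := @this v
    tauto)
  refine ⟨d, hd, fun b => ?_⟩
  rw [tp, Proj.mul_comm, sca_mul, ← hd', sca_map od_injective.injOn]
  intro v hv hv'
  rw [carrier_map] at hv hv'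
  exact absurd hv (Finset.disjoint_left.1 (disjoint_ev_od _ _) hv')

/-- The tensor product is generated by the tensor products of generators: by partial evaluation, the
generation can be used in each factor separately. -/
theorem isGen_tensorObj {S T : Set (Proj m ℕ)} (hS : A.IsGen S) (hT : B.IsGen T) :
    (tensorObj A B).IsGen {x | ∃ s ∈ S, ∃ t ∈ T, x = tp s t} := by
  constructor
  · rintro _ ⟨s, hs, t, ht, rfl⟩
    exact tp_mem (hS.mem s hs) (hT.mem t ht)
  · intro c hc h
    have hc' := hc
    rw [carrier_tensorObj] at hc'
    refine (isGen_tensorObj_self A B).mem_orth c hc ?_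
    have h1 : ∀ a ∈ A, ∀ t ∈ T, (tp a t).Perp c := by
      intro a ha t ht
      obtain ⟨d, hd, hd'⟩ := exists_sca_tp_left hc' (carrier_eq_of_mem (hT.mem t ht))
      have hdA : d ∈ A.orth := hS.mem_orth d hd fun s hs => by
        have := h _ ⟨s, hs, t, ht, rfl⟩
        unfold Perp at this ⊢
        rwa [← hd']
      have := perp_of_mem ha hdA
      unfold Perp at this ⊢
      rwa [hd']
    rintro _ ⟨a, ha, b, hb, rfl⟩
    obtain ⟨d, hd, hd'⟩ := exists_sca_tp_right hc' (carrier_eq_of_mem ha)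
    have hdB : d ∈ B.orth := hT.mem_orth d hd fun t ht => by
      have := h1 a ha t ht
      unfold Perp at this ⊢
      rwa [← hd']
    have := perp_of_mem hb hdB
    unfold Perp at this ⊢
    rwa [hd']

theorem sca_tp_congr {a a' b b' : Proj m ℕ} (ha : a ∈ A) (ha' : a' ∈ A) (hb : b ∈ B)
    (hb' : b' ∈ B) (h : El.mk a ha = El.mk a' ha') (h' : El.mk b hb = El.mk b' hb')
    {c : Proj m ℕ} (hc : c ∈ (tensorObj A B).orth) : (tp a b).sca c = (tp a' b').sca c := by
  have hcc : c.carrier = A.carrier.image ev ∪ B.carrier.image od := by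
    rw [← carrier_tensorObj]
    exact carrier_eq_of_mem (A := (tensorObj A B).orth) hc
  obtain ⟨d, hd, hd'⟩ := exists_sca_tp_left hcc (carrier_eq_of_mem hb)
  obtain ⟨e, he, he'⟩ := exists_sca_tp_right hcc (carrier_eq_of_mem ha')
  have hdA : d ∈ A.orth := mem_orth.2 ⟨hd, fun x hx => by
    have := perp_of_mem (tp_mem hx hb) hc
    unfold Perp at this ⊢
    rwa [← hd']⟩
  have heB : e ∈ B.orth := mem_orth.2 ⟨he, fun x hx => by
    have := perp_of_mem (tp_mem ha' hx) hc
    unfold Perp at this ⊢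
    rwa [← he']⟩
  rw [hd', (El.mk_eq_iff (isGen_self _)).1 h d hdA, ← hd', he',
    (El.mk_eq_iff (isGen_self _)).1 h' e heB, he']

/-- The tensor product of classes of projects. -/
noncomputable def El.tmul (x : El A) (y : El B) : El (tensorObj A B) :=
  Quotient.map₂ (sa := elSetoid A) (sb := elSetoid B) (sc := elSetoid (tensorObj A B))
    (fun a b => ⟨tp a.1 b.1, tp_mem a.2 b.2⟩)
    (fun a a' h b b' h' _ hc => sca_tp_congr a.2 a'.2 b.2 b'.2 (Quotient.sound h)
      (Quotient.sound h') hc) x y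

theorem El.tmul_mk {a b : Proj m ℕ} (ha : a ∈ A) (hb : b ∈ B) :
    El.tmul (El.mk a ha) (El.mk b hb) = El.mk (tp a b) (tp_mem ha hb) := rfl

theorem Hom.ext_tensor {h k : Hom (tensorObj A B) C}
    (H : ∀ x y, h.app (El.tmul x y) = k.app (El.tmul x y)) : h = k :=
  Hom.ext_gen (isGen_tensorObj_self A B) fun s hs => by
    obtain ⟨a, ha, b, hb, rfl⟩ := hs
    exact H (El.mk a ha) (El.mk b hb)

theorem isHom_tens {A' B' : Cond m} {F G : Proj m Two} (hF : IsHom A A' F) (hG : IsHom B B' G) :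
    IsHom (tensorObj A B) (tensorObj A' B') (tens F G) := by
  refine isHom_of_gen_left (isGen_tensorObj_self A B) ?_ ?_
  · rw [carrier_tens hF.carrier hG.carrier, carrier_tensorObj, carrier_tensorObj]
  · rintro _ ⟨a, ha, b, hb, rfl⟩
    rw [act_tens hF.carrier hG.carrier (carrier_eq_of_mem ha) (carrier_eq_of_mem hb)]
    exact tp_mem (hF.act_mem a ha) (hG.act_mem b hb)

theorem app_homMk_tens {A' B' : Cond m} {F G : Proj m Two} (hF : IsHom A A' F)
    (hG : IsHom B B' G) (x : El A) (y : El B) :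
    (homMk (tens F G) (isHom_tens hF hG)).app (El.tmul x y) =
      El.tmul ((homMk F hF).app x) ((homMk G hG).app y) := by
  obtain ⟨x, hx, rfl⟩ := x.exists_mk
  obtain ⟨y, hy, rfl⟩ := y.exists_mk
  rw [El.tmul_mk, app_homMk, app_homMk, app_homMk, El.tmul_mk]
  exact El.mk_congr
    (act_tens hF.carrier hG.carrier (carrier_eq_of_mem hx) (carrier_eq_of_mem hy)) _ _

/-- The tensor product of morphisms. -/
noncomputable def Hom.tens {A' B' : Cond m} (h : Hom A A') (k : Hom B B') :
    Hom (tensorObj A B) (tensorObj A' B') :=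
  homMk (Proj.tens h.rep k.rep) (isHom_tens h.isHom_rep k.isHom_rep)

@[simp] theorem app_tens {A' B' : Cond m} (h : Hom A A') (k : Hom B B') (x : El A) (y : El B) :
    (h.tens k).app (El.tmul x y) = El.tmul (h.app x) (k.app y) := by
  rw [Hom.tens, app_homMk_tens h.isHom_rep k.isHom_rep, homMk_rep, homMk_rep]

end Cond

end IG

namespace IG

open Conduct Proj

namespace Cond

variable {m : Weight → ℝ≥0∞} {A B C D : Cond m}

/-! ### Relocations as morphisms -/

/-- The morphism given by a relocation. -/
noncomputable def Hom.reloc {S : Set (Proj m ℕ)} (hS : A.IsGen S) (θ : ℕ → ℕ)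
    (hc : B.carrier = A.carrier.image θ) (h : ∀ s ∈ S, s.map θ ∈ B) : Hom A B :=
  homMk _ (isHom_reloc_of_gen hS θ hc h)

theorem app_hom_reloc {S : Set (Proj m ℕ)} {hS : A.IsGen S} {θ : ℕ → ℕ}
    {hc : B.carrier = A.carrier.image θ} {h : ∀ s ∈ S, s.map θ ∈ B} {x y : Proj m ℕ} (hx : x ∈ A)
    (hy : y ∈ B) (hxy : x.map θ = y) : (Hom.reloc hS θ hc h).app (El.mk x hx) = El.mk y hy := by
  subst hxy
  exact app_reloc θ _ hx hy

/-! ### Coherence morphisms of the tensor product -/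

/-- The relocation of the associator: `4 x ↦ 2 x`, `4 x + 2 ↦ 4 x + 1`, `2 x + 1 ↦ 4 x + 3`. -/
def assocMap (n : ℕ) : ℕ := if n % 4 = 0 then n / 2 else if n % 4 = 2 then n - 1 else 2 * n + 1

/-- The inverse of the relocation of the associator. -/
def assocMapInv (n : ℕ) : ℕ :=
  if n % 2 = 0 then 2 * n else if n % 4 = 1 then n + 1 else (n - 1) / 2

/-- The relocation of the symmetry: `2 x ↔ 2 x + 1`. -/
def swapMap (n : ℕ) : ℕ := if n % 2 = 0 then n + 1 else n - 1

theorem assocMap_comp₁ : assocMap ∘ ev ∘ ev = ev := funext fun n => by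
  change assocMap (2 * (2 * n)) = 2 * n
  unfold assocMap
  split_ifs <;> omega

theorem assocMap_comp₂ : assocMap ∘ ev ∘ od = od ∘ ev := funext fun n => by
  change assocMap (2 * (2 * n + 1)) = 2 * (2 * n) + 1
  unfold assocMap
  split_ifs <;> omega

theorem assocMap_comp₃ : assocMap ∘ od = od ∘ od := funext fun n => by
  change assocMap (2 * n + 1) = 2 * (2 * n + 1) + 1
  unfold assocMap
  split_ifs <;> omega

theorem assocMapInv_assocMap (n : ℕ) : assocMapInv (assocMap n) = n := by
  unfold assocMap assocMapInv
  split_ifs <;> omega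

theorem assocMap_injective : Function.Injective assocMap :=
  Function.LeftInverse.injective assocMapInv_assocMap

theorem swapMap_comp_ev : swapMap ∘ ev = od := funext fun n => by
  change swapMap (2 * n) = 2 * n + 1
  unfold swapMap
  split_ifs <;> omega

theorem swapMap_comp_od : swapMap ∘ od = ev := funext fun n => by
  change swapMap (2 * n + 1) = 2 * n
  unfold swapMap
  split_ifs <;> omega

theorem half_comp_ev : (· / 2) ∘ ev = id := funext fun n => by
  change 2 * n / 2 = n
  omega

theorem half_comp_od : (· / 2) ∘ od = id := funext fun n => by
  change (2 * n + 1) / 2 = n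
  omega

theorem swapMap_injective : Function.Injective swapMap := by
  refine Function.LeftInverse.injective (g := swapMap) fun n => ?_
  unfold swapMap
  split_ifs <;> omega

theorem tp_assoc (a b c : Proj m ℕ) :
    a.map ev * (b.map (od ∘ ev) * c.map (od ∘ od)) =
      a.map ev * b.map (od ∘ ev) * c.map (od ∘ od) := by
  refine (Proj.mul_assoc fun v hv hv' => ?_).symm
  rw [carrier_map, Finset.mem_image] at hv hv'
  obtain ⟨x, -, rfl⟩ := hv
  obtain ⟨y, -, h⟩ := hv'
  exact absurd h.symm (ev_ne_od _ _)

theorem map_assocMap_tp (a b c : Proj m ℕ) :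
    (tp (tp a b) c).map assocMap = tp a (tp b c) := by
  simp only [tp, map_mul_of_injective assocMap_injective, map_mul_of_injective ev_injective,
    map_mul_of_injective od_injective, map_map, assocMap_comp₁, assocMap_comp₂, assocMap_comp₃]
  exact (tp_assoc a b c).symm

theorem map_assocMapInv_tp (a b c : Proj m ℕ) :
    (tp a (tp b c)).map assocMapInv = tp (tp a b) c := by
  rw [← map_assocMap_tp, map_map]
  exact map_eq_self fun n _ => assocMapInv_assocMap n

theorem map_swapMap_tp (a b : Proj m ℕ) : (tp a b).map swapMap = tp b a := by
  simp only [tp, map_mul_of_injective swapMap_injective, map_map, swapMap_comp_ev, swapMap_comp_od]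
  exact Proj.mul_comm _ _

theorem tp_zero_left (a : Proj m ℕ) : tp (Proj.zero m ∅) a = a.map od := by
  rw [tp, Proj.map_zero, Finset.image_empty, Proj.zero_mul]

theorem tp_zero_right (a : Proj m ℕ) : tp a (Proj.zero m ∅) = a.map ev := by
  rw [tp, Proj.map_zero, Finset.image_empty, Proj.mul_zero]

theorem map_ev_half (a : Proj m ℕ) : (a.map ev).map (· / 2) = a := by
  rw [map_map, half_comp_ev, map_id]

theorem map_od_half (a : Proj m ℕ) : (a.map od).map (· / 2) = a := by
  rw [map_map, half_comp_od, map_id]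

theorem isGen_unitObj : (unitObj m).IsGen {Proj.zero m ∅} := by
  have h : {x : Proj m ℕ | ∃ a ∈ ({Project.zero ∅} : Set (Project ℕ)), Proj.mk m a = x} =
      {Proj.zero m ∅} := by
    ext x
    constructor
    · rintro ⟨_, rfl, rfl⟩
      rfl
    · rintro rfl
      exact ⟨_, rfl, rfl⟩
  rw [← h]
  exact isGen_gen (m := m) (∅ : Finset ℕ) (by rintro _ rfl; rfl)

@[simp] theorem carrier_unitObj : (unitObj m).carrier = ∅ := rfl

/-- The class of `0_∅`. -/
noncomputable def El.one : El (unitObj m) := El.mk (Proj.zero m ∅) (isGen_unitObj.mem _ rfl)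

theorem isGen_tensorObj₃ (A B C : Cond m) : (tensorObj (tensorObj A B) C).IsGen
    {x | ∃ a ∈ A, ∃ b ∈ B, ∃ c ∈ C, x = tp (tp a b) c} := by
  convert isGen_tensorObj (isGen_tensorObj_self A B) (isGen_self C) using 1
  ext x
  constructor
  · rintro ⟨a, ha, b, hb, c, hc, rfl⟩
    exact ⟨_, ⟨a, ha, b, hb, rfl⟩, c, hc, rfl⟩
  · rintro ⟨_, ⟨a, ha, b, hb, rfl⟩, c, hc, rfl⟩
    exact ⟨a, ha, b, hb, c, hc, rfl⟩

theorem isGen_tensorObj₃' (A B C : Cond m) : (tensorObj A (tensorObj B C)).IsGen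
    {x | ∃ a ∈ A, ∃ b ∈ B, ∃ c ∈ C, x = tp a (tp b c)} := by
  convert isGen_tensorObj (isGen_self A) (isGen_tensorObj_self B C) using 1
  ext x
  constructor
  · rintro ⟨a, ha, b, hb, c, hc, rfl⟩
    exact ⟨a, ha, _, ⟨b, hb, c, hc, rfl⟩, rfl⟩
  · rintro ⟨a, ha, _, ⟨b, hb, c, hc, rfl⟩, rfl⟩
    exact ⟨a, ha, b, hb, c, hc, rfl⟩

theorem Hom.ext_tensor₃ {h k : Hom (tensorObj (tensorObj A B) C) D}
    (H : ∀ x y z, h.app (El.tmul (El.tmul x y) z) = k.app (El.tmul (El.tmul x y) z)) : h = k :=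
  Hom.ext_gen (isGen_tensorObj₃ A B C) fun s hs => by
    obtain ⟨a, ha, b, hb, c, hc, rfl⟩ := hs
    exact H (El.mk a ha) (El.mk b hb) (El.mk c hc)

theorem Hom.ext_tensor₃' {h k : Hom (tensorObj A (tensorObj B C)) D}
    (H : ∀ x y z, h.app (El.tmul x (El.tmul y z)) = k.app (El.tmul x (El.tmul y z))) : h = k :=
  Hom.ext_gen (isGen_tensorObj₃' A B C) fun s hs => by
    obtain ⟨a, ha, b, hb, c, hc, rfl⟩ := hs
    exact H (El.mk a ha) (El.mk b hb) (El.mk c hc)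

theorem Hom.ext_tensor₄ {E : Cond m} {h k : Hom (tensorObj (tensorObj (tensorObj A B) C) D) E}
    (H : ∀ x y z w, h.app (El.tmul (El.tmul (El.tmul x y) z) w) =
      k.app (El.tmul (El.tmul (El.tmul x y) z) w)) : h = k :=
  Hom.ext_gen (isGen_tensorObj (isGen_tensorObj₃ A B C) (isGen_self D)) fun s hs => by
    obtain ⟨_, ⟨a, ha, b, hb, c, hc, rfl⟩, d, hd, rfl⟩ := hs
    exact H (El.mk a ha) (El.mk b hb) (El.mk c hc) (El.mk d hd)

theorem Hom.ext_unit_left {h k : Hom (tensorObj (unitObj m) A) B}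
    (H : ∀ x, h.app (El.tmul El.one x) = k.app (El.tmul El.one x)) : h = k :=
  Hom.ext_gen (isGen_tensorObj isGen_unitObj (isGen_self A)) fun s hs => by
    obtain ⟨_, rfl, a, ha, rfl⟩ := hs
    exact H (El.mk a ha)

theorem Hom.ext_unit_right {h k : Hom (tensorObj A (unitObj m)) B}
    (H : ∀ x, h.app (El.tmul x El.one) = k.app (El.tmul x El.one)) : h = k :=
  Hom.ext_gen (isGen_tensorObj (isGen_self A) isGen_unitObj) fun s hs => by
    obtain ⟨a, ha, _, rfl, rfl⟩ := hs
    exact H (El.mk a ha)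

theorem Hom.ext_unit_middle {h k : Hom (tensorObj (tensorObj A (unitObj m)) B) C}
    (H : ∀ x y, h.app (El.tmul (El.tmul x El.one) y) = k.app (El.tmul (El.tmul x El.one) y)) :
    h = k :=
  Hom.ext_gen (isGen_tensorObj (isGen_tensorObj (isGen_self A) isGen_unitObj) (isGen_self B))
    fun s hs => by
      obtain ⟨_, ⟨a, ha, _, rfl, rfl⟩, b, hb, rfl⟩ := hs
      exact H (El.mk a ha) (El.mk b hb)

variable (A B C)

theorem image_assocMap : (tensorObj A (tensorObj B C)).carrier =
    (tensorObj (tensorObj A B) C).carrier.image assocMap := by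
  simp only [carrier_tensorObj, Finset.image_union, Finset.image_image, ← Finset.union_assoc,
    assocMap_comp₁, assocMap_comp₂, assocMap_comp₃]

/-- The associator. -/
noncomputable def Hom.assoc :
    Hom (tensorObj (tensorObj A B) C) (tensorObj A (tensorObj B C)) :=
  Hom.reloc (isGen_tensorObj₃ A B C) assocMap (image_assocMap A B C) (by
    rintro _ ⟨a, ha, b, hb, c, hc, rfl⟩
    rw [map_assocMap_tp]
    exact tp_mem ha (tp_mem hb hc))

/-- The inverse of the associator. -/
noncomputable def Hom.assocInv :
    Hom (tensorObj A (tensorObj B C)) (tensorObj (tensorObj A B) C) :=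
  Hom.reloc (isGen_tensorObj₃' A B C) assocMapInv (by
    rw [image_assocMap, Finset.image_image]
    exact (Finset.image_id.symm.trans
      (Finset.image_congr fun n _ => (assocMapInv_assocMap n).symm))) (by
    rintro _ ⟨a, ha, b, hb, c, hc, rfl⟩
    rw [map_assocMapInv_tp]
    exact tp_mem (tp_mem ha hb) hc)

/-- The symmetry. -/
noncomputable def Hom.swap : Hom (tensorObj A B) (tensorObj B A) :=
  Hom.reloc (isGen_tensorObj_self A B) swapMap (by
    simp only [carrier_tensorObj, Finset.image_union, Finset.image_image, swapMap_comp_ev,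
      swapMap_comp_od]
    rw [Finset.union_comm]) (by
    rintro _ ⟨a, ha, b, hb, rfl⟩
    rw [map_swapMap_tp]
    exact tp_mem hb ha)

/-- The left unitor. -/
noncomputable def Hom.unitLeft : Hom (tensorObj (unitObj m) A) A :=
  Hom.reloc (isGen_tensorObj isGen_unitObj (isGen_self A)) (· / 2) (by
    rw [carrier_tensorObj, carrier_unitObj, Finset.image_empty, Finset.empty_union,
      Finset.image_image, half_comp_od, Finset.image_id]) (by
    rintro _ ⟨_, rfl, a, ha, rfl⟩
    rwa [tp_zero_left, map_od_half])

/-- The inverse of the left unitor. -/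
noncomputable def Hom.unitLeftInv : Hom A (tensorObj (unitObj m) A) :=
  Hom.reloc (isGen_self A) od (by
    rw [carrier_tensorObj, carrier_unitObj, Finset.image_empty, Finset.empty_union]) (by
    intro a ha
    rw [← tp_zero_left]
    exact tp_mem (isGen_unitObj.mem _ rfl) ha)

/-- The right unitor. -/
noncomputable def Hom.unitRight : Hom (tensorObj A (unitObj m)) A :=
  Hom.reloc (isGen_tensorObj (isGen_self A) isGen_unitObj) (· / 2) (by
    rw [carrier_tensorObj, carrier_unitObj, Finset.image_empty, Finset.union_empty,
      Finset.image_image, half_comp_ev, Finset.image_id]) (by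
    rintro _ ⟨a, ha, _, rfl, rfl⟩
    rwa [tp_zero_right, map_ev_half])

/-- The inverse of the right unitor. -/
noncomputable def Hom.unitRightInv : Hom A (tensorObj A (unitObj m)) :=
  Hom.reloc (isGen_self A) ev (by
    rw [carrier_tensorObj, carrier_unitObj, Finset.image_empty, Finset.union_empty]) (by
    intro a ha
    rw [← tp_zero_right]
    exact tp_mem ha (isGen_unitObj.mem _ rfl))

variable {A B C}

@[simp] theorem app_assoc (x : El A) (y : El B) (z : El C) :
    (Hom.assoc A B C).app (El.tmul (El.tmul x y) z) = El.tmul x (El.tmul y z) := by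
  obtain ⟨x, hx, rfl⟩ := x.exists_mk
  obtain ⟨y, hy, rfl⟩ := y.exists_mk
  obtain ⟨z, hz, rfl⟩ := z.exists_mk
  exact app_hom_reloc (tp_mem (tp_mem hx hy) hz) (tp_mem hx (tp_mem hy hz)) (map_assocMap_tp _ _ _)

@[simp] theorem app_assocInv (x : El A) (y : El B) (z : El C) :
    (Hom.assocInv A B C).app (El.tmul x (El.tmul y z)) = El.tmul (El.tmul x y) z := by
  obtain ⟨x, hx, rfl⟩ := x.exists_mk
  obtain ⟨y, hy, rfl⟩ := y.exists_mk
  obtain ⟨z, hz, rfl⟩ := z.exists_mk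
  exact app_hom_reloc (tp_mem hx (tp_mem hy hz)) (tp_mem (tp_mem hx hy) hz)
    (map_assocMapInv_tp _ _ _)

@[simp] theorem app_swap (x : El A) (y : El B) :
    (Hom.swap A B).app (El.tmul x y) = El.tmul y x := by
  obtain ⟨x, hx, rfl⟩ := x.exists_mk
  obtain ⟨y, hy, rfl⟩ := y.exists_mk
  exact app_hom_reloc (tp_mem hx hy) (tp_mem hy hx) (map_swapMap_tp _ _)

@[simp] theorem app_unitLeft (x : El A) : (Hom.unitLeft A).app (El.tmul El.one x) = x := by
  obtain ⟨x, hx, rfl⟩ := x.exists_mk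
  exact app_hom_reloc (tp_mem (isGen_unitObj.mem _ rfl) hx) hx (by rw [tp_zero_left, map_od_half])

@[simp] theorem app_unitLeftInv (x : El A) : (Hom.unitLeftInv A).app x = El.tmul El.one x := by
  obtain ⟨x, hx, rfl⟩ := x.exists_mk
  exact app_hom_reloc hx (tp_mem (isGen_unitObj.mem _ rfl) hx) (tp_zero_left _).symm

@[simp] theorem app_unitRight (x : El A) : (Hom.unitRight A).app (El.tmul x El.one) = x := by
  obtain ⟨x, hx, rfl⟩ := x.exists_mk
  exact app_hom_reloc (tp_mem hx (isGen_unitObj.mem _ rfl)) hx (by rw [tp_zero_right, map_ev_half])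

@[simp] theorem app_unitRightInv (x : El A) : (Hom.unitRightInv A).app x = El.tmul x El.one := by
  obtain ⟨x, hx, rfl⟩ := x.exists_mk
  exact app_hom_reloc hx (tp_mem hx (isGen_unitObj.mem _ rfl)) (tp_zero_right _).symm

/-! ### Internal hom -/

theorem lolliObj_eq (A B : Cond m) : lolliObj A B = (homConduct A B).deloc φ φ_injective := by
  have : Conduct.gen m ((copy 0 A).carrier ∪ (copy 1 B).carrier) (HomSet A B) =
      homConduct A B := by
    ext1
    · rfl
    · exact (homConduct A B).closed
  rw [lolliObj, this]

theorem lolliObj_projects (A B : Cond m) :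
    (lolliObj A B).projects = Project.map φ '' HomSet A B := by
  rw [lolliObj_eq]
  rfl

@[simp] theorem carrier_lolliObj (A B : Cond m) :
    (lolliObj A B).carrier = A.carrier.image ev ∪ B.carrier.image od :=
  carrier_tensorObj A B

theorem isGen_lolliObj_orth {S T : Set (Proj m ℕ)} (hS : A.IsGen S) (hT : B.orth.IsGen T) :
    (lolliObj A B).orth.IsGen {x | ∃ s ∈ S, ∃ t ∈ T, x = tp s t} := by
  rw [lolliObj_eq, deloc_orth]
  convert isGen_deloc φ_injective (isGen_homConduct_orth hS hT) using 1
  have h : ∀ s t : Proj m ℕ, (s.map (ψ 0) * t.map (ψ 1)).map φ = tp s t := fun s t => by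
    rw [map_mul_of_injective φ_injective, map_map, map_map]
    rfl
  ext x
  constructor
  · rintro ⟨s, hs, t, ht, rfl⟩
    exact ⟨_, ⟨s, hs, t, ht, rfl⟩, h s t⟩
  · rintro ⟨_, ⟨s, hs, t, ht, rfl⟩, rfl⟩
    exact ⟨s, hs, t, ht, h s t⟩

/-- The relocation of currying. -/
def curryMap (p : Two) : Two :=
  if p.2 = 0 then if p.1 % 2 = 0 then (p.1, 1) else (p.1 / 2, 0) else (od p.1, 1)

/-- The inverse of the relocation of currying. -/
def uncurryMap (p : Two) : Two :=
  if p.2 = 0 then (od p.1, 0) else if p.1 % 2 = 0 then (p.1, 0) else (p.1 / 2, 1)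

theorem curryMap_uncurryMap (p : Two) : curryMap (uncurryMap p) = p := by
  obtain ⟨x, i⟩ := p
  fin_cases i
  · have : (2 * x + 1) % 2 = 1 := by omega
    have : (2 * x + 1) / 2 = x := by omega
    simp [curryMap, uncurryMap, od, *]
  · rcases Nat.even_or_odd' x with ⟨c, rfl | rfl⟩
    · simp [curryMap, uncurryMap]
    · have : (2 * c + 1) / 2 = c := by omega
      simp [curryMap, uncurryMap, od, Nat.add_mod, this]

theorem uncurryMap_curryMap (p : Two) : uncurryMap (curryMap p) = p := by
  obtain ⟨x, i⟩ := p
  fin_cases i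
  · rcases Nat.even_or_odd' x with ⟨c, rfl | rfl⟩
    · simp [curryMap, uncurryMap]
    · have : (2 * c + 1) / 2 = c := by omega
      simp [curryMap, uncurryMap, od, Nat.add_mod, this]
  · have : (2 * x + 1) / 2 = x := by omega
    simp [curryMap, uncurryMap, od, Nat.add_mod, this]

theorem curryMap_injective : Function.Injective curryMap :=
  Function.LeftInverse.injective uncurryMap_curryMap

theorem curryMap_ev (x : ℕ) : curryMap (ψ 0 (ev x)) = ψ 1 (ev x) := by
  simp [curryMap, ψ, ev]

theorem curryMap_od (x : ℕ) : curryMap (ψ 0 (od x)) = ψ 0 x := by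
  have : (2 * x + 1) / 2 = x := by omega
  simp [curryMap, ψ, od, Nat.add_mod, this]

theorem curryMap_one (x : ℕ) : curryMap (ψ 1 x) = ψ 1 (od x) := by
  simp [curryMap, ψ]

theorem image_curryMap (U V W : Finset ℕ) :
    (bi (U.image ev ∪ V.image od) W).image curryMap = bi V (U.image ev ∪ W.image od) := by
  unfold bi
  simp only [Finset.image_union, Finset.image_image]
  have h1 : curryMap ∘ ψ 0 ∘ ev = ψ 1 ∘ ev := funext curryMap_ev
  have h2 : curryMap ∘ ψ 0 ∘ od = ψ 0 := funext curryMap_od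
  have h3 : curryMap ∘ ψ 1 = ψ 1 ∘ od := funext curryMap_one
  rw [h1, h2, h3]
  ext p
  simp only [Finset.mem_union]
  tauto

/-- Relocating `F` along `curryMap` exchanges the measurements against `(a ⊗ b) ⊗ c` and `b ⊗ (a ⊗
c)`. -/
theorem curry_sca (F : Proj m Two) (a b c : Proj m ℕ) :
    (F.map curryMap).sca (b.map (ψ 0) * (tp a c).map (ψ 1)) =
      F.sca ((tp a b).map (ψ 0) * c.map (ψ 1)) := by
  have h1 : curryMap ∘ ψ 0 ∘ ev = ψ 1 ∘ ev := funext curryMap_ev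
  have h2 : curryMap ∘ ψ 0 ∘ od = ψ 0 := funext curryMap_od
  have h3 : curryMap ∘ ψ 1 = ψ 1 ∘ od := funext curryMap_one
  rw [← sca_map curryMap_injective.injOn (x := F)]
  congr 1
  simp only [tp, map_mul_of_injective curryMap_injective, map_mul_of_injective (ψ_injective _),
    map_map, h1, h2, h3]
  rw [Proj.mul_comm (a.map _) (b.map _)]
  refine (Proj.mul_assoc fun v hv hv' => ?_).symm
  rw [carrier_map, Finset.mem_image] at hv hv'
  obtain ⟨x, -, rfl⟩ := hv
  obtain ⟨y, -, h⟩ := hv'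
  exact absurd (congrArg Prod.snd h) (by simp [ψ])

theorem carrier_curry {F : Proj m Two} :
    (F.map curryMap).carrier = bi B.carrier (lolliObj A C).carrier ↔
      F.carrier = bi (tensorObj A B).carrier C.carrier := by
  rw [carrier_map, carrier_tensorObj, carrier_lolliObj, ← image_curryMap]
  exact (Finset.image_injective curryMap_injective).eq_iff

theorem sca_act_curry {F : Proj m Two} (hF : F.carrier = bi (tensorObj A B).carrier C.carrier)
    {a b : Proj m ℕ} (ha : a ∈ A) (hb : b ∈ B) (c : Proj m ℕ) :
    (act (F.map curryMap) b).sca (tp a c) = (act F (tp a b)).sca c := by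
  rw [sca_act hF (carrier_eq_of_mem (tp_mem ha hb)),
    sca_act (carrier_curry.2 hF) (carrier_eq_of_mem hb), curry_sca]

/-- Both conditions say that the measurements against the same tensor products of three projects are
neither `0` nor `∞`. -/
theorem isHom_curry {F : Proj m Two} :
    IsHom B (lolliObj A C) (F.map curryMap) ↔ IsHom (tensorObj A B) C F := by
  constructor
  · intro h
    have hF := carrier_curry.1 h.carrier
    refine isHom_of_gen (isGen_tensorObj_self A B) (isGen_self _) hF ?_
    rintro _ ⟨a, ha, b, hb, rfl⟩ c hc
    have := perp_of_mem (h.act_mem b hb)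
      ((isGen_lolliObj_orth (isGen_self A) (isGen_self _)).mem _ ⟨a, ha, c, hc, rfl⟩)
    unfold Perp at this ⊢
    rwa [sca_act_curry hF ha hb] at this
  · intro h
    refine isHom_of_gen (isGen_self B) (isGen_lolliObj_orth (isGen_self A) (isGen_self _))
      (carrier_curry.2 h.carrier) ?_
    rintro b hb _ ⟨a, ha, c, hc, rfl⟩
    have := perp_of_mem (h.act_mem _ (tp_mem ha hb)) hc
    unfold Perp at this ⊢
    rwa [sca_act_curry h.carrier ha hb]

theorem homMk_curry_iff {F G : Proj m Two} {hF : IsHom (tensorObj A B) C F}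
    {hG : IsHom (tensorObj A B) C G} :
    homMk _ (isHom_curry.2 hF) = homMk _ (isHom_curry.2 hG) ↔ homMk F hF = homMk G hG := by
  rw [homMk_eq_iff (isGen_tensorObj_self A B) (isGen_self _),
    homMk_eq_iff (isGen_self B) (isGen_lolliObj_orth (isGen_self A) (isGen_self _))]
  constructor
  · rintro h _ ⟨a, ha, b, hb, rfl⟩ c hc
    rw [← sca_act_curry hF.carrier ha hb, ← sca_act_curry hG.carrier ha hb]
    exact h b hb _ ⟨a, ha, c, hc, rfl⟩
  · rintro h b hb _ ⟨a, ha, c, hc, rfl⟩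
    rw [sca_act_curry hF.carrier ha hb, sca_act_curry hG.carrier ha hb]
    exact h _ ⟨a, ha, b, hb, rfl⟩ c hc

theorem map_curry_uncurry (F : Proj m Two) : (F.map uncurryMap).map curryMap = F := by
  rw [map_map]
  exact map_eq_self fun p _ => curryMap_uncurryMap p

theorem map_uncurry_curry (F : Proj m Two) : (F.map curryMap).map uncurryMap = F := by
  rw [map_map]
  exact map_eq_self fun p _ => uncurryMap_curryMap p

theorem isHom_uncurry {G : Proj m Two} (hG : IsHom B (lolliObj A C) G) :
    IsHom (tensorObj A B) C (G.map uncurryMap) :=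
  isHom_curry.1 (by rwa [map_curry_uncurry])

theorem homMk_congr {F G : Proj m Two} (h : F = G) (hF : IsHom A B F) (hG : IsHom A B G) :
    homMk F hF = homMk G hG := by
  subst h
  rfl

/-- Currying. -/
noncomputable def Hom.curry (h : Hom (tensorObj A B) C) : Hom B (lolliObj A C) :=
  homMk _ (isHom_curry.2 h.isHom_rep)

/-- The inverse of currying. -/
noncomputable def Hom.uncurry (k : Hom B (lolliObj A C)) : Hom (tensorObj A B) C :=
  homMk _ (isHom_uncurry k.isHom_rep)

theorem curry_homMk {F : Proj m Two} (hF : IsHom (tensorObj A B) C F) :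
    (homMk F hF).curry = homMk _ (isHom_curry.2 hF) :=
  homMk_curry_iff.2 (homMk_rep _)

theorem uncurry_homMk {G : Proj m Two} (hG : IsHom B (lolliObj A C) G) :
    (homMk G hG).uncurry = homMk _ (isHom_uncurry hG) := by
  refine homMk_curry_iff.1 ?_
  rw [homMk_congr (map_curry_uncurry G) _ hG]
  exact (homMk_congr (map_curry_uncurry _) _ (Hom.isHom_rep _)).trans (homMk_rep _)

/-- Morphisms `A ⊗ B ⟶ C` correspond to morphisms `B ⟶ A ⊸ C`: up to relocation, both are
represented by the same projects. -/
noncomputable def curryEquiv (A B C : Cond m) : Hom (tensorObj A B) C ≃ Hom B (lolliObj A C) where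
  toFun := Hom.curry
  invFun := Hom.uncurry
  left_inv h := by
    obtain ⟨F, hF, rfl⟩ := h.exists_homMk
    rw [curry_homMk, uncurry_homMk]
    exact homMk_congr (map_uncurry_curry F) _ _
  right_inv k := by
    obtain ⟨G, hG, rfl⟩ := k.exists_homMk
    rw [uncurry_homMk, curry_homMk]
    exact homMk_congr (map_curry_uncurry G) _ _

/-- The measurement of a class of projects of `A` against a project of `A^⊥`. -/
noncomputable def El.sca (x : El A) (b : Proj m ℕ) (hb : b ∈ A.orth) : WithTop ℝ :=
  Quotient.lift (s := elSetoid A) (fun x => x.1.sca b) (fun _ _ h => h b hb) x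

theorem El.sca_mk {a b : Proj m ℕ} (ha : a ∈ A) (hb : b ∈ A.orth) :
    (El.mk a ha).sca b hb = a.sca b := rfl

theorem tp_mem_lolliObj_orth {a c : Proj m ℕ} (ha : a ∈ A) (hc : c ∈ C.orth) :
    tp a c ∈ (lolliObj A C).orth :=
  (isGen_lolliObj_orth (isGen_self A) (isGen_self _)).mem _ ⟨a, ha, c, hc, rfl⟩

theorem El.ext_lolliObj {T : Set (Proj m ℕ)} (hT : C.orth.IsGen T) {x y : El (lolliObj A C)}
    (h : ∀ (a : Proj m ℕ) (ha : a ∈ A) (c : Proj m ℕ) (hc : c ∈ T),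
      x.sca _ (tp_mem_lolliObj_orth ha (hT.mem c hc)) =
        y.sca _ (tp_mem_lolliObj_orth ha (hT.mem c hc))) : x = y := by
  obtain ⟨x, hx, rfl⟩ := x.exists_mk
  obtain ⟨y, hy, rfl⟩ := y.exists_mk
  rw [El.mk_eq_iff (isGen_lolliObj_orth (isGen_self A) hT)]
  rintro _ ⟨a, ha, c, hc, rfl⟩
  exact h a ha c hc

theorem sca_app_curry (h : Hom (tensorObj A B) C) (y : El B) {a c : Proj m ℕ} (ha : a ∈ A)
    (hc : c ∈ C.orth) : (h.curry.app y).sca _ (tp_mem_lolliObj_orth ha hc) =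
      (h.app (El.tmul (El.mk a ha) y)).sca c hc := by
  obtain ⟨F, hF, rfl⟩ := h.exists_homMk
  obtain ⟨y, hy, rfl⟩ := y.exists_mk
  rw [curry_homMk, app_homMk, El.sca_mk, El.tmul_mk, app_homMk, El.sca_mk]
  exact sca_act_curry hF.carrier ha hy c

theorem curry_comp (f : Hom B D) (g : Hom (tensorObj A D) C) :
    (((Hom.id A).tens f).comp g).curry = f.comp g.curry := by
  refine Hom.ext_app fun y => El.ext_lolliObj (isGen_self _) fun a ha c hc => ?_
  rw [sca_app_curry (ha := ha) (hc := hc), app_comp, app_comp, app_tens, app_id,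
    sca_app_curry (ha := ha) (hc := hc)]

/-! ### The dualizing object -/

theorem ext_of_isGen {S : Set (Proj m ℕ)} (h : A.carrier = B.carrier) (hA : A.orth.IsGen S)
    (hB : B.orth.IsGen S) : A = B :=
  ext_of_mem h fun x => by rw [hA.mem_iff, hB.mem_iff, h]

theorem isGen_counitObj_orth : (counitObj m).orth.IsGen {Proj.zero m ∅} := by
  rw [counitObj, orth_orth]
  exact isGen_unitObj

/-- The dual `A ⊸ ⊥` is `A^⊥`, relocated. -/
theorem lolliObj_counitObj (A : Cond m) :
    lolliObj A (counitObj m) = A.orth.deloc ev ev_injective := by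
  refine ext_of_isGen (S := Proj.map ev '' {x | x ∈ A}) ?_ ?_ ?_
  · rw [carrier_lolliObj]
    exact Finset.union_empty _
  · convert isGen_lolliObj_orth (isGen_self A) isGen_counitObj_orth using 1
    ext x
    constructor
    · rintro ⟨a, ha, rfl⟩
      exact ⟨a, ha, _, rfl, (tp_zero_right a).symm⟩
    · rintro ⟨a, ha, _, rfl, rfl⟩
      exact ⟨a, ha, (tp_zero_right a).symm⟩
  · rw [deloc_orth, orth_orth]
    exact isGen_deloc _ (isGen_self A)

theorem lolliObj_lolliObj_counitObj (A : Cond m) :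
    lolliObj (lolliObj A (counitObj m)) (counitObj m) =
      (A.deloc ev ev_injective).deloc ev ev_injective := by
  rw [lolliObj_counitObj, lolliObj_counitObj, deloc_orth, orth_orth]

/-- The canonical morphism from `A` to its double dual is a relocation. -/
theorem app_curry_swap (A : Cond m)
    (h : Hom (tensorObj A (lolliObj A (counitObj m))) (counitObj m)) (hh : h.curry = Hom.id _)
    {a : Proj m ℕ} (ha : a ∈ A)
    (ha' : (a.map ev).map ev ∈ lolliObj (lolliObj A (counitObj m)) (counitObj m)) :
    (((Hom.swap _ _).comp h).curry).app (El.mk a ha) = El.mk _ ha' := by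
  refine El.ext_lolliObj isGen_counitObj_orth ?_
  rintro u hu _ rfl
  rw [sca_app_curry (ha := hu) (hc := isGen_counitObj_orth.mem _ rfl), app_comp, app_swap,
    ← sca_app_curry h, hh, app_id, El.sca_mk, El.sca_mk, tp_zero_right, tp_zero_right,
    Proj.sca_map ev_injective.injOn, Proj.sca_comm]

/-- A morphism that acts as a relocation `θ` is invertible as soon as the inverse relocation
sends the target to the source. -/
theorem exists_inverse (h : Hom A B) (θ η : ℕ → ℕ) (hB : A.carrier = B.carrier.image η)
    (hθ : ∀ a ∈ A, a.map θ ∈ B) (hη : ∀ b ∈ B, b.map η ∈ A)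
    (hh : ∀ a (ha : a ∈ A), h.app (El.mk a ha) = El.mk (a.map θ) (hθ a ha))
    (hA' : ∀ a ∈ A, (a.map θ).map η = a) (hB' : ∀ b ∈ B, (b.map η).map θ = b) :
    ∃ k : Hom B A, h.comp k = Hom.id A ∧ k.comp h = Hom.id B := by
  refine ⟨Hom.reloc (isGen_self B) η hB hη, Hom.ext_app fun x => ?_, Hom.ext_app fun x => ?_⟩
  · obtain ⟨a, ha, rfl⟩ := x.exists_mk
    rw [app_comp, app_id, hh]
    exact app_hom_reloc _ _ (hA' a ha)
  · obtain ⟨b, hb, rfl⟩ := x.exists_mk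
    rw [app_comp, app_id, Hom.reloc, app_reloc η _ hb (hη b hb), hh]
    exact El.mk_congr (hB' b hb) _ _

theorem exists_dual_iso (A : Cond m) : ∃ (h : Hom (lolliObj A (counitObj m)) A.orth)
    (k : Hom A.orth (lolliObj A (counitObj m))),
      h.comp k = Hom.id _ ∧ k.comp h = Hom.id _ := by
  rw [lolliObj_counitObj]
  have hη : ∀ b ∈ A.orth.deloc ev ev_injective, b.map (· / 2) ∈ A.orth := by
    intro b hb
    obtain ⟨a, ha, rfl⟩ := (mem_deloc _).1 hb
    rwa [map_ev_half]
  have h1 : A.orth.carrier = (A.orth.deloc ev ev_injective).carrier.image (· / 2) := by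
    change _ = (A.orth.carrier.image ev).image _
    rw [Finset.image_image, half_comp_ev, Finset.image_id]
  let k : Hom A.orth (A.orth.deloc ev ev_injective) :=
    Hom.reloc (isGen_self _) ev rfl fun a ha => (mem_deloc _).2 ⟨a, ha, rfl⟩
  obtain ⟨h, hh, hh'⟩ := exists_inverse k ev (· / 2) h1
    (fun a ha => (mem_deloc _).2 ⟨a, ha, rfl⟩) hη (fun a ha => app_reloc _ _ _ _)
    (fun a _ => map_ev_half a) (fun b hb => by
      obtain ⟨a, ha, rfl⟩ := (mem_deloc _).1 hb
      rw [map_ev_half])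
  exact ⟨h, k, hh', hh⟩

/-- The canonical morphism from `A` to its double dual is invertible, because it acts as the
relocation `ev ∘ ev`. The hypothesis `hh` identifies `h` with the evaluation. -/
theorem exists_double_dual_inverse (A : Cond m)
    (h : Hom (tensorObj A (lolliObj A (counitObj m))) (counitObj m)) (hh : h.curry = Hom.id _) :
    ∃ k : Hom (lolliObj (lolliObj A (counitObj m)) (counitObj m)) A,
      ((Hom.swap _ _).comp h).curry.comp k = Hom.id _ ∧
        k.comp ((Hom.swap _ _).comp h).curry = Hom.id _ := by
  have hmem : ∀ b, b ∈ lolliObj (lolliObj A (counitObj m)) (counitObj m) ↔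
      ∃ a ∈ A, a.map (ev ∘ ev) = b := by
    intro b
    rw [lolliObj_lolliObj_counitObj, mem_deloc]
    constructor
    · rintro ⟨_, hc, rfl⟩
      obtain ⟨a, ha, rfl⟩ := (mem_deloc _).1 hc
      exact ⟨a, ha, (map_map _ _ _).symm⟩
    · rintro ⟨a, ha, rfl⟩
      exact ⟨_, (mem_deloc _).2 ⟨a, ha, rfl⟩, map_map _ _ _⟩
  have h2 : ∀ a : Proj m ℕ, (a.map (ev ∘ ev)).map ((· / 2) ∘ (· / 2)) = a := fun a => by
    rw [← map_map, ← map_map, map_ev_half, map_ev_half]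
  refine exists_inverse _ (ev ∘ ev) ((· / 2) ∘ (· / 2)) ?_ ?_ ?_ ?_ (fun a _ => h2 a) ?_
  · rw [lolliObj_lolliObj_counitObj]
    change _ = ((A.carrier.image ev).image ev).image _
    rw [← Finset.image_image (f := (· / 2)), Finset.image_image (f := ev), half_comp_ev,
      Finset.image_id, Finset.image_image, half_comp_ev, Finset.image_id]
  · intro a ha
    exact (hmem _).2 ⟨a, ha, rfl⟩
  · intro b hb
    obtain ⟨a, ha, rfl⟩ := (hmem b).1 hb
    rwa [h2]
  · intro a ha
    rw [app_curry_swap A h hh ha ((hmem _).2 ⟨a, ha, (map_map _ _ _).symm⟩)]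
    exact El.mk_congr (map_map _ _ _) _ _
  · intro b hb
    obtain ⟨a, ha, rfl⟩ := (hmem b).1 hb
    rw [h2]

end Cond

end IG

namespace IG

open Conduct Proj

theorem eqToHom_comp_eqToHom_self {C : Type*} [Category C] {X Y : C} (f : X ⟶ Y) :
    eqToHom (rfl : X = X) ≫ f ≫ eqToHom (rfl : Y = Y) = f := by
  rw [eqToHom_refl, eqToHom_refl, Category.id_comp, Category.comp_id]

section Closed

variable {C : Type*} [Category C] [MonoidalCategory C] (G : C → C → C)
  (e : ∀ A X Y : C, (A ⊗ X ⟶ Y) ≃ (X ⟶ G A Y))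
  (he : ∀ (A X' X Y : C) (f : X' ⟶ X) (g : A ⊗ X ⟶ Y), e A X' Y (A ◁ f ≫ g) = f ≫ e A X Y g)

/-- The closed structure given by a natural family of currying bijections. -/
@[reducible] def monoidalClosedOfEquiv : MonoidalClosed C where
  closed A :=
    { rightAdj := Adjunction.rightAdjointOfEquiv (F := MonoidalCategory.tensorLeft A)
        (G_obj := G A) (e A) (he A)
      adj := Adjunction.adjunctionOfEquivRight _ _ }

theorem curry_monoidalClosedOfEquiv {A X Y : C} (f : A ⊗ X ⟶ Y) :
    letI := monoidalClosedOfEquiv G e he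
    MonoidalClosed.curry f = e A X Y f := by
  let _ := monoidalClosedOfEquiv G e he
  change ((Adjunction.adjunctionOfEquivRight (F := MonoidalCategory.tensorLeft A)
    (G_obj := G A) (e A) (he A)).homEquiv X Y) f = _
  rw [Adjunction.adjunctionOfEquivRight, Adjunction.mkOfHomEquiv_homEquiv]

end Closed

namespace Cond

variable {m : Weight → ℝ≥0∞} {A B C D : Cond m}

/-- Mutually inverse morphisms as an isomorphism of the category of conducts. -/
def mkIso (h : Hom A B) (k : Hom B A) (hk : h.comp k = Hom.id A) (kh : k.comp h = Hom.id B) :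
    (condCat m).obj A ≅ (condCat m).obj B where
  hom := h
  inv := k
  hom_inv_id := hk
  inv_hom_id := kh

theorem assoc_assocInv (A B C : Cond m) :
    (Hom.assoc A B C).comp (Hom.assocInv A B C) = Hom.id _ :=
  Hom.ext_tensor₃ fun x y z => by simp

theorem assocInv_assoc (A B C : Cond m) :
    (Hom.assocInv A B C).comp (Hom.assoc A B C) = Hom.id _ :=
  Hom.ext_tensor₃' fun x y z => by simp

theorem unitLeft_unitLeftInv (A : Cond m) :
    (Hom.unitLeft A).comp (Hom.unitLeftInv A) = Hom.id _ :=
  Hom.ext_unit_left fun x => by simp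

theorem unitLeftInv_unitLeft (A : Cond m) :
    (Hom.unitLeftInv A).comp (Hom.unitLeft A) = Hom.id _ :=
  Hom.ext_app fun x => by simp

theorem unitRight_unitRightInv (A : Cond m) :
    (Hom.unitRight A).comp (Hom.unitRightInv A) = Hom.id _ :=
  Hom.ext_unit_right fun x => by simp

theorem unitRightInv_unitRight (A : Cond m) :
    (Hom.unitRightInv A).comp (Hom.unitRight A) = Hom.id _ :=
  Hom.ext_app fun x => by simp

/-- The tensor product of conducts and the coherence isomorphisms. -/
@[reducible] noncomputable def monoidalStruct (m : Weight → ℝ≥0∞) :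
    MonoidalCategoryStruct (condCat m).Obj where
  tensorObj A B := tensorObj (m := m) A B
  whiskerLeft A _ _ h := (Hom.id (m := m) A).tens h
  whiskerRight h B := Hom.tens h (Hom.id (m := m) B)
  tensorHom h k := Hom.tens (m := m) h k
  tensorUnit := unitObj m
  associator A B C := mkIso (m := m) (Hom.assoc A B C) (Hom.assocInv A B C)
    (assoc_assocInv A B C) (assocInv_assoc A B C)
  leftUnitor A := mkIso (m := m) (Hom.unitLeft A) (Hom.unitLeftInv A)
    (unitLeft_unitLeftInv A) (unitLeftInv_unitLeft A)
  rightUnitor A := mkIso (m := m) (Hom.unitRight A) (Hom.unitRightInv A)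
    (unitRight_unitRightInv A) (unitRightInv_unitRight A)

theorem tens_id_id : (Hom.id A).tens (Hom.id B) = Hom.id (tensorObj A B) :=
  Hom.ext_tensor fun x y => by simp

theorem tens_comp_tens {A' B' A'' B'' : Cond m} (f : Hom A A') (g : Hom B B') (f' : Hom A' A'')
    (g' : Hom B' B'') : (f.tens g).comp (f'.tens g') = (f.comp f').tens (g.comp g') :=
  Hom.ext_tensor fun x y => by simp

theorem assoc_naturality {A' B' C' : Cond m} (f : Hom A A') (g : Hom B B') (h : Hom C C') :
    ((f.tens g).tens h).comp (Hom.assoc A' B' C') =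
      (Hom.assoc A B C).comp (f.tens (g.tens h)) :=
  Hom.ext_tensor₃ fun x y z => by simp

theorem unitLeft_naturality (f : Hom A B) :
    ((Hom.id (unitObj m)).tens f).comp (Hom.unitLeft B) = (Hom.unitLeft A).comp f :=
  Hom.ext_unit_left fun x => by simp

theorem unitRight_naturality (f : Hom A B) :
    (f.tens (Hom.id (unitObj m))).comp (Hom.unitRight B) = (Hom.unitRight A).comp f :=
  Hom.ext_unit_right fun x => by simp

theorem assoc_pentagon (A B C D : Cond m) :
    ((Hom.assoc A B C).tens (Hom.id D)).comp ((Hom.assoc A (tensorObj B C) D).comp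
      ((Hom.id A).tens (Hom.assoc B C D))) =
      (Hom.assoc (tensorObj A B) C D).comp (Hom.assoc A B (tensorObj C D)) :=
  Hom.ext_tensor₄ fun x y z w => by simp

theorem assoc_triangle (A B : Cond m) :
    (Hom.assoc A (unitObj m) B).comp ((Hom.id A).tens (Hom.unitLeft B)) =
      (Hom.unitRight A).tens (Hom.id B) :=
  Hom.ext_unit_middle fun x y => by simp

/-- The monoidal structure given by the tensor product of conducts. -/
@[reducible] noncomputable def monoidal (m : Weight → ℝ≥0∞) : MonoidalCategory (condCat m).Obj :=
  letI := monoidalStruct m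
  MonoidalCategory.ofTensorHom
    (id_tensorHom_id := fun _ _ => tens_id_id)
    (id_tensorHom := fun _ _ _ _ => rfl)
    (tensorHom_id := fun _ _ => rfl)
    (tensorHom_comp_tensorHom := fun f g f' g' => tens_comp_tens (m := m) f g f' g')
    (associator_naturality := fun f g h => assoc_naturality (m := m) f g h)
    (leftUnitor_naturality := fun f => unitLeft_naturality (m := m) f)
    (rightUnitor_naturality := fun f => unitRight_naturality (m := m) f)
    (pentagon := fun A B C D => assoc_pentagon (m := m) A B C D)
    (triangle := fun A B => assoc_triangle (m := m) A B)

theorem swap_swap (A B : Cond m) : (Hom.swap A B).comp (Hom.swap B A) = Hom.id _ :=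
  Hom.ext_tensor fun x y => by simp

theorem swap_naturality {A' B' : Cond m} (f : Hom A A') (g : Hom B B') :
    (f.tens g).comp (Hom.swap A' B') = (Hom.swap A B).comp (g.tens f) :=
  Hom.ext_tensor fun x y => by simp

theorem swap_hexagon (A B C : Cond m) :
    (Hom.assoc A B C).comp ((Hom.swap A (tensorObj B C)).comp (Hom.assoc B C A)) =
      ((Hom.swap A B).tens (Hom.id C)).comp ((Hom.assoc B A C).comp
        ((Hom.id B).tens (Hom.swap A C))) :=
  Hom.ext_tensor₃ fun x y z => by simp

theorem swap_hexagon' (A B C : Cond m) :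
    (Hom.assocInv A B C).comp ((Hom.swap (tensorObj A B) C).comp (Hom.assocInv C A B)) =
      ((Hom.id A).tens (Hom.swap B C)).comp ((Hom.assocInv A C B).comp
        ((Hom.swap A C).tens (Hom.id B))) :=
  Hom.ext_tensor₃' fun x y z => by simp

/-- The symmetry that exchanges the two factors. -/
@[reducible] noncomputable def symmetric (m : Weight → ℝ≥0∞) :
    letI := monoidal m
    SymmetricCategory (condCat m).Obj :=
  letI := monoidal m
  { braiding := fun A B => mkIso (m := m) (Hom.swap A B) (Hom.swap B A) (swap_swap A B)
      (swap_swap B A)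
    braiding_naturality_right := fun A _ _ f => swap_naturality (m := m) (Hom.id A) f
    braiding_naturality_left := fun f A => swap_naturality (m := m) f (Hom.id A)
    hexagon_forward := fun A B C => swap_hexagon (m := m) A B C
    hexagon_reverse := fun A B C => swap_hexagon' (m := m) A B C
    symmetry := fun A B => swap_swap (m := m) A B }

/-- The internal hom. -/
@[reducible] noncomputable def closed (m : Weight → ℝ≥0∞) :
    letI := monoidal m
    MonoidalClosed (condCat m).Obj :=
  letI := monoidal m
  monoidalClosedOfEquiv (C := (condCat m).Obj) (lolliObj (m := m))
    (fun A B C => curryEquiv (m := m) A B C)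
    (fun _ _ _ _ f g => curry_comp (m := m) f g)

theorem curry_ev (A C : (condCat m).Obj) :
    letI := monoidal m
    letI := closed m
    Hom.curry (m := m) (A := A) (B := lolliObj (m := m) A C) (C := C) ((ihom.ev A).app C) =
      Hom.id (m := m) (lolliObj (m := m) A C) := by
  let _ := monoidal m
  let _ := closed m
  have h1 : MonoidalClosed.curry ((ihom.ev A).app C) = 𝟙 ((ihom A).obj C) := by
    rw [← MonoidalClosed.uncurry_id_eq_ev, MonoidalClosed.curry_uncurry]
  exact (curry_monoidalClosedOfEquiv _ _ _ _).symm.trans h1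

theorem isDualizing_counitObj (m : Weight → ℝ≥0∞) :
    letI := monoidal m
    letI := symmetric m
    letI := closed m
    IsDualizing ((condCat m).obj (counitObj m)) := by
  let _ := monoidal m
  let _ := symmetric m
  let _ := closed m
  intro A
  obtain ⟨k, hk, hk'⟩ := exists_double_dual_inverse (m := m) A _ (curry_ev A (counitObj m))
  have h1 := curry_monoidalClosedOfEquiv (C := (condCat m).Obj) (lolliObj (m := m))
    (fun A B C => curryEquiv (m := m) A B C) (fun _ _ _ _ f g => curry_comp (m := m) f g)
    ((β_ ((ihom A).obj ((condCat m).obj (counitObj m))) A).hom ≫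
      (ihom.ev A).app ((condCat m).obj (counitObj m)))
  refine ⟨⟨k, ?_, ?_⟩⟩
  · refine (congrArg (fun h => Hom.comp (m := m) h k) h1).trans hk
  · refine (congrArg (fun h => Hom.comp (m := m) k h) h1).trans hk'

theorem tens_mk {A' B' : Cond m} (f g : Project Two) (hf : f ∈ HomSet A A')
    (hg : g ∈ HomSet B B') :
    ∃ h : tensorProject m f g ∈ HomSet (tensorObj A B) (tensorObj A' B'),
      (Hom.mk f hf).tens (Hom.mk g hg) = Hom.mk (tensorProject m f g) h := by
  have h : tensorProject m f g ∈ HomSet (tensorObj A B) (tensorObj A' B') :=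
    mem_homSet.2 (by
      rw [mk_tensorProject]
      exact isHom_tens (mem_homSet.1 hf) (mem_homSet.1 hg))
  refine ⟨h, Hom.ext_tensor fun x y => ?_⟩
  rw [app_tens, mk_eq_homMk, mk_eq_homMk, mk_eq_homMk, homMk_congr (mk_tensorProject f g) _
    (isHom_tens (mem_homSet.1 hf) (mem_homSet.1 hg)), app_homMk_tens]

theorem starAutonomous (m : Weight → ℝ≥0∞) : Nonempty (condCat m).StarAutonomous := by
  refine ⟨{
    monoidal := monoidal m
    symmetric := symmetric m
    closed := closed m
    tensorObj_eq := fun A B => rfl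
    tensorHom_eq := fun f g hf hg => ?_
    unit_eq := rfl
    ihom_eq := fun A B => rfl
    lolli_eq := lolliObj_projects
    dualizing := isDualizing_counitObj m
    dual_iso := fun A => ?_ }⟩
  · obtain ⟨h, hh⟩ := tens_mk f g hf hg
    refine ⟨h, ?_⟩
    exact hh.trans (eqToHom_comp_eqToHom_self ((condCat m).hom (tensorProject m f g) h)).symm
  · obtain ⟨h, k, hk, kh⟩ := exists_dual_iso A
    exact ⟨mkIso h k hk kh⟩

end Cond

end IG

namespace IG

open Conduct Proj

/-! ### Behaviours -/

namespace Proj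

variable {m : Weight → ℝ≥0∞} {L : Type}

/-- The project `x + r 0`. -/
noncomputable def shift (x : Proj m L) (r : ℝ) : Proj m L :=
  mk m ((exists_rep x).choose.addSmul r (Project.zero _) rfl)

theorem carrier_shift (x : Proj m L) (r : ℝ) : (x.shift r).carrier = x.carrier := by
  conv_rhs => rw [← (exists_rep x).choose_spec]
  rfl

theorem sca_mk_addSmul (a : Project L) (r : ℝ) (y : Proj m L) :
    (mk m (a.addSmul r (Project.zero a.carrier) rfl)).sca y =
      (mk m a).sca y + mulTop r y.wager := by
  obtain ⟨c, rfl⟩ := exists_rep y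
  refine (Project.sca_addSmul m a r (Project.zero a.carrier) rfl c).trans ?_
  have : (Project.zero a.carrier).sca m c = (mk m c).wager := zero_sca (m := m) (mk m c)
  rw [this]
  rfl

theorem sca_shift (x : Proj m L) (r : ℝ) (y : Proj m L) :
    (x.shift r).sca y = x.sca y + mulTop r y.wager := by
  conv_rhs => rw [← (exists_rep x).choose_spec]
  exact sca_mk_addSmul _ r y

theorem unit_shift (x : Proj m L) (r : ℝ) : (x.shift r).unit = x.unit + r := by
  conv_rhs => rw [← (exists_rep x).choose_spec]
  refine (Fintype.sum_sum_type _).trans ?_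
  congr 1
  change ∑ _ : Unit, r * 1 = r
  simp

theorem wager_shift (x : Proj m L) (r : ℝ) : (x.shift r).wager = x.wager := by
  have := sca_shift x r (zero m x.carrier)
  rwa [sca_zero, sca_zero, wager_zero, mulTop_zero_right, add_zero] at this

end Proj

theorem eq_zero_of_forall_add_mulTop {s w : WithTop ℝ}
    (h : ∀ r : ℝ, s + mulTop r w ≠ 0 ∧ s + mulTop r w ≠ ⊤) : w = 0 := by
  induction w using WithTop.recTopCoe with
  | top => exact absurd (by rw [mulTop_top, add_top]) (h 0).2
  | coe w =>
  induction s using WithTop.recTopCoe with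
  | top => exact absurd (top_add _) (h 0).2
  | coe s =>
  by_contra hw
  have hw' : w ≠ 0 := fun h => hw (by rw [h]; rfl)
  -- the affine function `r ↦ s + r w` vanishes at `-s / w`
  apply (h (-s / w)).1
  rw [mulTop_coe, ← WithTop.coe_add]
  have : s + -s / w * w = 0 := by field_simp; ring
  rw [this]
  rfl

namespace Conduct

variable {m : Weight → ℝ≥0∞} {L L' : Type} {A : Conduct m L}

theorem mem_congr {x x' : Proj m L} (hc : x.carrier = x'.carrier) (h : ∀ y, x.sca y = x'.sca y) :
    x ∈ A ↔ x' ∈ A := by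
  rw [mem_iff, mem_iff (x := x')]
  simp only [Proj.Perp, hc, h]

theorem mk_addSmul_mem {a : Project L} {r : ℝ} :
    a.addSmul r (Project.zero a.carrier) rfl ∈ A.projects ↔ (Proj.mk m a).shift r ∈ A := by
  rw [← mk_mem]
  refine mem_congr ((carrier_shift (Proj.mk m a) r).symm) fun y => ?_
  rw [sca_mk_addSmul, sca_shift]

theorem forall_addSmul_mem {r : ℝ} :
    (∀ a ∈ A.projects, a.addSmul r (Project.zero a.carrier) rfl ∈ A.projects) ↔
      ∀ x ∈ A, x.shift r ∈ A := by
  constructor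
  · rintro h _ ⟨a, ha, rfl⟩
    exact mk_addSmul_mem.1 (h a ha)
  · exact fun h a ha => mk_addSmul_mem.2 (h _ (mk_mem.2 ha))

theorem shift_mem (h : ∀ y ∈ A.orth, y.wager = 0) {x : Proj m L} (hx : x ∈ A) (r : ℝ) :
    x.shift r ∈ A := by
  refine mem_iff.2 ⟨(carrier_shift x r).trans (carrier_eq_of_mem hx), fun y hy => ?_⟩
  have := perp_of_mem hx hy
  unfold Proj.Perp at this ⊢
  rwa [sca_shift, h y hy, mulTop_zero_right, add_zero]

theorem wager_eq_zero_of_shift_mem {x y : Proj m L} (h : ∀ r : ℝ, x.shift r ∈ A)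
    (hy : y ∈ A.orth) : y.wager = 0 :=
  eq_zero_of_forall_add_mulTop (s := x.sca y) fun r => by
    rw [← sca_shift]
    exact perp_of_mem (h r) hy

/-- Behaviours are the conducts such that, unless `A` or `A^⊥` is empty, all the projects of `A` and
of `A^⊥` have wager `0`. -/
theorem isBehaviour_iff :
    A.IsBehaviour ↔ ∀ x ∈ A, ∀ y ∈ A.orth, x.wager = 0 ∧ y.wager = 0 := by
  unfold IsBehaviour
  simp only [forall_addSmul_mem]
  constructor
  · intro h x hx y hy
    exact ⟨wager_eq_zero_of_shift_mem (A := A.orth) (fun r => (h r).2 y hy) (by rwa [orth_orth]),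
      wager_eq_zero_of_shift_mem (fun r => (h r).1 x hx) hy⟩
  · intro h r
    refine ⟨fun x hx => shift_mem (fun y hy => (h x hx y hy).2) hx r, fun y hy => ?_⟩
    exact shift_mem (fun x hx => (h x (by rwa [orth_orth] at hx) y hy).1) hy r

theorem IsBehaviour.shift_mem (h : A.IsBehaviour) {x : Proj m L} (hx : x ∈ A) (r : ℝ) :
    x.shift r ∈ A :=
  Conduct.shift_mem (fun y hy => (isBehaviour_iff.1 h x hx y hy).2) hx r

theorem IsBehaviour.orth (h : A.IsBehaviour) : A.orth.IsBehaviour := by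
  rw [isBehaviour_iff] at h ⊢
  intro y hy x hx
  rw [orth_orth] at hx
  exact (h x hx y hy).symm

/-- The project `x - 1_x 0`. -/
theorem IsBehaviour.exists_unit_eq_zero (h : A.IsBehaviour) {x : Proj m L} (hx : x ∈ A) :
    ∃ z ∈ A, z.unit = 0 ∧ z.wager = x.wager :=
  ⟨x.shift (-x.unit), h.shift_mem hx _, by rw [unit_shift, add_neg_cancel], wager_shift _ _⟩

/-- The conduct generated by no project is empty: its orthogonal contains a project of wager `∞`,
which is orthogonal to nothing. -/
theorem notMem_of_isGen_empty (h : A.IsGen ∅) (x : Proj m L) : x ∉ A := fun hx => by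
  have h1 : const m A.carrier ⊤ 1 ∈ A.orth := h.mem_orth _ rfl fun _ hs => hs.elim
  apply (perp_of_mem hx h1).2
  rw [Proj.sca_comm, const_sca, mulTop_top, top_add]

/-- If the generators have wager `0`, then the orthogonal is closed under `y ↦ y + r 0`, and so all
the projects have wager `0`, provided that the orthogonal is not empty. -/
theorem IsGen.wager_eq_zero {S : Set (Proj m L)} (hS : A.IsGen S) (h : ∀ s ∈ S, s.wager = 0)
    {y : Proj m L} (hy : y ∈ A.orth) {x : Proj m L} (hx : x ∈ A) : x.wager = 0 := by
  refine wager_eq_zero_of_shift_mem (A := A.orth) (x := y) (fun r => ?_) (by rwa [orth_orth])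
  refine hS.mem_orth _ ((carrier_shift y r).trans (carrier_eq_of_mem (A := A.orth) hy))
    fun s hs => ?_
  have := perp_of_mem (hS.mem s hs) hy
  rw [Proj.perp_comm] at this ⊢
  unfold Proj.Perp at this ⊢
  rwa [sca_shift, h s hs, mulTop_zero_right, add_zero]

theorem notMem_zero {V : Finset L} {x : Proj m L} : x ∉ Conduct.zero m V := by
  rintro ⟨a, ha, -⟩
  exact ha

theorem mem_full {V : Finset L} {x : Proj m L} : x ∈ Conduct.full m V ↔ x.carrier = V := by
  obtain ⟨a, rfl⟩ := exists_rep x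
  rw [mk_mem]
  rfl

theorem notMem_full_orth {V : Finset L} {x : Proj m L} : x ∉ (Conduct.full m V).orth := fun hx => by
  have h : const m V ⊤ 1 ∈ Conduct.full m V := mem_full.2 rfl
  apply (perp_of_mem h hx).2
  rw [const_sca, mulTop_top, top_add]

theorem eq_full_of_orth_empty (h : ∀ y, y ∉ A.orth) {x : Proj m L} (hx : x.carrier = A.carrier) :
    x ∈ A :=
  mem_iff.2 ⟨hx, fun y hy => absurd hy (h y)⟩

theorem isBehaviour_zero (V : Finset L) : (Conduct.zero m V).IsBehaviour :=
  isBehaviour_iff.2 fun _ hx => absurd hx notMem_zero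

theorem isBehaviour_full (V : Finset L) : (Conduct.full m V).IsBehaviour :=
  isBehaviour_iff.2 fun _ _ _ hy => absurd hy notMem_full_orth

theorem IsProper.wager_eq_zero (h : A.IsProper) {x : Proj m L} (hx : x ∈ A) : x.wager = 0 := by
  obtain ⟨a, ha, rfl⟩ := hx
  exact h.2.1 a ha

theorem IsProper.exists_mem (h : A.IsProper) : ∃ x, x ∈ A := nonempty_projects_iff.1 h.2.2

theorem IsProper.isBehaviour (h : A.IsProper) : A.IsBehaviour := by
  refine isBehaviour_iff.2 fun x hx y hy => ⟨h.wager_eq_zero hx, ?_⟩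
  exact wager_eq_zero_of_shift_mem (fun r => forall_addSmul_mem.1 (fun a ha => h.1 a ha r) x hx) hy

/-- The orthogonal of a proper behaviour is not empty: otherwise, there would be projects of
nonzero wager. -/
theorem IsProper.exists_mem_orth (h : A.IsProper) : ∃ y, y ∈ A.orth := by
  by_contra! hy
  have := h.wager_eq_zero (eq_full_of_orth_empty hy (x := const m A.carrier ⊤ 1) rfl)
  exact absurd this (by simp)

theorem IsProper.exists_mem_orth_unit_eq_zero (h : A.IsProper) :
    ∃ y ∈ A.orth, y.unit = 0 ∧ y.wager = 0 := by
  obtain ⟨y, hy⟩ := h.exists_mem_orth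
  obtain ⟨x, hx⟩ := h.exists_mem
  obtain ⟨z, hz, h1, h2⟩ := h.isBehaviour.orth.exists_unit_eq_zero hy
  exact ⟨z, hz, h1, h2.trans (isBehaviour_iff.1 h.isBehaviour x hx y hy).2⟩

end Conduct

namespace Proj

variable {m : Weight → ℝ≥0∞}

theorem wager_tp (a b : Proj m ℕ) :
    (tp a b).wager = mulTop b.unit a.wager + mulTop a.unit b.wager := by
  rw [tp, wager_mul, sca_of_disjoint (by simpa using disjoint_ev_od _ _)]
  simp

theorem sca_tp (a b a' b' : Proj m ℕ) :
    (tp a b).sca (tp a' b') =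
      mulTop (b.unit * b'.unit) (a.sca a') + mulTop (a.unit * a'.unit) (b.sca b') := by
  have h1 : Disjoint (a.map ev).carrier (b.map od).carrier := by simpa using disjoint_ev_od _ _
  have h2 : Disjoint (a'.map ev).carrier (b'.map od).carrier := by simpa using disjoint_ev_od _ _
  have h3 : Disjoint (a.map ev).carrier (b'.map od).carrier := by simpa using disjoint_ev_od _ _
  rw [← wager_mul, tp, tp, mul_mul_mul_comm' h1 h2 h3, ← map_mul_of_injective ev_injective,
    ← map_mul_of_injective od_injective, wager_mul, sca_of_disjoint]
  · simp only [unit_map, wager_map, unit_mul, wager_mul]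
  · simpa using disjoint_ev_od _ _

theorem tp_zero_zero (V W : Finset ℕ) :
    tp (zero m V) (zero m W) = zero m (V.image ev ∪ W.image od) := by
  rw [tp, map_zero, map_zero, zero_mul_zero, (disjoint_ev_od _ _).symmDiff_eq_sup]
  rfl

end Proj

namespace Cond

variable {m : Weight → ℝ≥0∞} {A B C D : Cond m}

/-! ### Closure of behaviours under the multiplicative connectives -/

theorem exists_of_mem_tensorObj {x : Proj m ℕ} (hx : x ∈ tensorObj A B) :
    (∃ a, a ∈ A) ∧ ∃ b, b ∈ B := by
  by_contra h
  refine notMem_of_isGen_empty ?_ x hx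
  convert isGen_tensorObj_self A B using 1
  refine (Set.eq_empty_of_forall_notMem ?_).symm
  rintro _ ⟨a, ha, b, hb, -⟩
  exact h ⟨⟨a, ha⟩, b, hb⟩

theorem exists_mem_orth_left {y b : Proj m ℕ} (hy : y ∈ (tensorObj A B).orth) (hb : b ∈ B) :
    ∃ d ∈ A.orth, ∀ a : Proj m ℕ, (tp a b).sca y = a.sca d := by
  have hc : y.carrier = A.carrier.image ev ∪ B.carrier.image od := by
    rw [← carrier_tensorObj]
    exact carrier_eq_of_mem (A := (tensorObj A B).orth) hy
  obtain ⟨d, hd, hd'⟩ := exists_sca_tp_left hc (carrier_eq_of_mem hb)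
  refine ⟨d, mem_orth.2 ⟨hd, fun a ha => ?_⟩, hd'⟩
  have := perp_of_mem (tp_mem ha hb) hy
  unfold Perp at this ⊢
  rwa [← hd']

theorem exists_mem_orth_right {y a : Proj m ℕ} (hy : y ∈ (tensorObj A B).orth) (ha : a ∈ A) :
    ∃ d ∈ B.orth, ∀ b : Proj m ℕ, (tp a b).sca y = b.sca d := by
  have hc : y.carrier = A.carrier.image ev ∪ B.carrier.image od := by
    rw [← carrier_tensorObj]
    exact carrier_eq_of_mem (A := (tensorObj A B).orth) hy
  obtain ⟨d, hd, hd'⟩ := exists_sca_tp_right hc (carrier_eq_of_mem ha)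
  refine ⟨d, mem_orth.2 ⟨hd, fun b hb => ?_⟩, hd'⟩
  have := perp_of_mem (tp_mem ha hb) hy
  unfold Perp at this ⊢
  rwa [← hd']

theorem isBehaviour_tensorObj (hA : A.IsBehaviour) (hB : B.IsBehaviour) :
    (tensorObj A B).IsBehaviour := by
  rw [isBehaviour_iff]
  intro x hx y hy
  obtain ⟨⟨a, ha⟩, b, hb⟩ := exists_of_mem_tensorObj hx
  obtain ⟨a', ha', -⟩ := exists_mem_orth_left hy hb
  obtain ⟨b', hb', -⟩ := exists_mem_orth_right hy ha
  rw [isBehaviour_iff] at hA hB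
  constructor
  · refine (isGen_tensorObj_self A B).wager_eq_zero ?_ hy hx
    rintro _ ⟨a, ha, b, hb, rfl⟩
    rw [wager_tp, (hA a ha a' ha').1, (hB b hb b' hb').1]
    simp
  · have h1 : ∀ b ∈ B, (tp (Proj.zero m A.carrier) b).sca y = 0 := by
      intro b hb
      obtain ⟨d, hd, hd'⟩ := exists_mem_orth_left hy hb
      rw [hd', zero_sca]
      exact (hA a ha d hd).2
    have hc : y.carrier = A.carrier.image ev ∪ B.carrier.image od := by
      rw [← carrier_tensorObj]
      exact carrier_eq_of_mem (A := (tensorObj A B).orth) hy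
    obtain ⟨e, -, he⟩ := exists_sca_tp_right hc (a := Proj.zero m A.carrier) rfl
    have h2 : e.wager = 0 := by
      have h3 := h1 _ (Conduct.shift_mem (fun y hy => (hB b hb y hy).2) hb 1)
      rwa [he, sca_shift, ← he, h1 b hb, zero_add, mulTop_one] at h3
    rw [← zero_sca (V := B.carrier), ← he, tp_zero_zero, zero_sca] at h2
    exact h2

theorem lolliObj_eq_orth (A B : Cond m) : lolliObj A B = (tensorObj A B.orth).orth := by
  refine ext_of_isGen ?_ (isGen_lolliObj_orth (isGen_self A) (isGen_self _)) ?_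
  · rw [carrier_orth, carrier_lolliObj, carrier_tensorObj, carrier_orth]
  · rw [orth_orth]
    exact isGen_tensorObj_self _ _

theorem isBehaviour_lolliObj (hA : A.IsBehaviour) (hB : B.IsBehaviour) :
    (lolliObj A B).IsBehaviour := by
  rw [lolliObj_eq_orth]
  exact (isBehaviour_tensorObj hA hB.orth).orth

end Cond

end IG

namespace IG

open Conduct Proj

namespace Proj

variable {m : Weight → ℝ≥0∞}

/-! ### Restriction of a project to one of the two factors -/

/-- The restriction to the first factor of a project whose second factor is carried by `W`. -/
noncomputable def resL (W : Finset ℕ) (x : Proj m ℕ) : Proj m ℕ :=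
  (zero m (W.image od) * x).map (· / 2)

/-- The restriction to the second factor of a project whose first factor is carried by `V`. -/
noncomputable def resR (V : Finset ℕ) (x : Proj m ℕ) : Proj m ℕ :=
  (zero m (V.image ev) * x).map (· / 2)

variable {V W U : Finset ℕ} {x : Proj m ℕ}

theorem symmDiff_image_od (V W : Finset ℕ) :
    symmDiff (W.image od) (V.image ev ∪ W.image od) = V.image ev := by
  have := disjoint_ev_od V W
  rw [Finset.disjoint_left] at this
  ext v
  rw [Finset.mem_symmDiff, Finset.mem_union]
  have := @this v
  tauto

theorem symmDiff_image_ev (V W : Finset ℕ) :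
    symmDiff (V.image ev) (V.image ev ∪ W.image od) = W.image od := by
  have := disjoint_ev_od V W
  rw [Finset.disjoint_left] at this
  ext v
  rw [Finset.mem_symmDiff, Finset.mem_union]
  have := @this v
  tauto

theorem map_resL (hx : x.carrier = V.image ev ∪ W.image od) :
    (resL W x).map ev = zero m (W.image od) * x := by
  rw [resL, map_map]
  refine map_eq_self fun v hv => ?_
  rw [carrier_mul, carrier_zero, hx, symmDiff_image_od] at hv
  obtain ⟨u, -, rfl⟩ := Finset.mem_image.1 hv
  exact congrArg ev (congrFun Cond.half_comp_ev u)

theorem map_resR (hx : x.carrier = V.image ev ∪ W.image od) :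
    (resR V x).map od = zero m (V.image ev) * x := by
  rw [resR, map_map]
  refine map_eq_self fun v hv => ?_
  rw [carrier_mul, carrier_zero, hx, symmDiff_image_ev] at hv
  obtain ⟨u, -, rfl⟩ := Finset.mem_image.1 hv
  exact congrArg od (congrFun Cond.half_comp_od u)

theorem carrier_resL (hx : x.carrier = V.image ev ∪ W.image od) : (resL W x).carrier = V := by
  rw [resL, carrier_map, carrier_mul, carrier_zero, hx, symmDiff_image_od, Finset.image_image,
    Cond.half_comp_ev, Finset.image_id]

theorem carrier_resR (hx : x.carrier = V.image ev ∪ W.image od) : (resR V x).carrier = W := by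
  rw [resR, carrier_map, carrier_mul, carrier_zero, hx, symmDiff_image_ev, Finset.image_image,
    Cond.half_comp_od, Finset.image_id]

theorem sca_resL (hx : x.carrier = V.image ev ∪ W.image od) (a : Proj m ℕ) :
    (resL W x).sca a = (tp a (zero m W)).sca x := by
  rw [← sca_map ev_injective.injOn, map_resL hx, sca_comm, ← sca_mul, tp, map_zero]
  intro v hv hv'
  rw [carrier_map] at hv
  exact absurd hv' (Finset.disjoint_left.1 (disjoint_ev_od _ _) hv)

theorem sca_resR (hx : x.carrier = V.image ev ∪ W.image od) (b : Proj m ℕ) :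
    (resR V x).sca b = (tp (zero m V) b).sca x := by
  rw [← sca_map od_injective.injOn, map_resR hx, sca_comm, ← sca_mul, tp, map_zero,
    Proj.mul_comm]
  intro v hv hv'
  rw [carrier_map] at hv
  exact absurd hv (Finset.disjoint_left.1 (disjoint_ev_od _ _) hv')

/-! ### The projections and the injections -/

/-- Associativity for a product with a project that does not share vertices with the first
factor. -/
theorem mul_assoc_of_disjoint {L : Type} [DecidableEq L] {x y z : Proj m L}
    (h : Disjoint x.carrier y.carrier) : x * y * z = x * (y * z) :=
  Proj.mul_assoc fun _ hv hv' => absurd hv' (Finset.disjoint_left.1 h hv)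

theorem disjoint_image_of_ne {K K' L : Type} [DecidableEq L] {S : Finset K} {T : Finset K'}
    {p : K → L} {q : K' → L} (h : ∀ x y, p x ≠ q y) : Disjoint (S.image p) (T.image q) := by
  rw [Finset.disjoint_left]
  rintro _ hx hy
  obtain ⟨x, -, rfl⟩ := Finset.mem_image.1 hx
  obtain ⟨y, -, hxy⟩ := Finset.mem_image.1 hy
  exact h _ _ hxy.symm

theorem ψ_ne (x y : ℕ) : ψ 0 x ≠ ψ 1 y := fun h =>
  absurd (congrArg Prod.snd h) (by simp [ψ])

theorem ψ_ev_ne_od (i j : Fin 2) (x y : ℕ) : ψ i (ev x) ≠ ψ j (od y) := fun h =>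
  ev_ne_od x y (congrArg Prod.fst h)

variable (m V W)

/-- The project of the first projection from a conduct of carrier `V + W`. -/
noncomputable def projL : Proj m Two := fax m V (ψ 0 ∘ ev) (ψ 1) * zero m (W.image (ψ 0 ∘ od))

/-- The project of the second projection. -/
noncomputable def projR : Proj m Two := fax m W (ψ 0 ∘ od) (ψ 1) * zero m (V.image (ψ 0 ∘ ev))

/-- The project of the first injection to a conduct of carrier `V + W`. -/
noncomputable def injL : Proj m Two := fax m V (ψ 0) (ψ 1 ∘ ev) * zero m (W.image (ψ 1 ∘ od))

/-- The project of the second injection. -/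
noncomputable def injR : Proj m Two := fax m W (ψ 0) (ψ 1 ∘ od) * zero m (V.image (ψ 1 ∘ ev))

variable {m V W}

theorem disjoint_projL : Disjoint (fax m V (ψ 0 ∘ ev) (ψ 1)).carrier
    (zero m (W.image (ψ 0 ∘ od))).carrier := by
  rw [carrier_fax, carrier_zero, Finset.disjoint_union_left]
  exact ⟨disjoint_image_of_ne fun x y => ψ_ev_ne_od _ _ x y,
    disjoint_image_of_ne fun x y => (ψ_ne _ x).symm⟩

theorem disjoint_projR : Disjoint (fax m W (ψ 0 ∘ od) (ψ 1)).carrier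
    (zero m (V.image (ψ 0 ∘ ev))).carrier := by
  rw [carrier_fax, carrier_zero, Finset.disjoint_union_left]
  exact ⟨disjoint_image_of_ne fun x y => (ψ_ev_ne_od _ _ y x).symm,
    disjoint_image_of_ne fun x y => (ψ_ne _ x).symm⟩

theorem disjoint_injL : Disjoint (fax m V (ψ 0) (ψ 1 ∘ ev)).carrier
    (zero m (W.image (ψ 1 ∘ od))).carrier := by
  rw [carrier_fax, carrier_zero, Finset.disjoint_union_left]
  exact ⟨disjoint_image_of_ne fun x y => ψ_ne _ _,
    disjoint_image_of_ne fun x y => ψ_ev_ne_od _ _ x y⟩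

theorem disjoint_injR : Disjoint (fax m W (ψ 0) (ψ 1 ∘ od)).carrier
    (zero m (V.image (ψ 1 ∘ ev))).carrier := by
  rw [carrier_fax, carrier_zero, Finset.disjoint_union_left]
  exact ⟨disjoint_image_of_ne fun x y => ψ_ne _ _,
    disjoint_image_of_ne fun x y => (ψ_ev_ne_od _ _ y x).symm⟩

theorem carrier_projL : (projL m V W).carrier = bi (V.image ev ∪ W.image od) V := by
  rw [projL, carrier_mul, disjoint_projL.symmDiff_eq_sup, carrier_fax, carrier_zero, bi,
    Finset.image_union, Finset.image_image, Finset.image_image]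
  exact Finset.union_right_comm _ _ _

theorem carrier_projR : (projR m V W).carrier = bi (V.image ev ∪ W.image od) W := by
  rw [projR, carrier_mul, disjoint_projR.symmDiff_eq_sup, carrier_fax, carrier_zero, bi,
    Finset.image_union, Finset.image_image, Finset.image_image, Finset.union_comm (V.image _)]
  exact Finset.union_right_comm _ _ _

theorem carrier_injL : (injL m V W).carrier = bi V (V.image ev ∪ W.image od) := by
  rw [injL, carrier_mul, disjoint_injL.symmDiff_eq_sup, carrier_fax, carrier_zero, bi,
    Finset.image_union, Finset.image_image, Finset.image_image]
  exact Finset.union_assoc _ _ _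

theorem carrier_injR : (injR m V W).carrier = bi W (V.image ev ∪ W.image od) := by
  rw [injR, carrier_mul, disjoint_injR.symmDiff_eq_sup, carrier_fax, carrier_zero, bi,
    Finset.image_union, Finset.image_image, Finset.image_image, Finset.union_comm (V.image _)]
  exact Finset.union_assoc _ _ _

theorem act_projL (hx : x.carrier = V.image ev ∪ W.image od) : act (projL m V W) x = resL W x := by
  have h1 : zero m (W.image (ψ 0 ∘ od)) * x.map (ψ 0) = (resL W x).map (ψ 0 ∘ ev) := by
    rw [← map_map, map_resL hx, map_mul_of_injective (ψ_injective 0), map_zero, Finset.image_image]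
  rw [act, projL, mul_assoc_of_disjoint disjoint_projL, h1, fax_mul (carrier_resL hx)
    ((ψ_injective 0).comp ev_injective).injOn fun _ _ _ _ => ψ_ne _ _, map_map]
  exact map_eq_self fun _ _ => rfl

theorem act_projR (hx : x.carrier = V.image ev ∪ W.image od) : act (projR m V W) x = resR V x := by
  have h1 : zero m (V.image (ψ 0 ∘ ev)) * x.map (ψ 0) = (resR V x).map (ψ 0 ∘ od) := by
    rw [← map_map, map_resR hx, map_mul_of_injective (ψ_injective 0), map_zero, Finset.image_image]
  rw [act, projR, mul_assoc_of_disjoint disjoint_projR, h1, fax_mul (carrier_resR hx)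
    ((ψ_injective 0).comp od_injective).injOn fun _ _ _ _ => ψ_ne _ _, map_map]
  exact map_eq_self fun _ _ => rfl

theorem map_fst_map_ψ_mul (x y : Proj m ℕ) : (x.map (ψ 1) * y.map (ψ 1)).map Prod.fst = x * y := by
  rw [← map_mul_of_injective (ψ_injective 1), map_map]
  exact map_eq_self fun _ _ => rfl

theorem act_injL {a : Proj m ℕ} (ha : a.carrier = V) :
    act (injL m V W) a = tp a (zero m W) := by
  rw [act, injL, Proj.mul_comm (fax _ _ _ _), mul_assoc_of_disjoint disjoint_injL.symm,
    fax_mul (q := ψ 1 ∘ ev) ha (ψ_injective 0).injOn fun _ _ _ _ => ψ_ne _ _, Proj.mul_comm,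
    ← Finset.image_image, ← map_zero, ← map_map, map_fst_map_ψ_mul, ← map_zero, tp]

theorem act_injR {b : Proj m ℕ} (hb : b.carrier = W) :
    act (injR m V W) b = tp (zero m V) b := by
  rw [act, injR, Proj.mul_comm (fax _ _ _ _), mul_assoc_of_disjoint disjoint_injR.symm,
    fax_mul (q := ψ 1 ∘ od) hb (ψ_injective 0).injOn fun _ _ _ _ => ψ_ne _ _, ← Finset.image_image,
    ← map_zero, ← map_map, map_fst_map_ψ_mul, ← map_zero, tp]

end Proj

namespace Cond

variable {m : Weight → ℝ≥0∞} {A B C D : Cond m}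

/-! ### The additive connectives -/

@[simp] theorem carrier_ampObj (A B : Cond m) :
    (ampObj A B).carrier = A.carrier.image ev ∪ B.carrier.image od :=
  carrier_tensorObj A B

@[simp] theorem carrier_plusObj (A B : Cond m) :
    (plusObj A B).carrier = A.carrier.image ev ∪ B.carrier.image od :=
  carrier_tensorObj A B

/-- The generators of `A ⊕ B`. -/
def upGen (A B : Cond m) : Set (Proj m ℕ) :=
  {x | (∃ a ∈ A, x = tp a (Proj.zero m B.carrier)) ∨ ∃ b ∈ B, x = tp (Proj.zero m A.carrier) b}

theorem mk_up_left (a : Project ℕ) (W : Finset ℕ) :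
    (Proj.mk m ((a.map (ψ 0)).tensor m (Project.zero (W.image (ψ 1))))).map φ =
      tp (Proj.mk m a) (Proj.zero m W) := by
  change ((Proj.mk m a).map (ψ 0) * Proj.zero m (W.image (ψ 1))).map φ = _
  rw [← Proj.map_zero, map_mul_of_injective φ_injective, map_map, map_map]
  rfl

theorem mk_up_right (b : Project ℕ) (V : Finset ℕ) :
    (Proj.mk m ((b.map (ψ 1)).tensor m (Project.zero (V.image (ψ 0))))).map φ =
      tp (Proj.zero m V) (Proj.mk m b) := by
  change ((Proj.mk m b).map (ψ 1) * Proj.zero m (V.image (ψ 0))).map φ = _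
  rw [← Proj.map_zero, map_mul_of_injective φ_injective, map_map, map_map, Proj.mul_comm]
  rfl

theorem image_up (A B : Cond m) :
    Proj.map φ '' {x | ∃ c ∈ (copy 0 A).up (copy 1 B).carrier ∪ (copy 1 B).up (copy 0 A).carrier,
      Proj.mk m c = x} = upGen A B := by
  ext x
  constructor
  · rintro ⟨_, ⟨_, ⟨_, ⟨a, ha, rfl⟩, rfl⟩ | ⟨_, ⟨b, hb, rfl⟩, rfl⟩, rfl⟩, rfl⟩
    · exact Or.inl ⟨_, mk_mem.2 ha, mk_up_left a _⟩
    · exact Or.inr ⟨_, mk_mem.2 hb, mk_up_right b _⟩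
  · rintro (⟨_, ⟨a, ha, rfl⟩, rfl⟩ | ⟨_, ⟨b, hb, rfl⟩, rfl⟩)
    · exact ⟨_, ⟨_, Or.inl ⟨_, ⟨a, ha, rfl⟩, rfl⟩, rfl⟩, mk_up_left a _⟩
    · exact ⟨_, ⟨_, Or.inr ⟨_, ⟨b, hb, rfl⟩, rfl⟩, rfl⟩, mk_up_right b _⟩

theorem carrier_up {c : Project Two}
    (hc : c ∈ (copy 0 A).up (copy 1 B).carrier ∪ (copy 1 B).up (copy 0 A).carrier) :
    c.carrier = (copy 0 A).carrier ∪ (copy 1 B).carrier := by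
  rcases hc with ⟨a, ha, rfl⟩ | ⟨b, hb, rfl⟩
  · exact Project.cut_carrier m (disjoint_ψ _ _) (Conduct.carrier_eq _ ha) rfl
  · rw [Finset.union_comm]
    exact Project.cut_carrier m (disjoint_ψ _ _).symm (Conduct.carrier_eq _ hb) rfl

theorem isGen_plusObj (A B : Cond m) : (plusObj A B).IsGen (upGen A B) := by
  rw [← image_up]
  refine isGen_deloc φ_injective ?_
  constructor
  · rintro _ ⟨c, hc, rfl⟩
    refine mk_mem.2 (subset_orthSet_orthSet m _ ?_ ?_)
    · rintro a (ha | ha)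
      · exact Conduct.carrier_eq _ ha
      · exact Conduct.carrier_eq _ ha
    · rcases hc with hc | hc
      · exact Or.inl (subset_orthSet_orthSet m _ (fun a ha => carrier_up (Or.inl ha)) hc)
      · exact Or.inr (subset_orthSet_orthSet m _ (fun a ha => carrier_up (Or.inr ha)) hc)
  · intro y hy h
    obtain ⟨b, rfl⟩ := exists_rep y
    refine mem_orth.2 ⟨hy, ?_⟩
    rintro _ ⟨a, ha, rfl⟩
    refine Project.perp_comm m _ _ |>.1 (ha.2 b ⟨hy, ?_⟩)
    rintro c (hc | hc)
    · exact Project.perp_comm m _ _ |>.1 (hc.2 b ⟨hy, fun d hd => h _ ⟨d, Or.inl hd, rfl⟩⟩)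
    · exact Project.perp_comm m _ _ |>.1 (hc.2 b ⟨hy, fun d hd => h _ ⟨d, Or.inr hd, rfl⟩⟩)

theorem isGen_ampObj_orth (A B : Cond m) : (ampObj A B).orth.IsGen (upGen A.orth B.orth) := by
  rw [← image_up, ampObj, deloc_orth]
  have h1 : copy 0 A.orth = (copy 0 A).orth := (deloc_orth _ _).symm
  have h2 : copy 1 B.orth = (copy 1 B).orth := (deloc_orth _ _).symm
  rw [h1, h2]
  refine isGen_deloc φ_injective ?_
  constructor
  · rintro _ ⟨c, hc, rfl⟩
    refine mk_mem.2 ⟨?_, fun f hf => ?_⟩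
    · have := carrier_up (A := A.orth) (B := B.orth) (c := c) (by rwa [h1, h2])
      rwa [h1, h2] at this
    · rw [Project.perp_comm]
      rcases hc with hc | hc
      exacts [hf.1.2 _ hc, hf.2.2 _ hc]
  · intro y hy h
    obtain ⟨b, rfl⟩ := exists_rep y
    rw [orth_orth, mk_mem]
    exact ⟨⟨hy, fun c hc => h _ ⟨c, Or.inl hc, rfl⟩⟩, ⟨hy, fun c hc => h _ ⟨c, Or.inr hc, rfl⟩⟩⟩

theorem plusObj_eq_orth (A B : Cond m) : plusObj A B = (ampObj A.orth B.orth).orth := by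
  refine ext_of_isGen (S := {x | x ∈ (plusObj A B).orth}) ?_ (isGen_self _) ?_
  · rw [carrier_orth, carrier_plusObj, carrier_ampObj, carrier_orth, carrier_orth]
  · have h : (plusObj A B).orth = ampObj A.orth B.orth := by
      refine ext_of_isGen (S := upGen A B) ?_ ?_ ?_
      · rw [carrier_orth, carrier_plusObj, carrier_ampObj, carrier_orth, carrier_orth]
      · rw [orth_orth]
        exact isGen_plusObj A B
      · have := isGen_ampObj_orth A.orth B.orth
        rwa [orth_orth, orth_orth] at this
    rw [orth_orth, ← h]
    exact isGen_self _

theorem carrier_eq_of_mem_ampObj {x : Proj m ℕ} (hx : x ∈ ampObj A B) :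
    x.carrier = A.carrier.image ev ∪ B.carrier.image od := by
  rw [← carrier_ampObj]
  exact carrier_eq_of_mem hx

theorem resL_mem {x : Proj m ℕ} (hx : x ∈ ampObj A B) : resL B.carrier x ∈ A := by
  have hc := carrier_eq_of_mem_ampObj hx
  refine mem_iff.2 ⟨carrier_resL hc, fun a ha => ?_⟩
  unfold Perp
  rw [sca_resL hc]
  exact perp_comm.1 (perp_of_mem hx ((isGen_ampObj_orth A B).mem _ (Or.inl ⟨a, ha, rfl⟩)))

theorem resR_mem {x : Proj m ℕ} (hx : x ∈ ampObj A B) : resR A.carrier x ∈ B := by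
  have hc := carrier_eq_of_mem_ampObj hx
  refine mem_iff.2 ⟨carrier_resR hc, fun b hb => ?_⟩
  unfold Perp
  rw [sca_resR hc]
  exact perp_comm.1 (perp_of_mem hx ((isGen_ampObj_orth A B).mem _ (Or.inr ⟨b, hb, rfl⟩)))

theorem wager_resL {x : Proj m ℕ} (hc : x.carrier = A.carrier.image ev ∪ B.carrier.image od) :
    (resL B.carrier x).wager = x.wager := by
  rw [← sca_zero (V := A.carrier), sca_resL hc, tp_zero_zero, zero_sca]

theorem wager_resR {x : Proj m ℕ} (hc : x.carrier = A.carrier.image ev ∪ B.carrier.image od) :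
    (resR A.carrier x).wager = x.wager := by
  rw [← sca_zero (V := B.carrier), sca_resR hc, tp_zero_zero, zero_sca]

theorem wager_tp_zero_right (a : Proj m ℕ) (W : Finset ℕ) :
    (tp a (Proj.zero m W)).wager = a.wager := by
  rw [wager_tp, wager_zero, mulTop_zero_right, add_zero, unit_zero, mulTop_one]

theorem wager_tp_zero_left (b : Proj m ℕ) (V : Finset ℕ) :
    (tp (Proj.zero m V) b).wager = b.wager := by
  rw [wager_tp, wager_zero, mulTop_zero_right, zero_add, unit_zero, mulTop_one]

theorem isBehaviour_ampObj (hA : A.IsBehaviour) (hB : B.IsBehaviour) :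
    (ampObj A B).IsBehaviour := by
  rw [isBehaviour_iff] at hA hB ⊢
  intro x hx y hy
  have hc := carrier_eq_of_mem_ampObj hx
  constructor
  · by_cases h : ∃ a, a ∈ A.orth
    · obtain ⟨a, ha⟩ := h
      rw [← wager_resL hc]
      exact (hA _ (resL_mem hx) a ha).1
    by_cases h' : ∃ b, b ∈ B.orth
    · obtain ⟨b, hb⟩ := h'
      rw [← wager_resR hc]
      exact (hB _ (resR_mem hx) b hb).1
    refine absurd hy (notMem_of_isGen_empty ?_ y)
    convert isGen_ampObj_orth A B using 1
    refine (Set.eq_empty_of_forall_notMem ?_).symm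
    rintro _ (⟨a, ha, -⟩ | ⟨b, hb, -⟩)
    exacts [h ⟨a, ha⟩, h' ⟨b, hb⟩]
  · refine (isGen_ampObj_orth A B).wager_eq_zero ?_ (by rwa [orth_orth]) hy
    rintro _ (⟨a, ha, rfl⟩ | ⟨b, hb, rfl⟩)
    · rw [carrier_orth, wager_tp_zero_right]
      exact (hA _ (resL_mem hx) a ha).2
    · rw [carrier_orth, wager_tp_zero_left]
      exact (hB _ (resR_mem hx) b hb).2

theorem isBehaviour_plusObj (hA : A.IsBehaviour) (hB : B.IsBehaviour) :
    (plusObj A B).IsBehaviour := by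
  rw [plusObj_eq_orth]
  exact (isBehaviour_ampObj hA.orth hB.orth).orth

theorem isHom_projL (A B : Cond m) : IsHom (ampObj A B) A (projL m A.carrier B.carrier) :=
  ⟨by rw [carrier_projL, carrier_ampObj], fun x hx => by
    rw [act_projL (carrier_eq_of_mem_ampObj hx)]
    exact resL_mem hx⟩

theorem isHom_projR (A B : Cond m) : IsHom (ampObj A B) B (projR m A.carrier B.carrier) :=
  ⟨by rw [carrier_projR, carrier_ampObj], fun x hx => by
    rw [act_projR (carrier_eq_of_mem_ampObj hx)]
    exact resR_mem hx⟩

theorem isHom_injL (A B : Cond m) : IsHom A (plusObj A B) (injL m A.carrier B.carrier) :=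
  ⟨by rw [carrier_injL, carrier_plusObj], fun a ha => by
    rw [act_injL (carrier_eq_of_mem ha)]
    exact (isGen_plusObj A B).mem _ (Or.inl ⟨a, ha, rfl⟩)⟩

theorem isHom_injR (A B : Cond m) : IsHom B (plusObj A B) (injR m A.carrier B.carrier) :=
  ⟨by rw [carrier_injR, carrier_plusObj], fun b hb => by
    rw [act_injR (carrier_eq_of_mem hb)]
    exact (isGen_plusObj A B).mem _ (Or.inr ⟨b, hb, rfl⟩)⟩

end Cond

end IG

namespace IG

open Conduct Proj

namespace Cond

variable {m : Weight → ℝ≥0∞} {A B C D : Cond m}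

/-! ### Products and coproducts of behaviours -/

theorem sca_tp_zero_right (a a' : Proj m ℕ) (W : Finset ℕ) :
    (tp a (Proj.zero m W)).sca (tp a' (Proj.zero m W)) = a.sca a' := by
  simp [sca_tp]

theorem sca_tp_zero_left (b b' : Proj m ℕ) (V : Finset ℕ) :
    (tp (Proj.zero m V) b).sca (tp (Proj.zero m V) b') = b.sca b' := by
  simp [sca_tp]

theorem sca_tp_zero_zero {a b : Proj m ℕ} (ha : a.wager = 0) (hb : b.wager = 0) (V W : Finset ℕ) :
    (tp a (Proj.zero m W)).sca (tp (Proj.zero m V) b) = 0 := by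
  simp [sca_tp, ha, hb]

theorem sca_act_add {F G H : Proj m Two} (hF : F.carrier = bi A.carrier B.carrier)
    (hG : G.carrier = bi A.carrier B.carrier) (hH : H.carrier = bi A.carrier B.carrier)
    (h : ∀ w, H.sca w = F.sca w + mulTop 1 (G.sca w)) {a : Proj m ℕ} (ha : a.carrier = A.carrier)
    (b : Proj m ℕ) : (act H a).sca b = (act F a).sca b + (act G a).sca b := by
  rw [sca_act hF ha, sca_act hG ha, sca_act hH ha, h, mulTop_one]

/-- The pairing of `F` and `G` is the sum of their compositions with the injections: the cross terms
are measurements of `0` against projects of wager `0`. If `A^⊥` or `B^⊥` is empty, one of the two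
summands is taken. -/
theorem exists_pair (hA : A.IsBehaviour) (hB : B.IsBehaviour) {F G : Proj m Two}
    (hF : IsHom C A F) (hG : IsHom C B G) : ∃ H, IsHom C (ampObj A B) H ∧ ∀ c ∈ C,
      (∀ a ∈ A.orth, (act H c).sca (tp a (Proj.zero m B.carrier)) = (act F c).sca a) ∧
      ∀ b ∈ B.orth, (act H c).sca (tp (Proj.zero m A.carrier) b) = (act G c).sca b := by
  rw [isBehaviour_iff] at hA hB
  suffices h : ∃ H : Proj m Two, H.carrier = bi C.carrier (ampObj A B).carrier ∧ ∀ c ∈ C,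
      (∀ a ∈ A.orth, (act H c).sca (tp a (Proj.zero m B.carrier)) = (act F c).sca a) ∧
      ∀ b ∈ B.orth, (act H c).sca (tp (Proj.zero m A.carrier) b) = (act G c).sca b by
    obtain ⟨H, hH, h⟩ := h
    refine ⟨H, isHom_of_gen (isGen_self C) (isGen_ampObj_orth A B) hH ?_, h⟩
    rintro c hc _ (⟨a, ha, rfl⟩ | ⟨b, hb, rfl⟩)
    · have := perp_of_mem (hF.act_mem c hc) ha
      unfold Perp at this ⊢
      rwa [← (h c hc).1 a ha] at this
    · have := perp_of_mem (hG.act_mem c hc) hb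
      unfold Perp at this ⊢
      rwa [← (h c hc).2 b hb] at this
  have hiL := carrier_injL (m := m) (V := A.carrier) (W := B.carrier)
  have hiR := carrier_injR (m := m) (V := A.carrier) (W := B.carrier)
  have hl : ∀ c ∈ C, act (comp F (injL m A.carrier B.carrier)) c =
      tp (act F c) (Proj.zero m B.carrier) := fun c hc => by
    rw [act_comp hF.carrier hiL (carrier_eq_of_mem hc),
      act_injL (carrier_eq_of_mem (hF.act_mem c hc))]
  have hr : ∀ c ∈ C, act (comp G (injR m A.carrier B.carrier)) c =
      tp (Proj.zero m A.carrier) (act G c) := fun c hc => by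
    rw [act_comp hG.carrier hiR (carrier_eq_of_mem hc),
      act_injR (carrier_eq_of_mem (hG.act_mem c hc))]
  have hlc : (comp F (injL m A.carrier B.carrier)).carrier =
      bi C.carrier (ampObj A B).carrier := by
    rw [carrier_comp hF.carrier hiL, carrier_ampObj]
  have hrc : (comp G (injR m A.carrier B.carrier)).carrier =
      bi C.carrier (ampObj A B).carrier := by
    rw [carrier_comp hG.carrier hiR, carrier_ampObj]
  -- If `A^⊥` or `B^⊥` is empty, then the elements of `A` or of `B` need not have wager `0`, but
  -- there is nothing to be required from the corresponding component.
  by_cases hA' : ∃ a, a ∈ A.orth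
  swap
  · refine ⟨_, hrc, fun c hc => ⟨fun a ha => absurd ⟨a, ha⟩ hA', fun b hb => ?_⟩⟩
    rw [hr c hc, sca_tp_zero_left]
  by_cases hB' : ∃ b, b ∈ B.orth
  swap
  · refine ⟨_, hlc, fun c hc => ⟨fun a ha => ?_, fun b hb => absurd ⟨b, hb⟩ hB'⟩⟩
    rw [hl c hc, sca_tp_zero_right]
  obtain ⟨a₀, ha₀⟩ := hA'
  obtain ⟨b₀, hb₀⟩ := hB'
  obtain ⟨H, hH, hH'⟩ := exists_add (comp F (injL m A.carrier B.carrier))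
    (comp G (injR m A.carrier B.carrier)) (hrc.trans hlc.symm) 1
  have hHc := hH.trans hlc
  refine ⟨H, hHc, fun c hc => ?_⟩
  have hf := hF.act_mem c hc
  have hg := hG.act_mem c hc
  constructor
  · intro a ha
    rw [sca_act_add hlc hrc hHc hH' (carrier_eq_of_mem hc), hl c hc, hr c hc, sca_tp_zero_right,
      Proj.sca_comm (tp (Proj.zero m A.carrier) _),
      sca_tp_zero_zero (hA _ hf a ha).2 (hB _ hg b₀ hb₀).1, add_zero]
  · intro b hb
    rw [sca_act_add hlc hrc hHc hH' (carrier_eq_of_mem hc), hl c hc, hr c hc, sca_tp_zero_left,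
      sca_tp_zero_zero (hA _ hf a₀ ha₀).1 (hB _ hg b hb).2, zero_add]

/-- The copairing of `F` and `G`, dual to the pairing: the sum of their compositions with the
projections, or one of the two if `A` or `B` is empty. -/
theorem exists_copair (hA : A.IsBehaviour) (hB : B.IsBehaviour) {F G : Proj m Two}
    (hF : IsHom A C F) (hG : IsHom B C G) : ∃ H, IsHom (plusObj A B) C H ∧ ∀ c ∈ C.orth,
      (∀ a ∈ A, (act H (tp a (Proj.zero m B.carrier))).sca c = (act F a).sca c) ∧
      ∀ b ∈ B, (act H (tp (Proj.zero m A.carrier) b)).sca c = (act G b).sca c := by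
  rw [isBehaviour_iff] at hA hB
  suffices h : ∃ H : Proj m Two, H.carrier = bi (plusObj A B).carrier C.carrier ∧ ∀ c ∈ C.orth,
      (∀ a ∈ A, (act H (tp a (Proj.zero m B.carrier))).sca c = (act F a).sca c) ∧
      ∀ b ∈ B, (act H (tp (Proj.zero m A.carrier) b)).sca c = (act G b).sca c by
    obtain ⟨H, hH, h⟩ := h
    refine ⟨H, isHom_of_gen (isGen_plusObj A B) (isGen_self _) hH ?_, h⟩
    rintro _ (⟨a, ha, rfl⟩ | ⟨b, hb, rfl⟩) c hc
    · have := perp_of_mem (hF.act_mem a ha) hc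
      unfold Perp at this ⊢
      rwa [← (h c hc).1 a ha] at this
    · have := perp_of_mem (hG.act_mem b hb) hc
      unfold Perp at this ⊢
      rwa [← (h c hc).2 b hb] at this
  have hpL := carrier_projL (m := m) (V := A.carrier) (W := B.carrier)
  have hpR := carrier_projR (m := m) (V := A.carrier) (W := B.carrier)
  have hl : ∀ x : Proj m ℕ, x.carrier = A.carrier.image ev ∪ B.carrier.image od → ∀ c ∈ C.orth,
      (act (comp (projL m A.carrier B.carrier) F) x).sca c =
        (tp (coact F c) (Proj.zero m B.carrier)).sca x := fun x hx c hc => by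
    rw [act_comp hpL hF.carrier hx, act_projL hx, sca_act_eq_sca_coact hF.carrier
      (carrier_resL hx) (carrier_eq_of_mem (A := C.orth) hc), sca_resL hx]
  have hr : ∀ x : Proj m ℕ, x.carrier = A.carrier.image ev ∪ B.carrier.image od → ∀ c ∈ C.orth,
      (act (comp (projR m A.carrier B.carrier) G) x).sca c =
        (tp (Proj.zero m A.carrier) (coact G c)).sca x := fun x hx c hc => by
    rw [act_comp hpR hG.carrier hx, act_projR hx, sca_act_eq_sca_coact hG.carrier
      (carrier_resR hx) (carrier_eq_of_mem (A := C.orth) hc), sca_resR hx]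
  have hca : ∀ a ∈ A, (tp a (Proj.zero m B.carrier)).carrier =
      A.carrier.image ev ∪ B.carrier.image od := fun a ha => by
    rw [carrier_tp, carrier_eq_of_mem ha, carrier_zero]
  have hcb : ∀ b ∈ B, (tp (Proj.zero m A.carrier) b).carrier =
      A.carrier.image ev ∪ B.carrier.image od := fun b hb => by
    rw [carrier_tp, carrier_eq_of_mem hb, carrier_zero]
  have hla : ∀ a ∈ A, ∀ c ∈ C.orth, (tp (coact F c) (Proj.zero m B.carrier)).sca
      (tp a (Proj.zero m B.carrier)) = (act F a).sca c := fun a ha c hc => by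
    rw [sca_tp_zero_right, Proj.sca_comm, sca_act_eq_sca_coact hF.carrier (carrier_eq_of_mem ha)
      (carrier_eq_of_mem (A := C.orth) hc)]
  have hrb : ∀ b ∈ B, ∀ c ∈ C.orth, (tp (Proj.zero m A.carrier) (coact G c)).sca
      (tp (Proj.zero m A.carrier) b) = (act G b).sca c := fun b hb c hc => by
    rw [sca_tp_zero_left, Proj.sca_comm, sca_act_eq_sca_coact hG.carrier (carrier_eq_of_mem hb)
      (carrier_eq_of_mem (A := C.orth) hc)]
  have hlc : (comp (projL m A.carrier B.carrier) F).carrier =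
      bi (plusObj A B).carrier C.carrier := by
    rw [carrier_comp hpL hF.carrier, carrier_plusObj]
  have hrc : (comp (projR m A.carrier B.carrier) G).carrier =
      bi (plusObj A B).carrier C.carrier := by
    rw [carrier_comp hpR hG.carrier, carrier_plusObj]
  by_cases hA' : ∃ a, a ∈ A
  swap
  · refine ⟨_, hrc, fun c hc => ⟨fun a ha => absurd ⟨a, ha⟩ hA', fun b hb => ?_⟩⟩
    rw [hr _ (hcb b hb) c hc, hrb b hb c hc]
  by_cases hB' : ∃ b, b ∈ B
  swap
  · refine ⟨_, hlc, fun c hc => ⟨fun a ha => ?_, fun b hb => absurd ⟨b, hb⟩ hB'⟩⟩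
    rw [hl _ (hca a ha) c hc, hla a ha c hc]
  obtain ⟨a₀, ha₀⟩ := hA'
  obtain ⟨b₀, hb₀⟩ := hB'
  obtain ⟨H, hH, hH'⟩ := exists_add (comp (projL m A.carrier B.carrier) F)
    (comp (projR m A.carrier B.carrier) G) (hrc.trans hlc.symm) 1
  have hHc := hH.trans hlc
  refine ⟨H, hHc, fun c hc => ⟨fun a ha => ?_, fun b hb => ?_⟩⟩
  · rw [sca_act_add hlc hrc hHc hH' ((hca a ha).trans (carrier_plusObj A B).symm),
      hl _ (hca a ha) c hc, hr _ (hca a ha) c hc, hla a ha c hc, Proj.sca_comm (tp _ (coact G c)),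
      sca_tp_zero_zero (hA a ha _ (hF.coact_mem hc)).1 (hB b₀ hb₀ _ (hG.coact_mem hc)).2, add_zero]
  · rw [sca_act_add hlc hrc hHc hH' ((hcb b hb).trans (carrier_plusObj A B).symm),
      hl _ (hcb b hb) c hc, hr _ (hcb b hb) c hc, hrb b hb c hc,
      sca_tp_zero_zero (hA a₀ ha₀ _ (hF.coact_mem hc)).2 (hB b hb _ (hG.coact_mem hc)).1, zero_add]

theorem exists_comp_projL_projR (hA : A.IsBehaviour) (hB : B.IsBehaviour) (f : Hom C A)
    (g : Hom C B) : ∃ h : Hom C (ampObj A B), h.comp (homMk _ (isHom_projL A B)) = f ∧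
      h.comp (homMk _ (isHom_projR A B)) = g := by
  obtain ⟨F, hF, rfl⟩ := f.exists_homMk
  obtain ⟨G, hG, rfl⟩ := g.exists_homMk
  obtain ⟨H, hH, h⟩ := exists_pair hA hB hF hG
  refine ⟨homMk H hH, Hom.ext_app fun x => ?_, Hom.ext_app fun x => ?_⟩
  all_goals
    obtain ⟨c, hc, rfl⟩ := x.exists_mk
    have h1 := carrier_eq_of_mem_ampObj (hH.act_mem c hc)
    rw [app_comp, app_homMk, app_homMk, app_homMk, El.mk_eq_iff (isGen_self _)]
    intro y hy
  · rw [act_projL h1, sca_resL h1, Proj.sca_comm]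
    exact (h c hc).1 y hy
  · rw [act_projR h1, sca_resR h1, Proj.sca_comm]
    exact (h c hc).2 y hy

theorem hom_ext_ampObj {h k : Hom C (ampObj A B)}
    (h₁ : h.comp (homMk _ (isHom_projL A B)) = k.comp (homMk _ (isHom_projL A B)))
    (h₂ : h.comp (homMk _ (isHom_projR A B)) = k.comp (homMk _ (isHom_projR A B))) : h = k := by
  refine Hom.ext_app fun x => ?_
  have e₁ := congrArg (fun f => f.app x) h₁
  have e₂ := congrArg (fun f => f.app x) h₂
  simp only [app_comp] at e₁ e₂
  obtain ⟨y, hy, hy'⟩ := (h.app x).exists_mk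
  obtain ⟨z, hz, hz'⟩ := (k.app x).exists_mk
  have hyc := carrier_eq_of_mem_ampObj hy
  have hzc := carrier_eq_of_mem_ampObj hz
  rw [hy', hz', app_homMk, app_homMk, El.mk_eq_iff (isGen_self _)] at e₁ e₂
  rw [hy', hz', El.mk_eq_iff (isGen_ampObj_orth A B)]
  rintro _ (⟨a, ha, rfl⟩ | ⟨b, hb, rfl⟩)
  · have := e₁ a ha
    rwa [act_projL hyc, act_projL hzc, sca_resL hyc, sca_resL hzc, Proj.sca_comm,
      Proj.sca_comm _ z] at this
  · have := e₂ b hb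
    rwa [act_projR hyc, act_projR hzc, sca_resR hyc, sca_resR hzc, Proj.sca_comm,
      Proj.sca_comm _ z] at this

theorem exists_injL_injR_comp (hA : A.IsBehaviour) (hB : B.IsBehaviour) (f : Hom A C)
    (g : Hom B C) : ∃ h : Hom (plusObj A B) C, (homMk _ (isHom_injL A B)).comp h = f ∧
      (homMk _ (isHom_injR A B)).comp h = g := by
  obtain ⟨F, hF, rfl⟩ := f.exists_homMk
  obtain ⟨G, hG, rfl⟩ := g.exists_homMk
  obtain ⟨H, hH, h⟩ := exists_copair hA hB hF hG
  refine ⟨homMk H hH, Hom.ext_app fun x => ?_, Hom.ext_app fun x => ?_⟩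
  all_goals
    obtain ⟨c, hc, rfl⟩ := x.exists_mk
    rw [app_comp, app_homMk, app_homMk, app_homMk, El.mk_eq_iff (isGen_self _)]
    intro y hy
  · rw [act_injL (carrier_eq_of_mem hc)]
    exact (h y hy).1 c hc
  · rw [act_injR (carrier_eq_of_mem hc)]
    exact (h y hy).2 c hc

theorem hom_ext_plusObj {h k : Hom (plusObj A B) C}
    (h₁ : (homMk _ (isHom_injL A B)).comp h = (homMk _ (isHom_injL A B)).comp k)
    (h₂ : (homMk _ (isHom_injR A B)).comp h = (homMk _ (isHom_injR A B)).comp k) : h = k := by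
  refine Hom.ext_gen (isGen_plusObj A B) fun s hs => ?_
  obtain ⟨a, ha, rfl⟩ | ⟨b, hb, rfl⟩ := hs
  · have := congrArg (fun f => f.app (El.mk a ha)) h₁
    simp only [app_comp, app_homMk, act_injL (carrier_eq_of_mem ha)] at this
    exact this
  · have := congrArg (fun f => f.app (El.mk b hb)) h₂
    simp only [app_comp, app_homMk, act_injR (carrier_eq_of_mem hb)] at this
    exact this

theorem fstProject_mem (A B : Cond m) : fstProject m A B ∈ HomSet (ampObj A B) A :=
  mem_homSet.2 (isHom_projL A B)

theorem sndProject_mem (A B : Cond m) : sndProject m A B ∈ HomSet (ampObj A B) B :=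
  mem_homSet.2 (isHom_projR A B)

theorem inlProject_mem (A B : Cond m) : inlProject m A B ∈ HomSet A (plusObj A B) :=
  mem_homSet.2 (isHom_injL A B)

theorem inrProject_mem (A B : Cond m) : inrProject m A B ∈ HomSet B (plusObj A B) :=
  mem_homSet.2 (isHom_injR A B)

theorem nonempty_isLimit (hA : A.IsBehaviour) (hB : B.IsBehaviour) :
    Nonempty (IsLimit (BinaryFan.mk
      ((condCat m).behHom (isBehaviour_ampObj hA hB) hA _ (fstProject_mem A B))
      ((condCat m).behHom (isBehaviour_ampObj hA hB) hB _ (sndProject_mem A B)))) := by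
  have e₁ : Hom.mk _ (fstProject_mem A B) = homMk _ (isHom_projL A B) := mk_eq_homMk _ _
  have e₂ : Hom.mk _ (sndProject_mem A B) = homMk _ (isHom_projR A B) := mk_eq_homMk _ _
  have key : ∀ (T : (condCat m).Beh) (f : T ⟶ (condCat m).behObj A hA)
      (g : T ⟶ (condCat m).behObj B hB),
      ∃ h : Hom (m := m) T.obj (ampObj A B), h.comp (Hom.mk _ (fstProject_mem A B)) = f.hom ∧
        h.comp (Hom.mk _ (sndProject_mem A B)) = g.hom := fun T f g => by
    rw [e₁, e₂]
    exact exists_comp_projL_projR (m := m) (C := T.obj) hA hB f.hom g.hom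
  refine ⟨BinaryFan.IsLimit.mk _ (fun {T} f g => ObjectProperty.homMk (key T f g).choose)
    (fun {T} f g => ?_) (fun {T} f g => ?_) (fun {T} f g h h₁ h₂ => ?_)⟩
  · exact ObjectProperty.hom_ext _ (key T f g).choose_spec.1
  · exact ObjectProperty.hom_ext _ (key T f g).choose_spec.2
  · refine ObjectProperty.hom_ext _ (hom_ext_ampObj (m := m) (C := T.obj) ?_ ?_)
    · rw [← e₁]
      exact (congrArg (fun f => f.hom) h₁).trans (key T f g).choose_spec.1.symm
    · rw [← e₂]
      exact (congrArg (fun f => f.hom) h₂).trans (key T f g).choose_spec.2.symm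

theorem nonempty_isColimit (hA : A.IsBehaviour) (hB : B.IsBehaviour) :
    Nonempty (IsColimit (BinaryCofan.mk
      ((condCat m).behHom hA (isBehaviour_plusObj hA hB) _ (inlProject_mem A B))
      ((condCat m).behHom hB (isBehaviour_plusObj hA hB) _ (inrProject_mem A B)))) := by
  have e₁ : Hom.mk _ (inlProject_mem A B) = homMk _ (isHom_injL A B) := mk_eq_homMk _ _
  have e₂ : Hom.mk _ (inrProject_mem A B) = homMk _ (isHom_injR A B) := mk_eq_homMk _ _
  have key : ∀ (T : (condCat m).Beh) (f : (condCat m).behObj A hA ⟶ T)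
      (g : (condCat m).behObj B hB ⟶ T),
      ∃ h : Hom (m := m) (plusObj A B) T.obj, (Hom.mk _ (inlProject_mem A B)).comp h = f.hom ∧
        (Hom.mk _ (inrProject_mem A B)).comp h = g.hom := fun T f g => by
    rw [e₁, e₂]
    exact exists_injL_injR_comp (m := m) (C := T.obj) hA hB f.hom g.hom
  refine ⟨BinaryCofan.IsColimit.mk _ (fun {T} f g => ObjectProperty.homMk (key T f g).choose)
    (fun {T} f g => ?_) (fun {T} f g => ?_) (fun {T} f g h h₁ h₂ => ?_)⟩
  · exact ObjectProperty.hom_ext _ (key T f g).choose_spec.1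
  · exact ObjectProperty.hom_ext _ (key T f g).choose_spec.2
  · refine ObjectProperty.hom_ext _ (hom_ext_plusObj (m := m) (C := T.obj) ?_ ?_)
    · rw [← e₁]
      exact (congrArg (fun f => f.hom) h₁).trans (key T f g).choose_spec.1.symm
    · rw [← e₂]
      exact (congrArg (fun f => f.hom) h₂).trans (key T f g).choose_spec.2.symm

/-! ### The additive units -/

theorem isHom_const_full (C : Cond m) :
    IsHom C (Conduct.full m ∅) (const m (bi C.carrier ∅) 0 1) :=
  ⟨rfl, fun _ hc => mem_full.2 (carrier_act (V := C.carrier) rfl (carrier_eq_of_mem hc))⟩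

theorem isHom_const_zero (C : Cond m) :
    IsHom (Conduct.zero m ∅) C (const m (bi ∅ C.carrier) 0 1) :=
  ⟨rfl, fun _ hc => absurd hc notMem_zero⟩

theorem hom_ext_full {V : Finset ℕ} (f g : Hom C (Conduct.full m V)) : f = g := by
  refine Hom.ext_app fun x => ?_
  obtain ⟨y, hy, hy'⟩ := (f.app x).exists_mk
  obtain ⟨z, hz, hz'⟩ := (g.app x).exists_mk
  rw [hy', hz', El.mk_eq_iff (isGen_self _)]
  exact fun t ht => absurd ht notMem_full_orth

theorem hom_ext_zero {V : Finset ℕ} (f g : Hom (Conduct.zero m V) C) : f = g :=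
  Hom.ext_gen (isGen_self _) fun _ hs => absurd hs notMem_zero

theorem isEmpty_hom_zero {V : Finset ℕ} {x : Proj m ℕ} (hx : x ∈ C) :
    IsEmpty (Hom C (Conduct.zero m V)) := by
  refine ⟨fun f => ?_⟩
  obtain ⟨y, hy, -⟩ := (f.app (El.mk x hx)).exists_mk
  exact notMem_zero hy

/-! ### Failure of mix and of weakening -/

/-- The measurement of `a ⊗ b` and `a' ⊗ b'` is `⟪a, a'⟫ 1_b 1_b' + 1_a 1_a' ⟪b, b'⟫`. -/
theorem not_perp_tp {a b a' b' : Proj m ℕ} (ha : a.sca a' ≠ ⊤) (hb : b.sca b' ≠ ⊤)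
    (h : b.unit * b'.unit = 0) (h' : a.unit * a'.unit = 0) : ¬ (tp a b).Perp (tp a' b') := by
  intro hp
  apply hp.1
  rw [sca_tp, h, h', mulTop_zero_left ha, mulTop_zero_left hb, add_zero]

/-- There are `a' ∈ A^⊥` and `b' ∈ B^⊥` whose units are `0`; then `a ⊗ b` is not orthogonal to `a' ⊗
b'`. -/
theorem tp_notMem_parObj (hA : A.IsProper) (hB : B.IsProper) {a b : Proj m ℕ} (ha : a ∈ A)
    (hb : b ∈ B) : tp a b ∉ parObj A B := by
  intro h
  obtain ⟨a', ha', hau, -⟩ := hA.exists_mem_orth_unit_eq_zero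
  obtain ⟨b', hb', hbu, -⟩ := hB.exists_mem_orth_unit_eq_zero
  refine not_perp_tp (perp_of_mem ha ha').2 (perp_of_mem hb hb').2
    (by rw [hbu, MulZeroClass.mul_zero]) (by rw [hau, MulZeroClass.mul_zero]) ?_
  exact perp_comm.1 (perp_of_mem (tp_mem ha' hb') h)

/-- On the empty carrier, the measurement only involves the wagers and the units. -/
theorem not_perp_of_unit_eq_zero {x y : Proj m ℕ} (hx : x.carrier = ∅) (hx' : x.unit = 0)
    (hy' : y.unit = 0) : ¬ x.Perp y := by
  intro h
  have e := sca_of_disjoint (x := x) (y := y) (by rw [hx]; exact Finset.disjoint_empty_left _)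
  rw [hx', hy', ← mulTop_add] at e
  have h1 : x.wager + y.wager ≠ ⊤ := fun h' => h.2 (by rw [e, h', mulTop_top])
  exact h.1 (by rw [e, mulTop_zero_left h1])

theorem const_mem_counitObj : const m ∅ 1 0 ∈ counitObj m := by
  refine isGen_unitObj.mem_orth _ rfl ?_
  rintro _ rfl
  unfold Perp
  rw [zero_sca, wager_const]
  exact ⟨one_ne_zero, WithTop.one_ne_top⟩

/-- There is no morphism to `1_∅` from a conduct with a project whose unit is `0`: the unit of the
image would be `0` as well. -/
theorem isEmpty_hom_unitObj {x : Proj m ℕ} (hx : x ∈ C) (h : x.unit = 0) :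
    IsEmpty (Hom C (unitObj m)) := by
  refine ⟨fun f => ?_⟩
  obtain ⟨F, hF, rfl⟩ := f.exists_homMk
  have h1 := hF.act_mem x hx
  refine not_perp_of_unit_eq_zero (carrier_eq_of_mem h1) ?_ unit_const
    (perp_of_mem h1 const_mem_counitObj)
  rw [act, unit_map, unit_mul, unit_map, h, MulZeroClass.mul_zero]

/-- A nonempty behaviour has a project of wager and unit `0`. -/
theorem exists_mem_wager_unit_eq_zero (hC : C.IsBehaviour) {x : Proj m ℕ} (hx : x ∈ C) :
    ∃ z ∈ C, z.unit = 0 ∧ z.wager = 0 := by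
  by_cases h : ∃ y, y ∈ C.orth
  · obtain ⟨y, hy⟩ := h
    obtain ⟨z, hz, h1, h2⟩ := hC.exists_unit_eq_zero hx
    exact ⟨z, hz, h1, h2.trans (isBehaviour_iff.1 hC x hx y hy).1⟩
  · push Not at h
    exact ⟨const m C.carrier 0 0, eq_full_of_orth_empty h rfl, unit_const, rfl⟩

/-- The relocation of the source of a morphism to the first factor of a tensor product. -/
def weakMap (p : Two) : Two := if p.2 = 0 then ψ 0 (ev p.1) else p

theorem weakMap_injective : Function.Injective weakMap := by
  rintro ⟨x, i⟩ ⟨y, j⟩ h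
  fin_cases i <;> fin_cases j <;> simp_all [weakMap, ψ, ev]

/-- The project of the weakening of a morphism. -/
noncomputable def weak (W : Finset ℕ) (F : Proj m Two) : Proj m Two :=
  F.map weakMap * Proj.zero m (W.image (ψ 0 ∘ od))

theorem mk_weakProject (f : Project Two) (C : Cond m) :
    Proj.mk m (weakProject f C) = weak C.carrier (Proj.mk m f) := rfl

theorem act_weak {F : Proj m Two} {U V W : Finset ℕ} (hF : F.carrier = bi V U) {x : Proj m ℕ}
    (hx : x.carrier = V.image ev ∪ W.image od) : act (weak W F) x = act F (resL W x) := by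
  have h1 : Proj.zero m (W.image (ψ 0 ∘ od)) * x.map (ψ 0) =
      ((resL W x).map (ψ 0)).map weakMap := by
    rw [map_map]
    change _ = (resL W x).map (ψ 0 ∘ ev)
    rw [← map_map, map_resL hx, map_mul_of_injective (ψ_injective 0), Proj.map_zero,
      Finset.image_image]
  have h2 : Disjoint (F.map weakMap).carrier (Proj.zero m (W.image (ψ 0 ∘ od))).carrier := by
    rw [carrier_map, carrier_zero, hF, bi, Finset.image_union, Finset.image_image,
      Finset.image_image, Finset.disjoint_union_left]
    exact ⟨disjoint_image_of_ne fun x y => ψ_ev_ne_od _ _ x y,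
      disjoint_image_of_ne fun x y => (ψ_ne _ x).symm⟩
  rw [act, weak, mul_assoc_of_disjoint h2, h1, ← map_mul_of_injective weakMap_injective,
    ← map_act hF (carrier_resL hx), map_map, map_map]
  exact map_eq_self fun _ _ => rfl

/-- The image of `a ⊗ z` under the weakening of `f` is the image of `a` under `f`, with a factor `0`
when `z` is a project of `C` of wager and unit `0`. -/
theorem weakProject_notMem {f : Project Two} (hf : f ∈ HomSet A B) (hC : C.IsBehaviour)
    {a b c : Proj m ℕ} (ha : a ∈ A) (hb : b ∈ B.orth) (hc : c ∈ C) :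
    weakProject f C ∉ HomSet (tensorObj A C) B := by
  intro h
  rw [mem_homSet] at hf h
  obtain ⟨z, hz, hu, hw⟩ := exists_mem_wager_unit_eq_zero hC hc
  have hx : (tp a z).carrier = A.carrier.image ev ∪ C.carrier.image od := by
    rw [carrier_tp, carrier_eq_of_mem ha, carrier_eq_of_mem hz]
  have h1 := perp_of_mem (h.act_mem _ (tp_mem ha hz)) hb
  rw [mk_weakProject, act_weak hf.carrier hx] at h1
  apply h1.1
  have h2 := (perp_of_mem ha (hf.coact_mem hb)).2
  rw [Proj.sca_comm] at h2
  rw [sca_act_eq_sca_coact hf.carrier (carrier_resL hx) (carrier_eq_of_mem (A := B.orth) hb),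
    sca_resL hx, sca_tp, hu, MulZeroClass.mul_zero, mulTop_zero_left h2, zero_sca, hw,
    mulTop_zero_right, add_zero]

/-! ### The connectives differ -/

/-- On the left, the tensor product of `0_∅` and `T_∅` is empty, since the first factor is; on the
right, the orthogonal of `T_∅` is empty, so that the conduct contains all projects. -/
theorem tensorObj_ne_parObj_units :
    tensorObj (Conduct.zero m ∅) (Conduct.full m ∅) ≠
      parObj (Conduct.zero m ∅) (Conduct.full m ∅) := by
  intro h
  have h1 : Proj.zero m ∅ ∈ parObj (Conduct.zero m ∅) (Conduct.full m ∅) := by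
    refine eq_full_of_orth_empty (fun y hy => ?_) ?_
    · rw [parObj, orth_orth] at hy
      obtain ⟨b, hb⟩ := (exists_of_mem_tensorObj hy).2
      exact notMem_full_orth hb
    · rw [parObj, carrier_orth, carrier_tensorObj]
      rfl
  rw [← h] at h1
  obtain ⟨a, ha⟩ := (exists_of_mem_tensorObj h1).1
  exact notMem_zero ha

theorem tensorObj_ne_parObj (hA : A.IsProper) (hB : B.IsProper) :
    tensorObj A B ≠ parObj A B := by
  obtain ⟨a, ha⟩ := hA.exists_mem
  obtain ⟨b, hb⟩ := hB.exists_mem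
  intro h
  exact tp_notMem_parObj hA hB ha hb (h ▸ tp_mem ha hb)

/-- For `a ∈ A` and `z ∈ B` of wager and unit `0`, the tensor product `a ⊗ z` is not in `A & B`,
because its restriction to the first factor has measurement `0` against `A^⊥`. -/
theorem tensorObj_ne_ampObj (hA : A.IsProper) (hB : B.IsProper) :
    tensorObj A B ≠ ampObj A B := by
  obtain ⟨a, ha⟩ := hA.exists_mem
  obtain ⟨a', ha'⟩ := hA.exists_mem_orth
  obtain ⟨b, hb⟩ := hB.exists_mem
  obtain ⟨z, hz, hu, hw⟩ := hB.isBehaviour.exists_unit_eq_zero hb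
  intro h
  have h1 : tp a z ∈ ampObj A B := h ▸ tp_mem ha hz
  have h2 := (resL_mem h1)
  have h3 := perp_of_mem h2 ha'
  apply h3.1
  have h4 := (perp_of_mem ha ha').2
  rw [Proj.sca_comm] at h4
  rw [sca_resL (carrier_eq_of_mem_ampObj h1), sca_tp, hu, MulZeroClass.mul_zero,
    mulTop_zero_left h4, zero_sca, hw, hB.wager_eq_zero hb, mulTop_zero_right, add_zero]

end Cond

end IG

namespace IG

open Conduct Proj

/-! ### Existence of proper behaviours -/

namespace Graph

/-- The graph with one vertex and one loop of weight `w`. -/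
def loop (w : Weight) : Graph ℕ where
  verts := {0}
  E := Unit
  countable := inferInstance
  src _ := 0
  tgt _ := 0
  src_mem _ := Finset.mem_singleton_self 0
  tgt_mem _ := Finset.mem_singleton_self 0
  weight _ := w

variable {v w : Weight}

theorem follows_loop :
    (Follows (loop v) (loop w) : Unit ⊕ Unit → Unit ⊕ Unit → Prop) =
      fun x y : Unit ⊕ Unit => y = Sum.swap (α := Unit) (β := Unit) x := by
  have h : ∀ x y : Unit ⊕ Unit, x.isLeft ≠ y.isLeft ↔ y = x.swap := by decide
  funext x y
  refine propext ⟨fun h' => (h x y).1 h'.2, fun h' => ⟨?_, (h x y).2 h'⟩⟩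
  rcases x with x | x <;> rcases y with y | y <;> rfl

/-- A closed alternating path of two loops is a power of the path of length `2`. -/
theorem eq_flatten_of_isChain_swap (x : Unit ⊕ Unit) :
    ∀ l : List (Unit ⊕ Unit), (x :: (l ++ [x])).IsChain (fun x y => y = x.swap) →
      ∃ k, x :: l = (List.replicate (k + 1) [x, x.swap]).flatten
  | [], h => by
    simp only [List.nil_append, List.isChain_cons_cons] at h
    rcases x with x | x <;> simp at h
  | [y], h => by
    simp only [List.cons_append, List.isChain_cons_cons] at h
    exact ⟨0, by rw [h.1]; rfl⟩
  | y :: z :: t, h => by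
    simp only [List.cons_append, List.isChain_cons_cons] at h
    obtain ⟨rfl, rfl, h⟩ := h
    rw [Sum.swap_swap] at h ⊢
    obtain ⟨k, hk⟩ := eq_flatten_of_isChain_swap x t h
    refine ⟨k + 1, ?_⟩
    rw [List.replicate_succ, List.flatten_cons, ← hk]
    rfl

/-- Two loops have only one `1`-circuit. -/
theorem isOneCircuit_loop {c : Cycle (Unit ⊕ Unit)} :
    IsOneCircuit (loop v) (loop w) c ↔
      c = (([Sum.inl (), Sum.inr ()] : List (Unit ⊕ Unit)) : Cycle (Unit ⊕ Unit)) := by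
  change (c ≠ Cycle.nil ∧ c.Chain (Follows (loop v) (loop w) : Unit ⊕ Unit → Unit ⊕ Unit → Prop) ∧
    ∀ (ρ : List (Unit ⊕ Unit)) (k : ℕ),
      ((List.replicate k ρ).flatten : Cycle (Unit ⊕ Unit)) = c → k = 1) ↔ _
  rw [follows_loop]
  constructor
  · rintro ⟨h1, h2, h3⟩
    induction c using Quotient.inductionOn' with
    | _ l =>
      rcases l with _ | ⟨x, l⟩
      · exact absurd rfl h1
      obtain ⟨k, hk⟩ := eq_flatten_of_isChain_swap x l ((Cycle.chain_coe_cons _ _ _).1 h2)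
      have h4 := h3 [x, x.swap] (k + 1) (by rw [← hk]; rfl)
      obtain rfl : k = 0 := by omega
      refine (congrArg (Cycle.ofList (α := Unit ⊕ Unit)) hk).trans ?_
      rcases x with ⟨⟩ | ⟨⟩
      · rfl
      · exact Cycle.coe_eq_coe.2 ⟨1, rfl⟩
  · rintro rfl
    refine ⟨?_, ?_, ?_⟩
    · intro h
      exact absurd (congrArg Cycle.length h) (by simp)
    · refine (Cycle.chain_coe_cons (α := Unit ⊕ Unit) _ _ _).2 ?_
      exact .cons_cons rfl (.cons_cons rfl (.singleton _))
    · intro ρ k h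
      rw [Cycle.coe_eq_coe] at h
      have hl : k * ρ.length = 2 := by simpa using h.perm.length_eq
      have key : ∀ x : Unit ⊕ Unit, x ∈ ρ := by
        intro x
        have : x ∈ (List.replicate k ρ).flatten :=
          h.mem_iff.2 (by rcases x with ⟨⟩ | ⟨⟩ <;> simp)
        simp only [List.mem_flatten, List.mem_replicate] at this
        obtain ⟨_, ⟨-, rfl⟩, hx⟩ := this
        exact hx
      have h1 := key (Sum.inl ())
      have h2 := key (Sum.inr ())
      rcases ρ with _ | ⟨x, _ | ⟨y, ρ⟩⟩
      · simp at h1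
      · simp only [List.mem_singleton] at h1 h2
        exact absurd (h1.trans h2.symm) (by simp)
      · simp only [List.length_cons] at hl
        rcases k with _ | _ | k
        · simp at hl
        · rfl
        · exfalso
          have : 2 * 2 ≤ (k + 1 + 1) * (ρ.length + 1 + 1) := Nat.mul_le_mul (by omega) (by omega)
          omega

theorem meas_loop (m : Weight → ℝ≥0∞) : meas m (loop v) (loop w) = m (v * w) := by
  refine (tsum_eq_single (⟨_, isOneCircuit_loop.2 rfl⟩ :
    {c // IsOneCircuit (loop v) (loop w) c}) fun c hc =>
      absurd (Subtype.ext (isOneCircuit_loop.1 c.2)) hc).trans ?_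
  congr 1
  change (v * (w * 1) : Weight) = v * w
  rw [mul_one]

theorem meas_eq_zero_or_top {L : Type} {m : Weight → ℝ≥0∞} (h : ∀ w, m w = 0 ∨ m w = ∞)
    (F G : Graph L) : meas m F G = 0 ∨ meas m F G = ∞ := by
  by_cases h' : ∃ c : {c : Cycle (PlugE F G) // IsOneCircuit F G c},
      m (circuitWeight F G c.1) = ∞
  · exact Or.inr (ENNReal.tsum_eq_top_of_eq_top h')
  · push Not at h'
    exact Or.inl (ENNReal.tsum_eq_zero.2 fun c => (h _).resolve_right (h' c))

end Graph

theorem ennToTop_eq_zero_iff {x : ℝ≥0∞} : ennToTop x = 0 ↔ x = 0 := by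
  unfold ennToTop
  split_ifs with h
  · simp [h]
  · rw [← WithTop.coe_zero, WithTop.coe_inj, ENNReal.toReal_eq_zero_iff]
    simp [h]

theorem ennToTop_eq_top_iff {x : ℝ≥0∞} : ennToTop x = ⊤ ↔ x = ∞ := by
  unfold ennToTop
  split_ifs with h <;> simp [h]

namespace Cond

variable {m : Weight → ℝ≥0∞}

/-- If `m` takes only the values `0` and `∞`, then so does the measurement of two projects of wager
`0`. -/
theorem exists_ne_of_isProper {A : Cond m} (h : A.IsProper) : ∃ x, m x ≠ 0 ∧ m x ≠ ∞ := by
  by_contra! hm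
  obtain ⟨x, hx⟩ := h.exists_mem
  obtain ⟨y, hy⟩ := h.exists_mem_orth
  have hp := perp_of_mem hx hy
  have hw := isBehaviour_iff.1 h.isBehaviour x hx y hy
  obtain ⟨a, rfl⟩ := exists_rep x
  obtain ⟨b, rfl⟩ := exists_rep y
  have e : (Proj.mk m a).sca (Proj.mk m b) = Project.meas m a b := by
    have h1 : a.wager = 0 := hw.1
    have h2 : b.wager = 0 := hw.2
    rw [sca_mk, Project.sca, h1, h2, mulTop_zero_right, mulTop_zero_right, zero_add, zero_add]
  unfold Perp at hp
  rw [e] at hp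
  have h1 : Project.meas m a b = 0 ∨ Project.meas m a b = ⊤ := by
    refine Finset.sum_induction _ (fun t : WithTop ℝ => t = 0 ∨ t = ⊤) ?_ (Or.inl rfl) ?_
    · rintro s t (rfl | rfl) (rfl | rfl) <;> simp
    · intro p _
      rcases Graph.meas_eq_zero_or_top (fun w => or_iff_not_imp_left.2 (hm w)) (a.slice p.1)
        (b.slice p.2) with h | h
      · exact Or.inl (by rw [h, ennToTop_zero, mulTop_zero_right])
      · exact Or.inr (by rw [h, mulTop_eq_top, ennToTop_eq_top_iff])
  exact h1.elim hp.1 hp.2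

theorem sca_single (F G : Graph ℕ) : (Proj.mk m (Project.single 0 F)).sca
    (Proj.mk m (Project.single 0 G)) = ennToTop (Graph.meas m F G) := by
  change mulTop _ 0 + mulTop _ 0 +
    ∑ p : Unit × Unit, mulTop (1 * 1) (ennToTop (Graph.meas m F G)) = _
  simp

/-- The orthogonal of the projects `loop w + r 0`, `r ∈ ℝ`. Including all `r` among the generators
forces the wagers of the orthogonal to be `0`; since the generators have wager `0`, it is closed
under `y ↦ y + r 0`; and it contains the loop of weight `1`. -/
theorem exists_isProper {w : Weight} (h0 : m w ≠ 0) (h1 : m w ≠ ∞) :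
    ∃ A : Cond m, A.IsProper := by
  let G : Project ℕ := Project.single 0 (Graph.loop w)
  let S : Set (Project ℕ) := {c | ∃ r, c = G.addSmul r (Project.zero G.carrier) rfl}
  let B : Cond m := Conduct.gen m {0} S
  have hB : B.IsGen {x | ∃ a ∈ S, Proj.mk m a = x} :=
    isGen_gen _ (by rintro _ ⟨r, rfl⟩; rfl)
  have hs : ∀ r, (Proj.mk m G).shift r ∈ B := fun r =>
    mk_addSmul_mem.1 (mk_mem.1 (hB.mem _ ⟨_, ⟨r, rfl⟩, rfl⟩))
  have hne : Proj.mk m (Project.single 0 (Graph.loop 1)) ∈ B.orth := by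
    refine hB.mem_orth _ rfl ?_
    rintro _ ⟨_, ⟨r, rfl⟩, rfl⟩
    unfold Perp
    rw [sca_mk_addSmul, sca_single, Graph.meas_loop, mul_one]
    change _ + mulTop r 0 ≠ 0 ∧ _ + mulTop r 0 ≠ ⊤
    rw [mulTop_zero_right, add_zero, ne_eq, ennToTop_eq_zero_iff, ne_eq, ennToTop_eq_top_iff]
    exact ⟨h0, h1⟩
  refine ⟨B.orth, fun a ha r => ?_, fun a ha => ?_, nonempty_projects_iff.2 ⟨_, hne⟩⟩
  · refine forall_addSmul_mem.2 (fun x hx => Conduct.shift_mem (fun y hy => ?_) hx r) a ha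
    rw [orth_orth] at hy
    refine hB.wager_eq_zero ?_ hne hy
    rintro _ ⟨_, ⟨r, rfl⟩, rfl⟩
    change (0 : WithTop ℝ) + mulTop r 0 = 0
    rw [mulTop_zero_right, add_zero]
  · exact wager_eq_zero_of_shift_mem hs (mk_mem.2 ha)

end Cond

end IG

theorem mainTheorem2 (m : Set.Ioc (0 : ℝ) 1 → ℝ≥0∞) :
    ∃ c : CondCat m,
      -- the category of conducts up to observational equivalence is `∗`-autonomous
      Nonempty c.StarAutonomous ∧
      -- its full subcategory `c.Beh` is closed under tensor product, internal hom and duality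
      (∀ A B : Cond m, A.IsBehaviour → B.IsBehaviour →
        (Cond.tensorObj A B).IsBehaviour ∧ (Cond.lolliObj A B).IsBehaviour ∧
          A.orth.IsBehaviour) ∧
      -- `A &̄ B` is a product in `c.Beh`
      (∀ (A B : Cond m) (hA : A.IsBehaviour) (hB : B.IsBehaviour),
        ∃ (h : (Cond.ampObj A B).IsBehaviour)
          (h₁ : Cond.fstProject m A B ∈ Cond.HomSet (Cond.ampObj A B) A)
          (h₂ : Cond.sndProject m A B ∈ Cond.HomSet (Cond.ampObj A B) B),
          Nonempty (IsLimit (BinaryFan.mk (c.behHom h hA _ h₁) (c.behHom h hB _ h₂)))) ∧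
      -- `A ⊕̄ B` is a coproduct in `c.Beh`
      (∀ (A B : Cond m) (hA : A.IsBehaviour) (hB : B.IsBehaviour),
        ∃ (h : (Cond.plusObj A B).IsBehaviour)
          (h₁ : Cond.inlProject m A B ∈ Cond.HomSet A (Cond.plusObj A B))
          (h₂ : Cond.inrProject m A B ∈ Cond.HomSet B (Cond.plusObj A B)),
          Nonempty (IsColimit (BinaryCofan.mk (c.behHom hA h _ h₁) (c.behHom hB h _ h₂)))) ∧
      -- the additive units: `T_∅` is terminal and `0_∅` is initial in `c.Beh`, and they differ
      (∃ (ht : (Conduct.full m (∅ : Finset ℕ)).IsBehaviour)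
          (hz : (Conduct.zero m (∅ : Finset ℕ)).IsBehaviour),
        Nonempty (IsTerminal (c.behObj _ ht)) ∧ Nonempty (IsInitial (c.behObj _ hz)) ∧
          IsEmpty (c.behObj _ ht ≅ c.behObj _ hz)) ∧
      -- mix fails: for all projects of all proper behaviours, and at the level of the units
      (∀ A B : Cond m, A.IsProper → B.IsProper → ∀ a ∈ A.projects, ∀ b ∈ B.projects,
        Cond.mixProject m a b ∉ (Cond.parObj A B).projects) ∧
      IsEmpty (c.obj (Cond.counitObj m) ⟶ c.obj (Cond.unitObj m)) ∧
      -- weakening by a non-empty behaviour `C` fails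
      (∀ A B C : Cond m, A.projects.Nonempty → B.orth.projects.Nonempty →
        C.IsBehaviour → C.projects.Nonempty → ∀ f ∈ Cond.HomSet A B,
          Cond.weakProject f C ∉ Cond.HomSet (Cond.tensorObj A C) B) ∧
      (∀ C : Cond m, C.IsBehaviour → C.projects.Nonempty →
        IsEmpty (c.obj C ⟶ c.obj (Cond.unitObj m))) ∧
      -- the connectives differ
      (∃ A B : Cond m, A.IsBehaviour ∧ B.IsBehaviour ∧
        Cond.tensorObj A B ≠ Cond.parObj A B) ∧
      (∀ A B : Cond m, A.IsProper → B.IsProper →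
        Cond.tensorObj A B ≠ Cond.parObj A B ∧ Cond.tensorObj A B ≠ Cond.ampObj A B) ∧
      -- proper behaviours are behaviours, and they exist if and only if `m` takes a value
      -- other than `0` and `∞`
      (∀ A : Cond m, A.IsProper → A.IsBehaviour) ∧
      ((∃ A : Cond m, A.IsProper) ↔ ∃ x, m x ≠ 0 ∧ m x ≠ ∞) := by
  refine ⟨Cond.condCat m, Cond.starAutonomous m, fun A B hA hB => ⟨Cond.isBehaviour_tensorObj hA hB,
    Cond.isBehaviour_lolliObj hA hB, hA.orth⟩,
    fun A B hA hB => ⟨Cond.isBehaviour_ampObj hA hB, Cond.fstProject_mem A B,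
      Cond.sndProject_mem A B, Cond.nonempty_isLimit hA hB⟩,
    fun A B hA hB => ⟨Cond.isBehaviour_plusObj hA hB, Cond.inlProject_mem A B,
      Cond.inrProject_mem A B, Cond.nonempty_isColimit hA hB⟩,
    ⟨Conduct.isBehaviour_full _, Conduct.isBehaviour_zero _, ⟨?_⟩, ⟨?_⟩, ⟨fun e => ?_⟩⟩,
    fun A B hA hB a ha b hb => ?_, ?_, fun A B C hA hB hC hC' f hf => ?_, fun C hC hC' => ?_,
    ⟨Conduct.zero m ∅, Conduct.full m ∅, Conduct.isBehaviour_zero _, Conduct.isBehaviour_full _,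
      Cond.tensorObj_ne_parObj_units⟩,
    fun A B hA hB => ⟨Cond.tensorObj_ne_parObj hA hB, Cond.tensorObj_ne_ampObj hA hB⟩,
    fun A hA => hA.isBehaviour, fun ⟨A, hA⟩ => Cond.exists_ne_of_isProper hA,
    fun ⟨w, h0, h1⟩ => Cond.exists_isProper h0 h1⟩
  · exact IsTerminal.ofUniqueHom
      (fun X => ObjectProperty.homMk (Cond.homMk _ (Cond.isHom_const_full (m := m) X.obj)))
      fun X f => ObjectProperty.hom_ext _ (Cond.hom_ext_full (m := m) (C := X.obj) _ _)
  · exact IsInitial.ofUniqueHom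
      (fun X => ObjectProperty.homMk (Cond.homMk _ (Cond.isHom_const_zero (m := m) X.obj)))
      fun X f => ObjectProperty.hom_ext _ (Cond.hom_ext_zero (m := m) (C := X.obj) _ _)
  · have hx : Proj.zero m ∅ ∈ Conduct.full m (∅ : Finset ℕ) := Conduct.mem_full.2 rfl
    exact (Cond.isEmpty_hom_zero hx).false e.hom.hom
  · rw [← Conduct.mk_mem, Proj.mk_mixProject]
    exact Cond.tp_notMem_parObj hA hB (Conduct.mk_mem.2 ha) (Conduct.mk_mem.2 hb)
  · exact Cond.isEmpty_hom_unitObj Cond.const_mem_counitObj Proj.unit_const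
  · obtain ⟨a, ha⟩ := Conduct.nonempty_projects_iff.1 hA
    obtain ⟨b, hb⟩ := Conduct.nonempty_projects_iff.1 hB
    obtain ⟨x, hx⟩ := Conduct.nonempty_projects_iff.1 hC'
    exact Cond.weakProject_notMem hf hC ha hb hx
  · obtain ⟨x, hx⟩ := Conduct.nonempty_projects_iff.1 hC'
    obtain ⟨z, hz, hu, -⟩ := Cond.exists_mem_wager_unit_eq_zero hC hx
    exact Cond.isEmpty_hom_unitObj hz hu
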